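/- Let $d\ge 1$ be an integer, $d/2<p<\min\{2,d\}$, and let $D\subset\mathbb R^d$ be a nonempty bounded open set. Let $W^{1,2}(D)$ be the closure of $C_c^\infty(D)$ under the norm $(\|g\|_{L^2(D)}^2+\|\nabla g\|_{L^2(D)}^2)^{1/2}$, put $$\mathcal G_d(D)=\Bigl\{g\in W^{1,2}(D):\ \|g\|_{L^2(D)}^2+\tfrac12\|\nabla g\|_{L^2(D)}^2=1\Bigr\},\qquad \rho^*_D=\sup_{g\in\mathcal G_d(D)}\sup_{x\in\mathbb R^d}\int_D\frac{g^2(y)}{|y-x|^p}\,dy .$$ Let $\omega$ be a Poisson field on $\mathbb R^d$ with Lebesgue intensity, defined on a probability space with law $\mathbb P$. For $\epsilon>0$ let $\omega(\epsilon\,dx)$ be the contracted field, whose value on a Borel set $A$ is $\omega(\epsilon^{1/d}A)$; it is a Poisson field with intensity $\epsilon\,dx$. For a function $f$ on $\mathbb R^d$ the compensated integral $\int_{\mathbb R^d} f(x)[\omega(\epsilon\,dx)-\epsilon\,dx]$ is the limit, as $n\to\infty$ through the integers, of $\int_{\{|x|\le n\}}f(x)\,\omega(\epsilon\,dx)-\epsilon\int_{\{|x|\le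 n\}}f(x)\,dx$. Let $\alpha:[0,\infty)\to[0,1]$ be smooth with $\alpha=1$ on $[0,1]$, $\alpha=0$ on $[3,\infty)$ and $-1\le\alpha'\le0$. For $a>0$, $0<\epsilon<1$ and $g\in\mathcal G_d(D)$ let $$K^{(1)}_{a,\epsilon}(x)=\frac{\alpha\bigl(a^{-1}(\log\epsilon^{-1})^{-1/p}|x|\bigr)}{|x|^p},\qquad L^{(1)}_{a,\epsilon}(x)=\frac{1}{|x|^p}-K^{(1)}_{a,\epsilon}(x),$$ $$G^{(1)}_{a,\epsilon}(g)=\int_{\mathbb R^d}\Bigl[\int_D K^{(1)}_{a,\epsilon}(y-x)g^2(y)\,dy\Bigr][\omega(\epsilon\,dx)-\epsilon\,dx],$$ $$F^{(1)}_{a,\epsilon}(g)=\int_{\mathbb R^d}\Bigl[\int_D L^{(1)}_{a,\epsilon}(y-x)g^2(y)\,dy\Bigr][\omega(\epsilon\,dx)-\epsilon\,dx],$$ $$\zeta_\epsilon(g)=\int_{\mathbb R^d}\Bigl[\int_D \frac{g^2(y)}{|y-x|^p}\,dy\Bigr][\omega(\epsilon\,dx)-\epsilon\,dx].$$ **Theorem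 3.2.** Write $l(\epsilon)=\epsilon^{-(2-p)/d}\log(1/\epsilon)$ and $\log 0=-\infty$. Then $0<\rho^*_D<\infty$; for every $a>0$ and $0<\epsilon<1$, almost surely, the integrals $G^{(1)}_{a,\epsilon}(g)$, $F^{(1)}_{a,\epsilon}(g)$ and $\zeta_\epsilon(g)$ are well defined simultaneously for all $g\in\mathcal G_d(D)$; and for every $a>0$ and $\gamma>0$, $$\lim_{\epsilon\to0^+}\frac1{l(\epsilon)}\log\mathbb P\Bigl\{\sup_{g\in\mathcal G_d(D)}\bigl|F^{(1)}_{a,\epsilon}(g)\bigr|\ge\gamma\epsilon^{-(2-p)/d}\Bigr\}=-\infty,$$ $$\lim_{\epsilon\to0^+}\frac1{l(\epsilon)}\log\mathbb P\Bigl\{\sup_{g\in\mathcal G_d(D)}G^{(1)}_{a,\epsilon}(g)\ge\gamma\epsilon^{-(2-p)/d}\Bigr\}=-\frac{2+d-p}{d\,\rho^*_D}\,\gamma,$$ $$\lim_{\epsilon\to0^+}\frac1{l(\epsilon)}\log\mathbb P\Bigl\{\sup_{g\in\mathcal G_d(D)}\zeta_\epsilon(g)\ge\gamma\epsilon^{-(2-p)/d}\Bigr\}=-\frac{2+d-p}{d\,\rho^*_D}\,\gamma.$$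 -/

import Mathlib

open MeasureTheory ProbabilityTheory Filter Topology Set
open scoped ContDiff

noncomputable section

/-- The Euclidean space `ℝ^d`. -/
abbrev Rd (d : ℕ) : Type := EuclideanSpace ℝ (Fin d)

/-! ## The Poisson field -/

/-- `N` is a Poisson random field (Poisson random measure) on `E` with intensity measure `ν`:
it is a random measure, the mass of a measurable set `A` with `ν A < ∞` is a Poisson variable with
parameter `ν A`, and the masses of pairwise disjoint measurable sets are independent. -/
structure IsPoissonField {Ω E : Type*} [MeasurableSpace Ω] [MeasurableSpace E]
    (P : Measure Ω) (N : Ω → Measure E) (ν : Measure E) : Prop where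
  measurable : Measurable N
  map_apply : ∀ A : Set E, MeasurableSet A → ν A ≠ ⊤ →
    P.map (fun w => N w A) = (poissonMeasure (ν A).toNNReal).map (Nat.cast : ℕ → ENNReal)
  indep : ∀ (n : ℕ) (A : Fin n → Set E), (∀ i, MeasurableSet (A i)) →
    Pairwise (fun i j => Disjoint (A i) (A j)) → iIndepFun (fun i w => N w (A i)) P

/-- The contracted field `m(ε dx)`: its value on `A` is `m (ε^{1/d} A)`, i.e. it is the image of
`m` under `x ↦ ε^{-1/d} x`. For `m` the Lebesgue measure this is `ε dx`. -/
def contract {d : ℕ} (ε : ℝ) (m : Measure (Rd d)) : Measure (Rd d) :=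
  m.map (fun x => (ε ^ (-(1 / (d : ℝ)))) • x)

/-! ## The compensated integral `∫ f(x) [μ(dx) - ν(dx)]` -/

/-- The compensated integral over the ball of radius `n` around the origin. -/
def truncInt {d : ℕ} (μ ν : Measure (Rd d)) (f : Rd d → ℝ) (n : ℕ) : ℝ :=
  (∫ x in Metric.closedBall 0 (n : ℝ), f x ∂μ) - ∫ x in Metric.closedBall 0 (n : ℝ), f x ∂ν

/-- The compensated integral `∫ f d(μ - ν)` is well defined: `f` is integrable on balls for both
measures, and the compensated integrals over the balls of radius `n` converge as `n → ∞`. -/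
def CompIntegrable {d : ℕ} (μ ν : Measure (Rd d)) (f : Rd d → ℝ) : Prop :=
  (∀ n : ℕ, IntegrableOn f (Metric.closedBall 0 (n : ℝ)) μ ∧
    IntegrableOn f (Metric.closedBall 0 (n : ℝ)) ν) ∧
  ∃ c : ℝ, Tendsto (truncInt μ ν f) atTop (𝓝 c)

/-- The compensated integral `∫ f(x) [μ(dx) - ν(dx)]`, the limit of the integrals over the balls of
radius `n`. In general neither `∫ f dμ` nor `∫ f dν` is finite. -/
def compInt {d : ℕ} (μ ν : Measure (Rd d)) (f : Rd d → ℝ) : ℝ :=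
  limUnder atTop (truncInt μ ν f)

/-! ## The Sobolev sphere -/

/-- `g` belongs to the Sobolev space `W^{1,2}(D)`, the closure of the smooth functions with compact
support in `D` under the Sobolev norm, and its gradient is `G`. Only the values of `g` and `G` on
`D` matter. -/
structure IsSobolev {d : ℕ} (D : Set (Rd d)) (g : Rd d → ℝ) (G : Rd d → Rd d) : Prop where
  memLp : MemLp g 2 (volume.restrict D)
  memLp_grad : MemLp G 2 (volume.restrict D)
  approx : ∃ φ : ℕ → Rd d → ℝ,
    (∀ n, ContDiff ℝ ∞ (φ n) ∧ HasCompactSupport (φ n) ∧ tsupport (φ n) ⊆ D) ∧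
    Tendsto (fun n => eLpNorm (fun x => φ n x - g x) 2 (volume.restrict D)) atTop (𝓝 0) ∧
    Tendsto (fun n => eLpNorm (fun x => gradient (φ n) x - G x) 2 (volume.restrict D)) atTop (𝓝 0)

/-- `𝒢_d(D)`: the `g ∈ W^{1,2}(D)` with `‖g‖² + ½ ‖∇g‖² = 1` (norms of `L²(D)`). -/
def sobolevSphere {d : ℕ} (D : Set (Rd d)) : Set (Rd d → ℝ) :=
  {g | ∃ G : Rd d → Rd d, IsSobolev D g G ∧
    (∫ x in D, g x ^ 2) + (1 / 2) * ∫ x in D, ‖G x‖ ^ 2 = 1}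

/-- `ρ*_D`, the supremum over `g ∈ 𝒢_d(D)` and `x ∈ ℝ^d` of `∫_D g(y)² / |y - x|^p dy`. -/
def rhoStar {d : ℕ} (p : ℝ) (D : Set (Rd d)) : ENNReal :=
  ⨆ g ∈ sobolevSphere D, ⨆ x : Rd d, ∫⁻ y in D, ENNReal.ofReal (g y ^ 2 / ‖y - x‖ ^ p)

/-! ## Truncated kernels and the Poisson integrals -/

/-- A smooth cutoff `α : [0,∞) → [0,1]` with `α = 1` on `[0,1]`, `α = 0` on `[3,∞)` and
`-1 ≤ α' ≤ 0`. Only the values on `[0,∞)` matter. -/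
structure IsCutoff (α : ℝ → ℝ) : Prop where
  smooth : ContDiffOn ℝ ∞ α (Ici 0)
  mem_Icc : ∀ t ∈ Ici (0 : ℝ), α t ∈ Icc (0 : ℝ) 1
  eq_one : ∀ t ∈ Icc (0 : ℝ) 1, α t = 1
  eq_zero : ∀ t, 3 ≤ t → α t = 0
  deriv_mem : ∀ t ∈ Ici (0 : ℝ), derivWithin α (Ici 0) t ∈ Icc (-1 : ℝ) 0

/-- The Riesz kernel `|x|^{-p}`. -/
def riesz {d : ℕ} (p : ℝ) (x : Rd d) : ℝ := 1 / ‖x‖ ^ p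

/-- `K^{(1)}_{a,ε}(x) = |x|^{-p} α(a⁻¹ (log ε⁻¹)^{-1/p} |x|)`. -/
def kerK {d : ℕ} (p : ℝ) (α : ℝ → ℝ) (a ε : ℝ) (x : Rd d) : ℝ :=
  riesz p x * α (a⁻¹ * Real.log ε⁻¹ ^ (-(1 / p)) * ‖x‖)

/-- `L^{(1)}_{a,ε}(x) = |x|^{-p} (1 - α(a⁻¹ (log ε⁻¹)^{-1/p} |x|))`. -/
def kerL {d : ℕ} (p : ℝ) (α : ℝ → ℝ) (a ε : ℝ) (x : Rd d) : ℝ :=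
  riesz p x * (1 - α (a⁻¹ * Real.log ε⁻¹ ^ (-(1 / p)) * ‖x‖))

/-- The smoothed kernel `x ↦ ∫_D K(y - x) g(y)² dy`. -/
def smear {d : ℕ} (D : Set (Rd d)) (K : Rd d → ℝ) (g : Rd d → ℝ) (x : Rd d) : ℝ :=
  ∫ y in D, K (y - x) * g y ^ 2

/-- `∫ [∫_D K(y - x) g(y)² dy] [m(ε dx) - ε dx]` for a realization `m` of the Poisson field. -/
def poissonInt {d : ℕ} (D : Set (Rd d)) (K : Rd d → ℝ) (ε : ℝ) (m : Measure (Rd d))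
    (g : Rd d → ℝ) : ℝ :=
  compInt (contract ε m) (ENNReal.ofReal ε • volume) (smear D K g)

/-- `poissonInt D K ε m g` is well defined: the inner integrals and the compensated outer integral
exist. -/
def PoissonIntegrable {d : ℕ} (D : Set (Rd d)) (K : Rd d → ℝ) (ε : ℝ) (m : Measure (Rd d))
    (g : Rd d → ℝ) : Prop :=
  (∀ x, IntegrableOn (fun y => K (y - x) * g y ^ 2) D) ∧
  CompIntegrable (contract ε m) (ENNReal.ofReal ε • volume) (smear D K g)

/-- `G^{(1)}_{a,ε}(g)`. -/
def Gone {d : ℕ} (p : ℝ) (α : ℝ → ℝ) (D : Set (Rd d)) (a ε : ℝ) (m : Measure (Rd d))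
    (g : Rd d → ℝ) : ℝ := poissonInt D (kerK p α a ε) ε m g

/-- `F^{(1)}_{a,ε}(g)`. -/
def Fone {d : ℕ} (p : ℝ) (α : ℝ → ℝ) (D : Set (Rd d)) (a ε : ℝ) (m : Measure (Rd d))
    (g : Rd d → ℝ) : ℝ := poissonInt D (kerL p α a ε) ε m g

/-- `ζ_ε(g)`. -/
def zeta {d : ℕ} (p : ℝ) (D : Set (Rd d)) (ε : ℝ) (m : Measure (Rd d)) (g : Rd d → ℝ) : ℝ :=
  poissonInt D (riesz p) ε m g

/-- The supremum over `𝒢_d(D)`, as an extended real number. -/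
def supSphere {d : ℕ} (D : Set (Rd d)) (Φ : (Rd d → ℝ) → ℝ) : EReal :=
  ⨆ g ∈ sobolevSphere D, (Φ g : EReal)

/-- `(1 / l(ε)) log P(A)`, where `l(ε) = ε^{-(2-p)/d} log(1/ε)` and `log 0 = -∞`. -/
def scaledLog {Ω : Type*} [MeasurableSpace Ω] (P : Measure Ω) (d : ℕ) (p ε : ℝ) (A : Set Ω) :
    EReal :=
  ((1 / (ε ^ (-((2 - p) / (d : ℝ))) * Real.log (1 / ε)) : ℝ) : EReal) * ENNReal.log (P A)

end

/-!
The contracted field has intensity `ε dx`, so on bounded sets it usually has no point, and a ball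
of fixed size with `k` points has probability about `exp (-k (log (1/ε) + log k))`. With
`u = ε^{-(2-p)/d}` (`devScale`), `t = log (1/ε)` and `k = c u` this is
`exp (-(1 + (2-p)/d) c u t)`. A point at `x` contributes `∫_D g(y)² / |y - x|^p dy` to the
Poisson integral, at most `ρ = ρ*_D`, and nearly `ρ` near an optimal `x` for an optimal `g`. So the
level `γ u` is reached by `γ u / ρ` points, at the cost `(1 + (2-p)/d) (γ / ρ) u t`, which is the
asserted rate.

* Lower bound (`eventually_le_measure_le_supSphere_Gone`): put these points in a ball on which the
  smoothed kernel of a nearly optimal `g` exceeds a given `b < ρ`; the smoothed kernel is lower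
  semicontinuous by Fatou's lemma.
* Upper bound (`eventually_measure_le_supSphere_Gone`): `Gone` is at most `ρ` times the number of
  points in a ball of radius of the order of `t^{1/p}`, since the truncated kernel vanishes outside.
  The Chernoff bound for this number with an exponent slightly below `(1 + (2-p)/d) t` gives the
  same rate. No entropy bound for the unit sphere of the Sobolev space is needed.
* `Fone` is negligible (`eventually_measure_le_supSphere_Fone`). In the ball of radius
  `ε^{-(1 + (2-p)/d)/d}`, where the mean number of points is of the order of `u`, there are fewer
  points than a given small multiple of `u t`, up to superexponentially small probabilities, and
  each contributes `O(1/t)`. Outside this ball the Taylor expansion of the Riesz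
  kernel, `|y - x|^{-p} = |x|^{-p} + p ⟨x, y⟩ |x|^{-p-2} + O(|x|^{-p-2})`, reduces the integral for
  all `g` simultaneously to the compensated integrals of `|x|^{-p}`, `x_i |x|^{-p-2}` and
  `|x|^{-p-2}`, whose deviations are controlled by Chernoff bounds. Here `p > d/2` makes the square
  of `|x|^{-p}` integrable at infinity. The same expansion, with Borel–Cantelli for the increments
  of these compensated integrals, gives the almost sure convergence of all Poisson integrals
  (`IsPoissonField.ae_tailRegular`). The error term is integrable at
  infinity, since `d < 4` implies `p + 2 > d`.
* `ζ_ε = Gone + Fone`, so that its deviations are those of `Gone`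
  (`tendsto_scaledLog_supSphere_add`).
* `ρ*_D` is finite by Hardy's inequality and `p < min 2 d` (`rhoStar_lt_top`).
-/

noncomputable section

/-! ### Exponential moments of a Poisson field -/

section PoissonField

variable {Ω E : Type*} [MeasurableSpace Ω] [MeasurableSpace E] {P : Measure Ω}
  {N : Ω → Measure E} {ν : Measure E}

theorem lintegral_exp_poissonMeasure (r : NNReal) (c : ℝ) :
    ∫⁻ k, ENNReal.ofReal (Real.exp (c * k)) ∂(poissonMeasure r) =
      ENNReal.ofReal (Real.exp (r * (Real.exp c - 1))) := by
  rw [poissonMeasure, lintegral_sum_measure]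
  simp only [lintegral_smul_measure, lintegral_dirac, smul_eq_mul]
  have h : HasSum (fun n : ℕ => Real.exp (-r) * r ^ n / n.factorial * Real.exp (c * n))
      (Real.exp (r * (Real.exp c - 1))) := by
    have h1 := (NormedSpace.expSeries_div_hasSum_exp ((r : ℝ) * Real.exp c)).mul_left
      (Real.exp (-r))
    rw [← Real.exp_eq_exp_ℝ, ← Real.exp_add] at h1
    have h2 : Real.exp (-r + r * Real.exp c) = Real.exp (r * (Real.exp c - 1)) := by ring_nf
    rw [h2] at h1
    refine h1.congr_fun fun n => ?_
    rw [mul_pow, ← Real.exp_nat_mul, mul_comm c]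
    ring
  rw [← h.tsum_eq, ENNReal.ofReal_tsum_of_nonneg (fun n => by positivity) h.summable]
  congr 1
  ext n
  rw [← ENNReal.ofReal_mul (by positivity)]

theorem IsPoissonField.measurable_apply (h : IsPoissonField P N ν) {A : Set E}
    (hA : MeasurableSet A) : Measurable fun w => N w A :=
  (Measure.measurable_coe hA).comp h.measurable

theorem IsPoissonField.lintegral_exp_real (h : IsPoissonField P N ν) {A : Set E}
    (hA : MeasurableSet A) (hν : ν A ≠ ⊤) (c : ℝ) :
    ∫⁻ w, ENNReal.ofReal (Real.exp (c * (N w).real A)) ∂P =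
      ENNReal.ofReal (Real.exp (ν.real A * (Real.exp c - 1))) := by
  have hg : Measurable fun z : ENNReal => ENNReal.ofReal (Real.exp (c * z.toReal)) := by fun_prop
  have h1 := lintegral_map hg (h.measurable_apply hA) (μ := P)
  simp only [Measure.real]
  rw [← h1, h.map_apply A hA hν, lintegral_map hg (measurable_of_countable _)]
  simp only [ENNReal.toReal_natCast]
  exact lintegral_exp_poissonMeasure (ν A).toNNReal c

theorem IsPoissonField.ae_lt_top (h : IsPoissonField P N ν) {A : Set E}
    (hA : MeasurableSet A) (hν : ν A ≠ ⊤) : ∀ᵐ w ∂P, N w A < ⊤ := by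
  have h1 : ∀ᵐ z ∂(P.map (fun w => N w A)), z < ⊤ := by
    rw [h.map_apply A hA hν, ae_map_iff (measurable_of_countable _).aemeasurable
      measurableSet_Iio]
    simp
  exact ae_of_ae_map (h.measurable_apply hA).aemeasurable h1

theorem IsPoissonField.measure_eq (h : IsPoissonField P N ν) {A : Set E}
    (hA : MeasurableSet A) (hν : ν A ≠ ⊤) (k : ℕ) :
    P {w | N w A = k} =
      ENNReal.ofReal (Real.exp (-ν.real A) * ν.real A ^ k / k.factorial) := by
  have h1 := congrArg (fun m : Measure ENNReal => m {(k : ENNReal)}) (h.map_apply A hA hν)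
  rw [Measure.map_apply (h.measurable_apply hA) (measurableSet_singleton _),
    Measure.map_apply (measurable_of_countable _) (measurableSet_singleton _)] at h1
  have h2 : (Nat.cast : ℕ → ENNReal) ⁻¹' {(k : ENNReal)} = {k} := by
    ext n; simp
  rw [h2, poissonMeasure_singleton] at h1
  exact h1

theorem IsPoissonField.measurable_setIntegral (h : IsPoissonField P N ν) {B : Set E}
    (hB : MeasurableSet B) {f : E → ℝ} (hf : Measurable f) :
    Measurable fun w => ∫ x in B, f x ∂(N w) := by
  have h1 : ∀ g : E → ENNReal, Measurable g → Measurable fun w => ∫⁻ x in B, g x ∂(N w) := by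
    intro g hg
    have h2 : (fun w => ∫⁻ x in B, g x ∂(N w)) = fun w => ∫⁻ x, B.indicator g x ∂(N w) := by
      ext w; rw [lintegral_indicator hB]
    rw [h2]
    exact (Measure.measurable_lintegral (hg.indicator hB)).comp h.measurable
  have hg1 := h1 (fun x => ‖f x‖ₑ) hf.enorm
  have hg2 := h1 (fun x => ENNReal.ofReal (f x)) hf.ennreal_ofReal
  have hg3 := h1 (fun x => ENNReal.ofReal (- f x)) hf.neg.ennreal_ofReal
  have hS : MeasurableSet {w | ∫⁻ x in B, ‖f x‖ₑ ∂(N w) < ⊤} :=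
    measurableSet_lt hg1 measurable_const
  have h3 : (fun w => ∫ x in B, f x ∂(N w)) =
      {w | ∫⁻ x in B, ‖f x‖ₑ ∂(N w) < ⊤}.indicator
        fun w => (∫⁻ x in B, ENNReal.ofReal (f x) ∂(N w)).toReal -
          (∫⁻ x in B, ENNReal.ofReal (- f x) ∂(N w)).toReal := by
    ext w
    by_cases hw : ∫⁻ x in B, ‖f x‖ₑ ∂(N w) < ⊤
    · rw [indicator_of_mem (s := {w | ∫⁻ x in B, ‖f x‖ₑ ∂(N w) < ⊤}) hw]
      exact integral_eq_lintegral_pos_part_sub_lintegral_neg_part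
        ⟨hf.aestronglyMeasurable, hw⟩
    · rw [indicator_of_notMem (s := {w | ∫⁻ x in B, ‖f x‖ₑ ∂(N w) < ⊤}) hw]
      exact integral_undef fun hi => hw hi.2
  rw [h3]
  exact (hg2.ennreal_toReal.sub hg3.ennreal_toReal).indicator hS

theorem IsPoissonField.lintegral_exp_simpleFunc (h : IsPoissonField P N ν) {B : Set E}
    (hB : MeasurableSet B) (hν : ν B ≠ ⊤) (s : SimpleFunc E ℝ) :
    ∫⁻ w, ENNReal.ofReal (Real.exp (∫ x in B, s x ∂(N w))) ∂P =
      ENNReal.ofReal (Real.exp (∫ x in B, (Real.exp (s x) - 1) ∂ν)) := by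
  have key : ∀ m : Measure E, m B < ⊤ →
      ∫ x in B, s x ∂m = ∑ y ∈ s.range, y * m.real (s ⁻¹' {y} ∩ B) ∧
      ∫ x in B, (Real.exp (s x) - 1) ∂m =
        ∑ y ∈ s.range, m.real (s ⁻¹' {y} ∩ B) * (Real.exp y - 1) := by
    intro m hm
    have : IsFiniteMeasure (m.restrict B) := ⟨by simpa using hm⟩
    have hr : ∀ y, (m.restrict B).real (s ⁻¹' {y}) = m.real (s ⁻¹' {y} ∩ B) := fun y => by
      rw [measureReal_restrict_apply (s.measurableSet_fiber y)]
    constructor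
    · rw [SimpleFunc.integral_eq_sum s (SimpleFunc.integrable_of_isFiniteMeasure s)]
      simp only [hr, smul_eq_mul]
      exact Finset.sum_congr rfl fun y _ => mul_comm _ _
    · have h2 : (fun x => Real.exp (s x) - 1) = (s.map fun y => Real.exp y - 1) := by
        ext x; simp
      rw [h2, ← SimpleFunc.integral_eq_integral _ (SimpleFunc.integrable_of_isFiniteMeasure _),
        SimpleFunc.map_integral _ _ (SimpleFunc.integrable_of_isFiniteMeasure _)]
      · simp only [hr, smul_eq_mul]
      · simp
  set e := s.range.equivFin
  set A : Fin s.range.card → Set E := fun i => s ⁻¹' {((e.symm i : s.range) : ℝ)} ∩ B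
  have hA : ∀ i, MeasurableSet (A i) := fun i => (s.measurableSet_fiber _).inter hB
  have hdisj : Pairwise fun i j => Disjoint (A i) (A j) := by
    intro i j hij
    rw [Set.disjoint_left]
    rintro x ⟨hx, -⟩ ⟨hx', -⟩
    simp only [mem_preimage, mem_singleton_iff] at hx hx'
    exact hij (e.symm.injective (Subtype.ext (hx.symm.trans hx')))
  have hfin : ∀ i, ν (A i) ≠ ⊤ := fun i => ne_top_of_le_ne_top hν (measure_mono inter_subset_right)
  have hsum : ∀ F : ℝ → ℝ, ∑ y ∈ s.range, F y = ∑ i, F (e.symm i : s.range) := fun F => by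
    rw [← Finset.sum_coe_sort]
    exact (Equiv.sum_comp e.symm (fun y : s.range => F y)).symm
  rw [(key ν hν.lt_top).2, hsum, Real.exp_sum, ENNReal.ofReal_prod_of_nonneg
    fun i _ => (Real.exp_pos _).le]
  have hcongr : ∀ᵐ w ∂P, ENNReal.ofReal (Real.exp (∫ x in B, s x ∂(N w))) =
      ∏ i, ENNReal.ofReal (Real.exp ((e.symm i : s.range) * (N w).real (A i))) := by
    filter_upwards [h.ae_lt_top hB hν] with w hw
    rw [(key (N w) hw).1, hsum, Real.exp_sum, ENNReal.ofReal_prod_of_nonneg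
      fun i _ => (Real.exp_pos _).le]
  rw [lintegral_congr_ae hcongr]
  have hind := (h.indep _ A hA hdisj).comp
    (fun i z => ENNReal.ofReal (Real.exp ((e.symm i : s.range) * z.toReal)))
    (fun i => by fun_prop)
  have := lintegral_prod_eq_prod_lintegral_of_indepFun Finset.univ _ hind fun i => by
    have := h.measurable_apply (hA i)
    simp only [Function.comp_def]
    fun_prop
  simp only [Function.comp_def] at this
  simp only [Measure.real]
  rw [this]
  refine Finset.prod_congr rfl fun i _ => ?_
  exact h.lintegral_exp_real (hA i) (hfin i) _

/-- Exponential moment bound for a Poisson field: simple functions give equality, by the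
independence of the masses of disjoint sets, and Fatou's lemma does the rest. -/
theorem IsPoissonField.lintegral_exp_le (h : IsPoissonField P N ν) {B : Set E}
    (hB : MeasurableSet B) (hν : ν B ≠ ⊤) {f : E → ℝ} (hf : Measurable f) {C : ℝ}
    (hC : ∀ x, |f x| ≤ C) :
    ∫⁻ w, ENNReal.ofReal (Real.exp (∫ x in B, f x ∂(N w))) ∂P ≤
      ENNReal.ofReal (Real.exp (∫ x in B, (Real.exp (f x) - 1) ∂ν)) := by
  rcases isEmpty_or_nonempty E with hE | ⟨⟨x₀⟩⟩
  · have hz : ∀ m : Measure E, m = 0 := fun m => Measure.eq_zero_of_isEmpty m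
    have h0 := h.lintegral_exp_simpleFunc hB hν 0
    simp only [hz, integral_zero_measure] at h0 ⊢
    exact h0.le
  have hC0 : 0 ≤ C := (abs_nonneg _).trans (hC x₀)
  have hsm := hf.stronglyMeasurable
  set s := hsm.approxBounded C with hs
  have hsb : ∀ n x, |s n x| ≤ C := fun n x => hsm.norm_approxBounded_le hC0 n x
  have hst : ∀ x, Tendsto (fun n => s n x) atTop (𝓝 (f x)) :=
    fun x => hsm.tendsto_approxBounded_of_norm_le (hC x)
  have hlim : ∀ m : Measure E, m B < ⊤ →
      Tendsto (fun n => ∫ x in B, s n x ∂m) atTop (𝓝 (∫ x in B, f x ∂m)) := by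
    intro m hm
    have : IsFiniteMeasure (m.restrict B) := ⟨by simpa using hm⟩
    refine tendsto_integral_of_dominated_convergence (fun _ => C)
      (fun n => (s n).measurable.aestronglyMeasurable) (integrable_const _) (fun n => ?_) ?_
    · exact ae_of_all _ (hsb n)
    · exact ae_of_all _ hst
  have hlimν : Tendsto (fun n => ∫ x in B, (Real.exp (s n x) - 1) ∂ν) atTop
      (𝓝 (∫ x in B, (Real.exp (f x) - 1) ∂ν)) := by
    have : IsFiniteMeasure (ν.restrict B) := ⟨by simpa using hν.lt_top⟩
    refine tendsto_integral_of_dominated_convergence (fun _ => Real.exp C + 1)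
      (fun n => ((Real.measurable_exp.comp (s n).measurable).sub_const 1).aestronglyMeasurable)
      (integrable_const _) (fun n => ae_of_all _ fun x => ?_) (ae_of_all _ fun x => ?_)
    · rw [Real.norm_eq_abs, abs_le]
      have := Real.exp_pos (s n x)
      have h2 := Real.exp_le_exp.2 ((le_abs_self _).trans (hsb n x))
      constructor <;> linarith [Real.exp_pos C]
    · exact ((Real.continuous_exp.tendsto _).comp (hst x)).sub_const 1
  calc ∫⁻ w, ENNReal.ofReal (Real.exp (∫ x in B, f x ∂(N w))) ∂P
      = ∫⁻ w, liminf (fun n => ENNReal.ofReal (Real.exp (∫ x in B, s n x ∂(N w)))) atTop ∂P := by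
        refine lintegral_congr_ae ?_
        filter_upwards [h.ae_lt_top hB hν] with w hw
        refine (Tendsto.liminf_eq ?_).symm
        exact (ENNReal.continuous_ofReal.tendsto _).comp
          ((Real.continuous_exp.tendsto _).comp (hlim _ hw))
    _ ≤ liminf (fun n => ∫⁻ w, ENNReal.ofReal (Real.exp (∫ x in B, s n x ∂(N w))) ∂P) atTop :=
        lintegral_liminf_le fun n => by
          have := h.measurable_setIntegral hB (s n).measurable
          fun_prop
    _ = ENNReal.ofReal (Real.exp (∫ x in B, (Real.exp (f x) - 1) ∂ν)) := by
        refine Tendsto.liminf_eq ?_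
        simp only [h.lintegral_exp_simpleFunc hB hν]
        exact (ENNReal.continuous_ofReal.tendsto _).comp
          ((Real.continuous_exp.tendsto _).comp hlimν)

/-- The exponential Markov inequality for an integral with respect to a Poisson field. -/
theorem IsPoissonField.measure_le_setIntegral_le (h : IsPoissonField P N ν) {B : Set E}
    (hB : MeasurableSet B) (hν : ν B ≠ ⊤) {f : E → ℝ} (hf : Measurable f) {C : ℝ}
    (hC : ∀ x, |f x| ≤ C) (s : ℝ) :
    P {w | s ≤ ∫ x in B, f x ∂(N w)} ≤
      ENNReal.ofReal (Real.exp (-s + ∫ x in B, (Real.exp (f x) - 1) ∂ν)) := by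
  have hm := h.measurable_setIntegral hB hf
  have h1 := mul_meas_ge_le_lintegral (μ := P)
    (f := fun w => ENNReal.ofReal (Real.exp (∫ x in B, f x ∂(N w)))) (by fun_prop)
    (ENNReal.ofReal (Real.exp s))
  have h2 : {w | ENNReal.ofReal (Real.exp s) ≤ ENNReal.ofReal (Real.exp (∫ x in B, f x ∂(N w)))} =
      {w | s ≤ ∫ x in B, f x ∂(N w)} := by
    ext w
    simp only [mem_ofPred_eq]
    rw [ENNReal.ofReal_le_ofReal_iff (Real.exp_pos _).le, Real.exp_le_exp]
  rw [h2] at h1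
  have h3 := h1.trans (h.lintegral_exp_le hB hν hf hC)
  rw [Real.exp_add, ENNReal.ofReal_mul (Real.exp_pos _).le]
  calc P {w | s ≤ ∫ x in B, f x ∂(N w)}
      = ENNReal.ofReal (Real.exp (-s)) *
        (ENNReal.ofReal (Real.exp s) * P {w | s ≤ ∫ x in B, f x ∂(N w)}) := by
        rw [← mul_assoc, ← ENNReal.ofReal_mul (Real.exp_pos _).le, ← Real.exp_add]
        simp
    _ ≤ _ := by gcongr

/-- Chernoff bound at an exponent `θ` so small that `θ |f| ≤ 1`, where `e^s - 1 ≤ s + s²` applies to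
`s = θ f`. -/
theorem IsPoissonField.measure_le_sub_le (h : IsPoissonField P N ν) {B : Set E}
    (hB : MeasurableSet B) (hν : ν B ≠ ⊤) {f : E → ℝ} (hf : Measurable f) {θ V : ℝ}
    (hθ : 0 ≤ θ) (hfθ : ∀ x ∈ B, θ * |f x| ≤ 1) (hV : ∫ x in B, f x ^ 2 ∂ν ≤ V) (t : ℝ) :
    P {w | t ≤ (∫ x in B, f x ∂(N w)) - ∫ x in B, f x ∂ν} ≤
      ENNReal.ofReal (Real.exp (-(θ * t) + θ ^ 2 * V)) := by
  have hfin : IsFiniteMeasure (ν.restrict B) := ⟨by simpa using hν.lt_top⟩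
  set g : E → ℝ := B.indicator fun x => θ * f x with hg
  have hgm : Measurable g := (hf.const_mul θ).indicator hB
  have hg1 : ∀ x, |g x| ≤ 1 := by
    intro x
    by_cases hx : x ∈ B
    · rw [hg, indicator_of_mem hx, abs_mul, abs_of_nonneg hθ]; exact hfθ x hx
    · rw [hg, indicator_of_notMem hx]; simp
  have hgB : ∀ m : Measure E, ∫ x in B, g x ∂m = θ * ∫ x in B, f x ∂m := by
    intro m
    rw [← integral_const_mul]
    exact setIntegral_congr_fun hB fun x hx => by simp [hg, hx]
  have hgB2 : ∫ x in B, g x ^ 2 ∂ν = θ ^ 2 * ∫ x in B, f x ^ 2 ∂ν := by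
    rw [← integral_const_mul]
    exact setIntegral_congr_fun hB fun x hx => by simp [hg, hx]; ring
  have hi1 : Integrable g (ν.restrict B) :=
    Integrable.of_bound hgm.aestronglyMeasurable 1 (ae_of_all _ hg1)
  have hi2 : Integrable (fun x => g x ^ 2) (ν.restrict B) :=
    Integrable.of_bound (hgm.pow_const 2).aestronglyMeasurable 1 (ae_of_all _ fun x => by
      rw [Real.norm_eq_abs, abs_pow]; exact pow_le_one₀ (abs_nonneg _) (hg1 x))
  have hi3 : Integrable (fun x => Real.exp (g x) - 1) (ν.restrict B) := by
    refine Integrable.mono' (hi1.abs.add hi2)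
      ((Real.measurable_exp.comp hgm).sub_const 1).aestronglyMeasurable (ae_of_all _ fun x => ?_)
    have := abs_le.1 (Real.abs_exp_sub_one_sub_id_le (hg1 x))
    have h2 := abs_le.1 (le_refl |g x|)
    simp only [Pi.add_apply, Real.norm_eq_abs]
    rw [abs_le]; constructor <;> linarith
  have hexp : ∫ x in B, (Real.exp (g x) - 1) ∂ν ≤ θ * (∫ x in B, f x ∂ν) + θ ^ 2 * V := by
    calc ∫ x in B, (Real.exp (g x) - 1) ∂ν ≤ ∫ x in B, (g x + g x ^ 2) ∂ν := by
          refine integral_mono hi3 (hi1.add hi2) fun x => ?_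
          have := abs_le.1 (Real.abs_exp_sub_one_sub_id_le (hg1 x))
          simp only; linarith
      _ = θ * (∫ x in B, f x ∂ν) + θ ^ 2 * ∫ x in B, f x ^ 2 ∂ν := by
          rw [integral_add hi1 hi2, hgB, hgB2]
      _ ≤ _ := by gcongr
  calc P {w | t ≤ (∫ x in B, f x ∂(N w)) - ∫ x in B, f x ∂ν}
      ≤ P {w | θ * (t + ∫ x in B, f x ∂ν) ≤ ∫ x in B, g x ∂(N w)} := by
        refine measure_mono fun w hw => ?_
        simp only [mem_ofPred_eq] at hw ⊢
        rw [hgB]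
        exact mul_le_mul_of_nonneg_left (by linarith) hθ
    _ ≤ _ := h.measure_le_setIntegral_le hB hν hgm hg1 _
    _ ≤ _ := by
        apply ENNReal.ofReal_le_ofReal
        apply Real.exp_le_exp.2
        linarith

/-- Two-sided Chernoff bound for a compensated integral with respect to a Poisson field. -/
theorem IsPoissonField.measure_le_abs_sub_le (h : IsPoissonField P N ν) {B : Set E}
    (hB : MeasurableSet B) (hν : ν B ≠ ⊤) {f : E → ℝ} (hf : Measurable f) {θ V : ℝ}
    (hθ : 0 ≤ θ) (hfθ : ∀ x ∈ B, θ * |f x| ≤ 1) (hV : ∫ x in B, f x ^ 2 ∂ν ≤ V) (t : ℝ) :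
    P {w | t ≤ |(∫ x in B, f x ∂(N w)) - ∫ x in B, f x ∂ν|} ≤
      ENNReal.ofReal (2 * Real.exp (-(θ * t) + θ ^ 2 * V)) := by
  have h1 := h.measure_le_sub_le hB hν hf hθ hfθ hV t
  have h2 := h.measure_le_sub_le hB hν hf.neg hθ (fun x hx => by simpa using hfθ x hx)
    (by simpa using hV) t
  calc P {w | t ≤ |(∫ x in B, f x ∂(N w)) - ∫ x in B, f x ∂ν|}
      ≤ P ({w | t ≤ (∫ x in B, f x ∂(N w)) - ∫ x in B, f x ∂ν} ∪
          {w | t ≤ (∫ x in B, (-f) x ∂(N w)) - ∫ x in B, (-f) x ∂ν}) := by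
        refine measure_mono fun w hw => ?_
        simp only [mem_ofPred_eq, mem_union, Pi.neg_apply, integral_neg] at hw ⊢
        rcases le_abs.1 hw with h | h
        · exact Or.inl h
        · right; linarith
    _ ≤ _ := measure_union_le _ _
    _ ≤ _ := add_le_add h1 h2
    _ = _ := by
        rw [← ENNReal.ofReal_add (Real.exp_pos _).le (Real.exp_pos _).le, two_mul]

/-- Chernoff bound for the number of points of a Poisson field. -/
theorem IsPoissonField.measure_le_real_le (h : IsPoissonField P N ν) {B : Set E}
    (hB : MeasurableSet B) (hν : ν B ≠ ⊤) (θ t : ℝ) (hθ : 0 < θ) :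
    P {w | t ≤ (N w).real B} ≤
      ENNReal.ofReal (Real.exp (-(θ * t) + ν.real B * (Real.exp θ - 1))) := by
  have h1 := h.measure_le_setIntegral_le hB hν (f := fun _ => θ) measurable_const
    (C := |θ|) (fun _ => le_rfl) (θ * t)
  simp only [setIntegral_const, smul_eq_mul] at h1
  refine le_trans (measure_mono fun w hw => ?_) h1
  simp only [mem_ofPred_eq] at hw ⊢
  rw [mul_comm]
  exact mul_le_mul_of_nonneg_right hw hθ.le

end PoissonField

/-! ### The contracted field -/

section Contract

variable {Ω E F : Type*} [MeasurableSpace Ω] [MeasurableSpace E] [MeasurableSpace F]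
  {P : Measure Ω} {N : Ω → Measure E} {ν : Measure E}

theorem IsPoissonField.map (h : IsPoissonField P N ν) {T : E → F} (hT : Measurable T) :
    IsPoissonField P (fun w => (N w).map T) (ν.map T) where
  measurable := (Measure.measurable_map T hT).comp h.measurable
  map_apply A hA hν := by
    have hν' : ν (T ⁻¹' A) ≠ ⊤ := by rwa [Measure.map_apply hT hA] at hν
    have h1 : (fun w => (N w).map T A) = fun w => N w (T ⁻¹' A) := by
      ext w; exact Measure.map_apply hT hA
    rw [h1, Measure.map_apply hT hA]
    exact h.map_apply _ (hT hA) hν'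
  indep n A hA hd := by
    have h1 : (fun i w => (N w).map T (A i)) = fun i w => N w (T ⁻¹' A i) := by
      ext i w; exact Measure.map_apply hT (hA i)
    rw [h1]
    exact h.indep n (fun i => T ⁻¹' A i) (fun i => hT (hA i))
      fun i j hij => (hd hij).preimage T

theorem isPoissonField_contract {d : ℕ} (hd : 0 < d) {N : Ω → Measure (Rd d)}
    (h : IsPoissonField P N volume) {ε : ℝ} (hε : 0 < ε) :
    IsPoissonField P (fun w => contract ε (N w)) (ENNReal.ofReal ε • volume) := by
  have h1 := h.map (T := fun x : Rd d => (ε ^ (-(1 / (d : ℝ)))) • x) (measurable_const_smul _)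
  rw [Measure.map_addHaar_smul volume (Real.rpow_pos_of_pos hε _).ne'] at h1
  have h2 : |((ε ^ (-(1 / (d : ℝ)))) ^ Module.finrank ℝ (Rd d))⁻¹| = ε := by
    have hd' : (d : ℝ) ≠ 0 := by positivity
    rw [finrank_euclideanSpace_fin, ← Real.rpow_natCast, ← Real.rpow_mul hε.le,
      ← Real.rpow_neg hε.le]
    rw [show -(-(1 / (d : ℝ)) * d) = 1 by field_simp, Real.rpow_one, abs_of_pos hε]
  rw [h2] at h1
  exact h1

end Contract

/-! ### Compensated integrals of slowly decaying kernels -/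

/-- Measurable kernels bounded by `1` and by `‖x‖^{-p}` outside the unit ball. For `p > d/2` they
are square integrable, so their compensated Poisson integrals converge, but for `p ≤ d` they need
not be integrable. -/
structure IsTailKernel {d : ℕ} (p : ℝ) (f : Rd d → ℝ) : Prop where
  measurable : Measurable f
  le_one : ∀ x, |f x| ≤ 1
  le_rpow : ∀ x, 1 ≤ ‖x‖ → |f x| ≤ ‖x‖ ^ (-p)

/-- A bound for the integral of `‖x‖^{-(p + d/2)}` over the complement of the unit ball. -/
def tailConst (d : ℕ) (p : ℝ) : ℝ :=
  2 ^ (p + d / 2) * ∫ x : Rd d, (1 + ‖x‖) ^ (-(p + d / 2))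

theorem tailConst_nonneg (d : ℕ) (p : ℝ) : 0 ≤ tailConst d p := by
  unfold tailConst
  have : 0 ≤ ∫ x : Rd d, (1 + ‖x‖) ^ (-(p + d / 2)) := integral_nonneg fun x => by positivity
  positivity

theorem rpow_neg_le_two_rpow_mul {r q : ℝ} (hr : 1 ≤ r) (hq : 0 ≤ q) :
    r ^ (-q) ≤ 2 ^ q * (1 + r) ^ (-q) := by
  rw [Real.rpow_neg (by linarith), Real.rpow_neg (by linarith), ← div_eq_mul_inv,
    inv_eq_one_div, div_le_div_iff₀ (by positivity) (by positivity), one_mul,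
    ← Real.mul_rpow (by norm_num) (by linarith)]
  exact Real.rpow_le_rpow (by linarith) (by linarith) hq

theorem integral_smul_ofReal {d : ℕ} {ε : ℝ} (hε : 0 ≤ ε) (B : Set (Rd d)) (f : Rd d → ℝ) :
    ∫ x in B, f x ∂(ENNReal.ofReal ε • volume : Measure (Rd d)) = ε * ∫ x in B, f x := by
  rw [Measure.restrict_smul, integral_smul_measure, ENNReal.toReal_ofReal hε, smul_eq_mul]

/-- Outside the ball of radius `n`, the integral of a function bounded by `‖x‖^{-(p + d/2) - κ}` is
of the order of `n^{-κ}`, as `p + d/2 > d`. -/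
theorem setIntegral_le_of_rpow {d : ℕ} {p κ : ℝ} (hp : (d : ℝ) / 2 < p) (hκ : 0 ≤ κ)
    {n : ℕ} (hn : 1 ≤ n)
    {B : Set (Rd d)} (hB : MeasurableSet B) (hBn : ∀ x ∈ B, (n : ℝ) ≤ ‖x‖) {g : Rd d → ℝ}
    (hg : Measurable g) (hgB : ∀ x ∈ B, |g x| ≤ ‖x‖ ^ (-(p + d / 2 + κ))) :
    ∫ x in B, |g x| ≤ (n : ℝ) ^ (-κ) * tailConst d p := by
  have hn' : (1 : ℝ) ≤ n := by exact_mod_cast hn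
  have hd0 : (0 : ℝ) ≤ d := by positivity
  have hint : Integrable (fun x : Rd d => (1 + ‖x‖) ^ (-(p + d / 2))) :=
    integrable_one_add_norm (by rw [finrank_euclideanSpace_fin]; linarith)
  have hint2 : Integrable
      (fun x : Rd d => (n : ℝ) ^ (-κ) * (2 ^ (p + d / 2) * (1 + ‖x‖) ^ (-(p + d / 2)))) :=
    (hint.const_mul _).const_mul _
  have hpt : ∀ x ∈ B, |g x| ≤
      (n : ℝ) ^ (-κ) * (2 ^ (p + d / 2) * (1 + ‖x‖) ^ (-(p + d / 2))) := by
    intro x hx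
    have hx1 := hBn x hx
    have hx0 : 0 < ‖x‖ := by linarith
    calc |g x| ≤ ‖x‖ ^ (-(p + d / 2 + κ)) := hgB x hx
      _ = ‖x‖ ^ (-κ) * ‖x‖ ^ (-(p + d / 2)) := by
          rw [← Real.rpow_add hx0]; ring_nf
      _ ≤ _ := by
          refine mul_le_mul
            (Real.rpow_le_rpow_of_nonpos (by linarith) hx1 (by linarith))
            (rpow_neg_le_two_rpow_mul (by linarith) (by linarith)) (by positivity) (by positivity)
  calc ∫ x in B, |g x|
      ≤ ∫ x in B, (n : ℝ) ^ (-κ) * (2 ^ (p + d / 2) * (1 + ‖x‖) ^ (-(p + d / 2))) := by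
        refine setIntegral_mono_on ?_ hint2.integrableOn hB hpt
        refine Integrable.mono' hint2.integrableOn hg.abs.aestronglyMeasurable ?_
        filter_upwards [ae_restrict_mem hB] with x hx
        simpa using hpt x hx
    _ ≤ ∫ x, (n : ℝ) ^ (-κ) * (2 ^ (p + d / 2) * (1 + ‖x‖) ^ (-(p + d / 2))) :=
        setIntegral_le_integral hint2 (ae_of_all _ fun x => by positivity)
    _ = _ := by rw [integral_const_mul, integral_const_mul, tailConst]

theorem truncInt_sub {d : ℕ} {μ ν : Measure (Rd d)} {f : Rd d → ℝ} {n m : ℕ} (hnm : n ≤ m)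
    (hμ : IntegrableOn f (Metric.closedBall 0 (m : ℝ)) μ)
    (hν : IntegrableOn f (Metric.closedBall 0 (m : ℝ)) ν) :
    truncInt μ ν f m - truncInt μ ν f n =
      (∫ x in Metric.closedBall 0 (m : ℝ) \ Metric.closedBall 0 (n : ℝ), f x ∂μ) -
        ∫ x in Metric.closedBall 0 (m : ℝ) \ Metric.closedBall 0 (n : ℝ), f x ∂ν := by
  have hsub : Metric.closedBall (0 : Rd d) (n : ℝ) ⊆ Metric.closedBall 0 (m : ℝ) :=
    Metric.closedBall_subset_closedBall (by exact_mod_cast hnm)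
  rw [setIntegral_sdiff Metric.isClosed_closedBall.measurableSet hμ hsub,
    setIntegral_sdiff Metric.isClosed_closedBall.measurableSet hν hsub]
  unfold truncInt
  ring

theorem IsTailKernel.integrableOn {d : ℕ} {p : ℝ} {f : Rd d → ℝ} (hf : IsTailKernel p f)
    {m : Measure (Rd d)} {B : Set (Rd d)} (hm : m B < ⊤) : IntegrableOn f B m := by
  have : IsFiniteMeasure (m.restrict B) := ⟨by simpa using hm⟩
  exact Integrable.of_bound hf.measurable.aestronglyMeasurable 1 (ae_of_all _ hf.le_one)

/-- A sequence whose oscillation over `[n, 2n]` is at most `n^{-κ}` converges. -/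
theorem cauchySeq_of_dyadic {S : ℕ → ℝ} {κ : ℝ} (hκ : 0 < κ) {n₀ : ℕ} (hn₀ : 1 ≤ n₀)
    (h : ∀ n, n₀ ≤ n → ∀ m, n ≤ m → m ≤ 2 * n → |S m - S n| ≤ (n : ℝ) ^ (-κ)) :
    CauchySeq S := by
  have h2 : (2 : ℝ) ^ (-κ) < 1 := Real.rpow_lt_one_of_one_lt_of_neg (by norm_num) (by linarith)
  have h2' : (0 : ℝ) < 2 ^ (-κ) := by positivity
  set C : ℝ := 1 / (1 - 2 ^ (-κ)) with hC
  have hC1 : 1 ≤ C := by rw [hC, le_div_iff₀ (by linarith)]; linarith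
  have hC2 : C * 2 ^ (-κ) + 1 = C := by
    have : 1 - (2 : ℝ) ^ (-κ) ≠ 0 := by linarith
    rw [hC]; field_simp; ring
  have key : ∀ k n m, n₀ ≤ n → n ≤ m → m - n ≤ k → |S m - S n| ≤ C * (n : ℝ) ^ (-κ) := by
    intro k
    induction k with
    | zero =>
      intro n m hn hnm hk
      have : m = n := by omega
      subst this
      simp only [sub_self, abs_zero]
      positivity
    | succ k ih =>
      intro n m hn hnm hk
      have hpos : (0 : ℝ) ≤ (n : ℝ) ^ (-κ) := by positivity
      by_cases hm : m ≤ 2 * n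
      · exact (h n hn m hnm hm).trans (by nlinarith)
      · have h3 := ih (2 * n) m (by omega) (by omega) (by omega)
        have h4 := h n hn (2 * n) (by omega) le_rfl
        push_cast at h3
        rw [Real.mul_rpow (by norm_num) (by positivity)] at h3
        calc |S m - S n| ≤ |S m - S (2 * n)| + |S (2 * n) - S n| := abs_sub_le _ _ _
          _ ≤ C * (2 ^ (-κ) * (n : ℝ) ^ (-κ)) + (n : ℝ) ^ (-κ) := add_le_add h3 h4
          _ = (C * 2 ^ (-κ) + 1) * (n : ℝ) ^ (-κ) := by ring
          _ = _ := by rw [hC2]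
  have hlim : Tendsto (fun n : ℕ => C * (n : ℝ) ^ (-κ)) atTop (𝓝 0) := by
    simpa using ((tendsto_rpow_neg_atTop hκ).comp tendsto_natCast_atTop_atTop).const_mul C
  rw [Metric.cauchySeq_iff']
  intro e he
  obtain ⟨n, hn, hn'⟩ := ((hlim.eventually_lt_const he).and (eventually_ge_atTop n₀)).exists
  exact ⟨n, fun m hm => (key _ n m hn' hm le_rfl).trans_lt hn⟩

theorem summable_mul_exp_neg_rpow {κ : ℝ} (hκ : 0 < κ) (C : ℝ) :
    Summable fun n : ℕ => ((n : ℝ) + 1) * (C * Real.exp (-(n : ℝ) ^ κ)) := by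
  set k := ⌈3 / κ⌉₊ with hk
  have hk3 : 3 ≤ κ * k := by
    have := Nat.le_ceil (3 / κ)
    rw [div_le_iff₀ hκ] at this
    rw [hk]; linarith
  have hs : Summable fun n : ℕ => 2 * |C| * k.factorial * (1 / (n : ℝ) ^ 2) :=
    (Real.summable_one_div_nat_pow.2 (by norm_num)).mul_left _
  refine Summable.of_norm_bounded_eventually_nat hs ?_
  filter_upwards [eventually_ge_atTop 1] with n hn
  have hn' : (1 : ℝ) ≤ n := by exact_mod_cast hn
  have h1 := Real.pow_div_factorial_le_exp (x := (n : ℝ) ^ κ) (by positivity) k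
  have h2 : (n : ℝ) ^ 3 ≤ ((n : ℝ) ^ κ) ^ k := by
    rw [← Real.rpow_natCast, ← Real.rpow_natCast, ← Real.rpow_mul (by positivity)]
    exact Real.rpow_le_rpow_of_exponent_le hn' (by exact_mod_cast hk3)
  have h3 : Real.exp (-(n : ℝ) ^ κ) ≤ k.factorial / (n : ℝ) ^ 3 := by
    rw [Real.exp_neg, inv_eq_one_div, div_le_div_iff₀ (Real.exp_pos _) (by positivity), one_mul]
    rw [div_le_iff₀ (by positivity)] at h1
    linarith
  rw [norm_mul, norm_mul, Real.norm_of_nonneg (by positivity : (0 : ℝ) ≤ n + 1),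
    Real.norm_of_nonneg (Real.exp_pos _).le, Real.norm_eq_abs]
  calc ((n : ℝ) + 1) * (|C| * Real.exp (-(n : ℝ) ^ κ))
      ≤ (2 * n) * (|C| * (k.factorial / (n : ℝ) ^ 3)) := by
        gcongr; linarith
    _ = _ := by field_simp

section TailConvergence

variable {Ω : Type*} [MeasurableSpace Ω] {P : Measure Ω} {d : ℕ} {μ : Ω → Measure (Rd d)} {ε : ℝ}

theorem ofReal_smul_volume_ne_top (ε : ℝ) {B : Set (Rd d)} (hB : volume B ≠ ⊤) :
    (ENNReal.ofReal ε • volume : Measure (Rd d)) B ≠ ⊤ := by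
  simpa using ENNReal.mul_ne_top ENNReal.ofReal_ne_top hB

theorem IsPoissonField.ae_closedBall_lt_top
    (h : IsPoissonField P μ (ENNReal.ofReal ε • volume)) :
    ∀ᵐ w ∂P, ∀ n : ℕ, μ w (Metric.closedBall 0 (n : ℝ)) < ⊤ :=
  ae_all_iff.2 fun _ => h.ae_lt_top Metric.isClosed_closedBall.measurableSet
    (ofReal_smul_volume_ne_top ε measure_closedBall_lt_top.ne)

/-- The Chernoff bound for the increments of the truncated compensated integral. The exponent `κ`
is `p - d/2`: the square of the kernel decays like `‖x‖^{-(p + d/2) - κ}`. -/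
theorem IsTailKernel.measure_le_abs_truncInt_sub_le {p : ℝ} (hp : (d : ℝ) / 2 < p)
    {f : Rd d → ℝ} (hf : IsTailKernel p f)
    (h : IsPoissonField P μ (ENNReal.ofReal ε • volume)) (hε : 0 ≤ ε)
    {n m : ℕ} (hn : 1 ≤ n) (hnm : n ≤ m) {θ : ℝ} (hθ : 0 ≤ θ) (hθn : θ ≤ (n : ℝ) ^ p) (t : ℝ) :
    P {w | t ≤ |truncInt (μ w) (ENNReal.ofReal ε • volume) f m -
        truncInt (μ w) (ENNReal.ofReal ε • volume) f n|} ≤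
      ENNReal.ofReal (2 * Real.exp (-(θ * t) +
        θ ^ 2 * (ε * ((n : ℝ) ^ (-(p - d / 2)) * tailConst d p)))) := by
  set B : Set (Rd d) := Metric.closedBall 0 (m : ℝ) \ Metric.closedBall 0 (n : ℝ) with hB
  have hn' : (1 : ℝ) ≤ n := by exact_mod_cast hn
  have hd0 : (0 : ℝ) ≤ d := by positivity
  have hBm : MeasurableSet B :=
    Metric.isClosed_closedBall.measurableSet.diff Metric.isClosed_closedBall.measurableSet
  have hBn : ∀ x ∈ B, (n : ℝ) ≤ ‖x‖ := by
    rintro x ⟨-, hx⟩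
    rw [mem_closedBall_zero_iff, not_le] at hx
    exact hx.le
  have hBfin : volume B ≠ ⊤ :=
    ne_top_of_le_ne_top (measure_closedBall_lt_top (x := (0 : Rd d)) (r := m)).ne
      (measure_mono sdiff_subset)
  have hV : ∫ x in B, f x ^ 2 ∂(ENNReal.ofReal ε • volume : Measure (Rd d)) ≤
      ε * ((n : ℝ) ^ (-(p - d / 2)) * tailConst d p) := by
    rw [integral_smul_ofReal hε]
    refine mul_le_mul_of_nonneg_left ?_ hε
    have h1 := setIntegral_le_of_rpow (κ := p - d / 2) hp (by linarith) hn hBm hBn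
      (hf.measurable.pow_const 2) (fun x hx => by
        have hx1 := hBn x hx
        have h2 := hf.le_rpow x (by linarith)
        rw [abs_pow]
        calc |f x| ^ 2 ≤ (‖x‖ ^ (-p)) ^ 2 := by gcongr
          _ = _ := by
            rw [← Real.rpow_natCast, ← Real.rpow_mul (norm_nonneg _)]
            congr 1; push_cast; ring)
    simpa using h1
  have h1 := h.measure_le_abs_sub_le hBm (ofReal_smul_volume_ne_top ε hBfin) hf.measurable hθ
    (fun x hx => by
      have hx1 := hBn x hx
      have h2 := hf.le_rpow x (by linarith)
      calc θ * |f x| ≤ (n : ℝ) ^ p * (n : ℝ) ^ (-p) := by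
            gcongr
            exact h2.trans (Real.rpow_le_rpow_of_nonpos (by linarith) hx1 (by linarith))
        _ = 1 := by rw [← Real.rpow_add (by linarith)]; simp) hV t
  refine le_trans (measure_mono_ae ?_) h1
  filter_upwards [h.ae_closedBall_lt_top] with w hw hwt
  change t ≤ |_| at hwt
  change t ≤ |_|
  rwa [truncInt_sub hnm (hf.integrableOn (hw m)) (hf.integrableOn
    (ofReal_smul_volume_ne_top ε measure_closedBall_lt_top.ne).lt_top)] at hwt

theorem IsTailKernel.ae_tendsto_truncInt {p : ℝ} (hp : (d : ℝ) / 2 < p)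
    {f : Rd d → ℝ} (hf : IsTailKernel p f)
    (h : IsPoissonField P μ (ENNReal.ofReal ε • volume)) (hε : 0 ≤ ε) :
    ∀ᵐ w ∂P, ∃ c, Tendsto (truncInt (μ w) (ENNReal.ofReal ε • volume) f) atTop (𝓝 c) := by
  have hd0 : (0 : ℝ) ≤ d := by positivity
  -- with `κ = p - d/2`, take increments of size `n^{-κ/4}` and the exponential rate `n^{κ/2}`
  set η : ℝ := (p - d / 2) / 4 with hη
  have hη0 : 0 < η := by rw [hη]; linarith
  set A : ℕ → ℕ → Set Ω := fun n m =>
    {w | (n : ℝ) ^ (-η) ≤ |truncInt (μ w) (ENNReal.ofReal ε • volume) f m -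
        truncInt (μ w) (ENNReal.ofReal ε • volume) f n|} with hA
  set C : ℝ := 2 * Real.exp (ε * tailConst d p) with hC
  have hP : ∀ n, 1 ≤ n → ∀ m, n ≤ m → P (A n m) ≤
      ENNReal.ofReal (C * Real.exp (-(n : ℝ) ^ η)) := by
    intro n hn m hnm
    have hn' : (1 : ℝ) ≤ n := by exact_mod_cast hn
    have h1 := hf.measure_le_abs_truncInt_sub_le hp h hε hn hnm (θ := (n : ℝ) ^ (2 * η))
      (by positivity) (Real.rpow_le_rpow_of_exponent_le hn' (by rw [hη]; linarith))
      ((n : ℝ) ^ (-η))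
    refine h1.trans (ENNReal.ofReal_le_ofReal (le_of_eq ?_))
    have e1 : (n : ℝ) ^ (2 * η) * (n : ℝ) ^ (-η) = (n : ℝ) ^ η := by
      rw [← Real.rpow_add (by linarith)]; ring_nf
    have e2 : ((n : ℝ) ^ (2 * η)) ^ 2 * (n : ℝ) ^ (-(p - d / 2)) = 1 := by
      rw [← Real.rpow_natCast, ← Real.rpow_mul (by linarith), ← Real.rpow_add (by linarith)]
      rw [show 2 * η * ((2 : ℕ) : ℝ) + -(p - d / 2) = 0 by rw [hη]; push_cast; ring]
      simp
    rw [e1, show ((n : ℝ) ^ (2 * η)) ^ 2 * (ε * ((n : ℝ) ^ (-(p - d / 2)) * tailConst d p)) =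
      (((n : ℝ) ^ (2 * η)) ^ 2 * (n : ℝ) ^ (-(p - d / 2))) * (ε * tailConst d p) by ring, e2,
      hC, Real.exp_add]
    ring_nf
  have hsum : ∑' n, P (⋃ m ∈ Finset.Icc (n + 1) (2 * (n + 1)), A (n + 1) m) ≠ ⊤ := by
    have hs := (summable_nat_add_iff 1).2 (summable_mul_exp_neg_rpow hη0 C)
    refine ne_top_of_le_ne_top hs.tsum_ofReal_ne_top (ENNReal.tsum_le_tsum fun n => ?_)
    refine (measure_biUnion_finset_le _ _).trans ?_
    refine (Finset.sum_le_card_nsmul _ _ _ fun m hm =>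
      hP (n + 1) (by omega) m (Finset.mem_Icc.1 hm).1).trans ?_
    rw [Nat.card_Icc, nsmul_eq_mul,
      ENNReal.ofReal_mul (p := ((n + 1 : ℕ) : ℝ) + 1) (by positivity)]
    have hc : (((2 * (n + 1) + 1 - (n + 1) : ℕ)) : ENNReal) ≤
        ENNReal.ofReal (((n + 1 : ℕ) : ℝ) + 1) := ?_
    · exact mul_le_mul_left hc _
    rw [← ENNReal.ofReal_natCast]
    apply ENNReal.ofReal_le_ofReal
    have : 2 * (n + 1) + 1 - (n + 1) = n + 2 := by omega
    rw [this]; push_cast; linarith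
  filter_upwards [ae_eventually_notMem hsum] with w hw
  obtain ⟨n₁, hn₁⟩ := eventually_atTop.1 hw
  refine cauchySeq_tendsto_of_complete (cauchySeq_of_dyadic hη0 (n₀ := n₁ + 1) (by omega) ?_)
  intro n hn m hnm hm
  have h1 := hn₁ (n - 1) (by omega)
  rw [show n - 1 + 1 = n by omega] at h1
  simp only [mem_iUnion, not_exists] at h1
  have h2 := h1 m (Finset.mem_Icc.2 ⟨hnm, hm⟩)
  exact (not_le.1 h2).le

/-- The Chernoff bound passes to the limit of the truncated compensated integrals. -/
theorem IsTailKernel.measure_lt_abs_lim_sub_le {p : ℝ} (hp : (d : ℝ) / 2 < p)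
    {f : Rd d → ℝ} (hf : IsTailKernel p f)
    (h : IsPoissonField P μ (ENNReal.ofReal ε • volume)) (hε : 0 ≤ ε)
    {n : ℕ} (hn : 1 ≤ n) {θ : ℝ} (hθ : 0 ≤ θ) (hθn : θ ≤ (n : ℝ) ^ p) (t : ℝ) :
    P {w | ∃ c, Tendsto (truncInt (μ w) (ENNReal.ofReal ε • volume) f) atTop (𝓝 c) ∧
        t < |c - truncInt (μ w) (ENNReal.ofReal ε • volume) f n|} ≤
      ENNReal.ofReal (2 * Real.exp (-(θ * t) +
        θ ^ 2 * (ε * ((n : ℝ) ^ (-(p - d / 2)) * tailConst d p)))) := by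
  set A : ℕ → Set Ω := fun m =>
    {w | t ≤ |truncInt (μ w) (ENNReal.ofReal ε • volume) f m -
        truncInt (μ w) (ENNReal.ofReal ε • volume) f n|} with hA
  have hmono : Monotone fun k => ⋂ m ≥ k, A m := by
    intro k l hkl w hw
    simp only [mem_iInter] at hw ⊢
    exact fun m hm => hw m (hkl.trans hm)
  calc _ ≤ P (⋃ k, ⋂ m ≥ k, A m) := by
        refine measure_mono ?_
        rintro w ⟨c, hc, hct⟩
        have h1 := ((hc.sub_const (truncInt (μ w) (ENNReal.ofReal ε • volume) f n)).abs).eventually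
          (lt_mem_nhds hct)
        obtain ⟨k, hk⟩ := eventually_atTop.1 h1
        simp only [mem_iUnion, mem_iInter]
        exact ⟨k, fun m hm => (hk m hm).le⟩
    _ = ⨆ k, P (⋂ m ≥ k, A m) := hmono.measure_iUnion
    _ ≤ _ := by
        refine iSup_le fun k => ?_
        refine le_trans (measure_mono ?_) (hf.measure_le_abs_truncInt_sub_le hp h hε hn
          (le_max_right k n) hθ hθn t)
        intro w hw
        simp only [mem_iInter] at hw
        exact hw _ (le_max_left k n)

end TailConvergence

/-! ### A Hardy inequality on bounded domains -/

section Hardy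

variable {d : ℕ}

theorem continuous_gradient {φ : Rd d → ℝ} (hφ : ContDiff ℝ ∞ φ) : Continuous (gradient φ) := by
  have h1 : gradient φ = fun y => (InnerProductSpace.toDual ℝ (Rd d)).symm (fderiv ℝ φ y) := rfl
  rw [h1]
  exact (LinearIsometryEquiv.continuous _).comp (hφ.continuous_fderiv (by simp))

theorem hasCompactSupport_gradient {φ : Rd d → ℝ} (hφ : HasCompactSupport φ) :
    HasCompactSupport (gradient φ) :=
  (hφ.fderiv (𝕜 := ℝ)).comp_left (map_zero (InnerProductSpace.toDual ℝ (Rd d)).symm)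

/-- The derivative in the direction `e_i` of the `i`-th component of the vector field
`y ↦ (‖y - x‖² + δ)^{-p/2} (y - x)`. -/
theorem fderiv_regularized_field (p : ℝ) {δ : ℝ} (hδ : 0 < δ) (x y : Rd d) (i : Fin d) :
    fderiv ℝ (fun z : Rd d => (‖z - x‖ ^ 2 + δ) ^ (-(p / 2)) * (z i - x i)) y
      (EuclideanSpace.single i 1) =
    (‖y - x‖ ^ 2 + δ) ^ (-(p / 2)) -
      p * (‖y - x‖ ^ 2 + δ) ^ (-(p / 2) - 1) * (y i - x i) ^ 2 := by
  have hw : (‖y - x‖ ^ 2 + δ) ≠ 0 := by positivity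
  have h1 : HasFDerivAt (fun z : Rd d => ‖z - x‖ ^ 2 + δ) _ y :=
    (((hasFDerivAt_id y).sub_const x).norm_sq).add_const δ
  have h2 := h1.rpow_const (p := -(p / 2)) (Or.inl hw)
  have h3 : HasFDerivAt (fun z : Rd d => z i - x i) (EuclideanSpace.proj i : Rd d →L[ℝ] ℝ) y :=
    ((EuclideanSpace.proj i : Rd d →L[ℝ] ℝ).hasFDerivAt).sub_const (x i)
  have h4 : HasFDerivAt (fun z : Rd d => (‖z - x‖ ^ 2 + δ) ^ (-(p / 2)) * (z i - x i)) _ y :=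
    h2.mul h3
  rw [h4.fderiv]
  simp [EuclideanSpace.inner_single_right]
  ring

theorem contDiff_regularized_field (p : ℝ) {δ : ℝ} (hδ : 0 < δ) (x : Rd d) (i : Fin d) :
    ContDiff ℝ ∞ fun z : Rd d => (‖z - x‖ ^ 2 + δ) ^ (-(p / 2)) * (z i - x i) := by
  refine ContDiff.mul ?_ ?_
  · refine ContDiff.rpow_const_of_ne ?_ fun z => by positivity
    exact ((contDiff_id.sub contDiff_const).norm_sq ℝ).add contDiff_const
  · exact (EuclideanSpace.proj i : Rd d →L[ℝ] ℝ).contDiff.sub contDiff_const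

/-- Integration by parts against the regularized field `(‖y - x‖² + δ)^{-p/2} (y - x)`, whose
divergence is at least `(d - p) (‖y - x‖² + δ)^{-p/2}`. -/
theorem integral_sq_mul_regularized_le {p : ℝ} (hp0 : 0 ≤ p) {φ : Rd d → ℝ} (hφ : ContDiff ℝ ∞ φ)
    (hc : HasCompactSupport φ) {δ : ℝ} (hδ : 0 < δ) (x : Rd d) :
    (d - p) * ∫ y, φ y ^ 2 * (‖y - x‖ ^ 2 + δ) ^ (-(p / 2)) ≤
      ∫ y, -(2 * φ y * inner ℝ (gradient φ y) (y - x) * (‖y - x‖ ^ 2 + δ) ^ (-(p / 2))) := by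
  set w : Rd d → ℝ := fun y => ‖y - x‖ ^ 2 + δ with hw
  have hw0 : ∀ y, 0 < w y := fun y => by simp only [hw]; positivity
  have hwc : Continuous w := by fun_prop
  have hwpc : ∀ s : ℝ, Continuous fun y => w y ^ s := fun s =>
    hwc.rpow_const fun y => Or.inl (hw0 y).ne'
  set g : Fin d → Rd d → ℝ := fun i z => w z ^ (-(p / 2)) * (z i - x i) with hg
  have hgs : ∀ i, ContDiff ℝ ∞ (g i) := contDiff_regularized_field p hδ x
  have hgc : ∀ i, Continuous (g i) := fun i => (hgs i).continuous
  have hφ2 : ContDiff ℝ ∞ fun y => φ y ^ 2 := hφ.pow 2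
  have hc2 : HasCompactSupport fun y => φ y ^ 2 :=
    hc.comp_left (g := fun t => t ^ 2) (by simp)
  have hfc : ∀ (f : Rd d → ℝ), ContDiff ℝ ∞ f → ∀ v, Continuous fun y => fderiv ℝ f y v :=
    fun f hf v => (hf.continuous_fderiv (by simp)).clm_apply continuous_const
  have hfd2 : ∀ y v, fderiv ℝ (fun y => φ y ^ 2) y v = 2 * φ y * fderiv ℝ φ y v := by
    intro y v
    have h1 := ((hφ.differentiable (by simp)) y).hasFDerivAt.pow 2
    rw [h1.fderiv]; simp
  have hfs : ∀ v, HasCompactSupport fun y => fderiv ℝ (fun y => φ y ^ 2) y v := fun v =>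
    hc2.fderiv_apply (𝕜 := ℝ) v
  have hint1 : ∀ i, Integrable fun y => fderiv ℝ (fun y => φ y ^ 2) y
      (EuclideanSpace.single i 1) * g i y := fun i =>
    ((hfc _ hφ2 _).mul (hgc i)).integrable_of_hasCompactSupport (hfs _).mul_right
  have hint2 : ∀ i, Integrable fun y => φ y ^ 2 * fderiv ℝ (g i) y
      (EuclideanSpace.single i 1) := fun i =>
    (hφ2.continuous.mul (hfc _ (hgs i) _)).integrable_of_hasCompactSupport hc2.mul_right
  have hint3 : ∀ i, Integrable fun y => φ y ^ 2 * g i y := fun i =>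
    (hφ2.continuous.mul (hgc i)).integrable_of_hasCompactSupport hc2.mul_right
  have hibp : ∀ i, ∫ y, φ y ^ 2 * fderiv ℝ (g i) y (EuclideanSpace.single i 1) =
      - ∫ y, fderiv ℝ (fun y => φ y ^ 2) y (EuclideanSpace.single i 1) * g i y := fun i =>
    integral_mul_fderiv_eq_neg_fderiv_mul_of_integrable (hint1 i) (hint2 i) (hint3 i)
      (fun y _ => hφ2.differentiable (by simp) y) (fun y _ => (hgs i).differentiable (by simp) y)
  have hsum := Finset.sum_congr (rfl : (Finset.univ : Finset (Fin d)) = _) fun i _ => hibp i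
  rw [Finset.sum_neg_distrib, ← integral_finsetSum _ fun i _ => hint1 i,
    ← integral_finsetSum _ fun i _ => hint2 i, ← integral_neg] at hsum
  have hnorm : ∀ y : Rd d, ∑ i, (y i - x i) ^ 2 = ‖y - x‖ ^ 2 := fun y => by
    rw [EuclideanSpace.real_norm_sq_eq]; simp
  have hdiv : ∀ y, ∑ i, φ y ^ 2 * fderiv ℝ (g i) y (EuclideanSpace.single i 1) =
      φ y ^ 2 * (d * w y ^ (-(p / 2)) - p * w y ^ (-(p / 2) - 1) * ‖y - x‖ ^ 2) := by
    intro y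
    simp only [hg, hw, fderiv_regularized_field p hδ x y]
    rw [← Finset.mul_sum, Finset.sum_sub_distrib, ← Finset.mul_sum, hnorm]
    simp
  have hrhs : ∀ y, -∑ i, fderiv ℝ (fun y => φ y ^ 2) y (EuclideanSpace.single i 1) * g i y =
      -(2 * φ y * inner ℝ (gradient φ y) (y - x) * w y ^ (-(p / 2))) := by
    intro y
    congr 1
    have h1 : ∀ i, fderiv ℝ (fun y => φ y ^ 2) y (EuclideanSpace.single i 1) * g i y =
        2 * φ y * (gradient φ y i * (y i - x i)) * w y ^ (-(p / 2)) := by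
      intro i
      rw [hfd2, ← inner_gradient_left, EuclideanSpace.inner_single_right]
      simp only [hg]
      simp
      ring
    simp only [h1]
    rw [← Finset.sum_mul, ← Finset.mul_sum]
    congr 2
    rw [PiLp.inner_apply]
    exact Finset.sum_congr rfl fun i _ => by simp [mul_comm]
  simp only [hdiv, hrhs] at hsum
  rw [← hsum, ← integral_const_mul]
  refine integral_mono ?_ ?_ fun y => ?_
  · exact ((hφ2.continuous.mul (hwpc _)).integrable_of_hasCompactSupport hc2.mul_right).const_mul _
  · refine Continuous.integrable_of_hasCompactSupport ?_ hc2.mul_right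
    have := hwpc (-(p / 2))
    have := hwpc (-(p / 2) - 1)
    have := hφ.continuous
    fun_prop
  · have h1 : w y ^ (-(p / 2)) = w y ^ (-(p / 2) - 1) * w y := by
      rw [← Real.rpow_add_one (hw0 y).ne']; ring_nf
    have h2 : 0 < w y ^ (-(p / 2) - 1) := Real.rpow_pos_of_pos (hw0 y) _
    have h3 : ‖y - x‖ ^ 2 ≤ w y := by simp only [hw]; linarith
    have h4 : p * w y ^ (-(p / 2) - 1) * ‖y - x‖ ^ 2 ≤ p * w y ^ (-(p / 2)) := by
      rw [h1]
      have := mul_le_mul_of_nonneg_left h3 h2.le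
      nlinarith
    calc (d - p) * (φ y ^ 2 * w y ^ (-(p / 2)))
        = φ y ^ 2 * (d * w y ^ (-(p / 2)) - p * w y ^ (-(p / 2))) := by ring
      _ ≤ _ := by gcongr

/-- Hardy inequality for test functions, uniformly in the regularization `δ`, for functions
supported where `‖y - x‖² + δ ≤ W`. -/
theorem integral_sq_mul_regularized_le_grad {p : ℝ} (hp0 : 0 ≤ p) (hp2 : p < 2) (hpd : p < d)
    {φ : Rd d → ℝ} (hφ : ContDiff ℝ ∞ φ)
    (hc : HasCompactSupport φ) {δ W : ℝ} (hδ : 0 < δ) (x : Rd d)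
    (hW : ∀ y, φ y ≠ 0 → ‖y - x‖ ^ 2 + δ ≤ W) (hW0 : 0 < W) :
    ∫ y, φ y ^ 2 * (‖y - x‖ ^ 2 + δ) ^ (-(p / 2)) ≤
      4 * W ^ (1 - p / 2) / (d - p) ^ 2 * ∫ y, ‖gradient φ y‖ ^ 2 := by
  set w : Rd d → ℝ := fun y => ‖y - x‖ ^ 2 + δ with hw
  have hw0 : ∀ y, 0 < w y := fun y => by simp only [hw]; positivity
  have hwpc : Continuous fun y => w y ^ (-(p / 2)) :=
    (by fun_prop : Continuous w).rpow_const fun y => Or.inl (hw0 y).ne'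
  have hdp : 0 < (d : ℝ) - p := by linarith
  set A : ℝ := W ^ (1 - p / 2) with hA
  have hA0 : 0 < A := Real.rpow_pos_of_pos hW0 _
  -- with this weight in Young's inequality, the term in `φ²` is half of the left side of
  -- `integral_sq_mul_regularized_le`
  set η : ℝ := (d - p) / (2 * A) with hη
  have hη0 : 0 < η := by positivity
  have hc2 : HasCompactSupport fun y => φ y ^ 2 :=
    hc.comp_left (g := fun t => t ^ 2) (by simp)
  have hgradc := continuous_gradient hφ
  have hgradcs : HasCompactSupport fun y => ‖gradient φ y‖ ^ 2 :=
    (hasCompactSupport_gradient hc).comp_left (g := fun v => ‖v‖ ^ 2) (by simp)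
  have hi1 : Integrable fun y => φ y ^ 2 * w y ^ (-(p / 2)) :=
    ((hφ.continuous.pow 2).mul hwpc).integrable_of_hasCompactSupport hc2.mul_right
  have hi2 : Integrable fun y => ‖gradient φ y‖ ^ 2 :=
    (hgradc.norm.pow 2).integrable_of_hasCompactSupport hgradcs
  have h0 := integral_sq_mul_regularized_le hp0 hφ hc hδ x
  have hpt : ∀ y, -(2 * φ y * inner ℝ (gradient φ y) (y - x) * w y ^ (-(p / 2))) ≤
      (d - p) / 2 * (φ y ^ 2 * w y ^ (-(p / 2))) + η⁻¹ * ‖gradient φ y‖ ^ 2 := by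
    intro y
    by_cases hy : φ y = 0
    · rw [hy]; simp; positivity
    have hwW : w y ≤ W := hW y hy
    have hs : ‖y - x‖ ≤ w y ^ (1 / 2 : ℝ) := by
      rw [← Real.sqrt_eq_rpow]
      refine Real.le_sqrt_of_sq_le ?_
      simp only [hw]; linarith
    set u := w y ^ (-(p / 2)) with hu
    have hu0 : 0 < u := Real.rpow_pos_of_pos (hw0 y) _
    set v := w y ^ (1 / 2 : ℝ) with hv
    have hv0 : 0 < v := Real.rpow_pos_of_pos (hw0 y) _
    have huv : v ^ 2 * u ≤ A := by
      rw [hv, hu, ← Real.rpow_natCast, ← Real.rpow_mul (hw0 y).le, ← Real.rpow_add (hw0 y)]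
      calc _ = w y ^ (1 - p / 2) := by congr 1; push_cast; ring
        _ ≤ _ := Real.rpow_le_rpow (hw0 y).le hwW (by linarith)
    have hin : |inner ℝ (gradient φ y) (y - x)| ≤ ‖gradient φ y‖ * v :=
      (abs_real_inner_le_norm _ _).trans (by gcongr)
    set b := ‖gradient φ y‖ with hb
    have hb0 : 0 ≤ b := norm_nonneg _
    calc -(2 * φ y * inner ℝ (gradient φ y) (y - x) * u)
        ≤ |2 * φ y * inner ℝ (gradient φ y) (y - x) * u| := neg_le_abs _
      _ = 2 * |φ y| * |inner ℝ (gradient φ y) (y - x)| * u := by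
          rw [abs_mul, abs_mul, abs_mul, abs_of_pos hu0]; norm_num
      _ ≤ 2 * |φ y| * (b * v) * u := by gcongr
      _ ≤ η * (|φ y| * v * u) ^ 2 + η⁻¹ * b ^ 2 := by
          have h := sq_nonneg (η * (|φ y| * v * u) - b)
          have h2 : η * (|φ y| * v * u) ^ 2 + η⁻¹ * b ^ 2 - 2 * |φ y| * (b * v) * u =
            η⁻¹ * (η * (|φ y| * v * u) - b) ^ 2 := by field_simp; ring
          have h3 : 0 ≤ η⁻¹ * (η * (|φ y| * v * u) - b) ^ 2 := by positivity
          linarith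
      _ = η * (v ^ 2 * u) * (φ y ^ 2 * u) + η⁻¹ * b ^ 2 := by
          rw [mul_pow, mul_pow, sq_abs]; ring
      _ ≤ η * A * (φ y ^ 2 * u) + η⁻¹ * b ^ 2 := by gcongr
      _ = _ := by
          rw [hη]; field_simp
  have h1 : ∫ y, -(2 * φ y * inner ℝ (gradient φ y) (y - x) * w y ^ (-(p / 2))) ≤
      (d - p) / 2 * (∫ y, φ y ^ 2 * w y ^ (-(p / 2))) + η⁻¹ * ∫ y, ‖gradient φ y‖ ^ 2 := by
    rw [← integral_const_mul, ← integral_const_mul,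
      ← integral_add (hi1.const_mul _) (hi2.const_mul _)]
    refine integral_mono ?_ ((hi1.const_mul _).add (hi2.const_mul _)) hpt
    refine Continuous.integrable_of_hasCompactSupport ?_ ?_
    · have := hφ.continuous
      fun_prop
    · have h2 : HasCompactSupport fun y => φ y *
        (-(2 * inner ℝ (gradient φ y) (y - x) * w y ^ (-(p / 2)))) := hc.mul_right
      refine (congrArg HasCompactSupport ?_).mp h2
      ext y; ring
  have h2 := h0.trans h1
  set I := ∫ y, φ y ^ 2 * w y ^ (-(p / 2)) with hI
  set J := ∫ y, ‖gradient φ y‖ ^ 2 with hJ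
  have h3 : (d - p) / 2 * I ≤ η⁻¹ * J := by linarith
  have h4 : I ≤ 2 / (d - p) * (η⁻¹ * J) := by
    rw [div_mul_eq_mul_div, le_div_iff₀ hdp]; linarith
  refine h4.trans (le_of_eq ?_)
  rw [hη]; field_simp; ring

end Hardy

/-! ### Finiteness and positivity of `ρ*_D` -/

section RhoStar

variable {d : ℕ} {D : Set (Rd d)}

theorem integrableOn_sq_of_mem_sobolevSphere {g : Rd d → ℝ} (hg : g ∈ sobolevSphere D) :
    IntegrableOn (fun y => g y ^ 2) D := by
  obtain ⟨G, hG, -⟩ := hg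
  exact hG.memLp.integrable_sq

theorem integral_sq_le_one_of_mem_sobolevSphere {g : Rd d → ℝ} (hg : g ∈ sobolevSphere D) :
    ∫ y in D, g y ^ 2 ≤ 1 := by
  obtain ⟨G, -, h⟩ := hg
  have : 0 ≤ ∫ y in D, ‖G y‖ ^ 2 := integral_nonneg fun y => by positivity
  linarith

theorem gradient_eq_zero_of_notMem_tsupport {φ : Rd d → ℝ} {y : Rd d} (hy : y ∉ tsupport φ) :
    gradient φ y = 0 := by
  have h1 : fderiv ℝ φ y = 0 := by
    by_contra h
    exact hy (support_fderiv_subset ℝ (Function.mem_support.2 h))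
  rw [gradient, h1, map_zero]

theorem eLpNorm_two_eq {E F : Type*} [MeasurableSpace E] [NormedAddCommGroup F] {μ : Measure E}
    {f : E → F} (hf : MemLp f 2 μ) : eLpNorm f 2 μ = ENNReal.ofReal (√(∫ x, ‖f x‖ ^ 2 ∂μ)) := by
  rw [hf.eLpNorm_eq_integral_rpow_norm (by norm_num) (by norm_num), Real.sqrt_eq_rpow]
  simp

/-- A Hardy inequality for the closure of the test functions, obtained by Fatou's lemma. -/
theorem lintegral_riesz_le_of_norm_le {p R : ℝ} (hp0 : 0 ≤ p) (hp2 : p < 2) (hpd : p < d)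
    (hR : 0 ≤ R) (hD : D ⊆ Metric.closedBall 0 R)
    {g : Rd d → ℝ} (hg : g ∈ sobolevSphere D) {x : Rd d} (hx : ‖x‖ ≤ R + 1) :
    ∫⁻ y in D, ENNReal.ofReal (g y ^ 2 / ‖y - x‖ ^ p) ≤
      ENNReal.ofReal (4 * ((2 * R + 1) ^ 2 + 1) ^ (1 - p / 2) / (d - p) ^ 2 * 9) := by
  obtain ⟨G, ⟨hgm, hGm, φ, hφ, hφg, hφG⟩, h1⟩ := hg
  have hGn : eLpNorm G 2 (volume.restrict D) ≤ ENNReal.ofReal 2 := by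
    rw [eLpNorm_two_eq hGm]
    refine ENNReal.ofReal_le_ofReal ?_
    rw [Real.sqrt_le_iff]
    have : 0 ≤ ∫ y in D, g y ^ 2 := integral_nonneg fun y => by positivity
    constructor <;> linarith
  have hgradc : ∀ n, Continuous (gradient (φ n)) := fun n => continuous_gradient (hφ n).1
  have hgradcs : ∀ n, HasCompactSupport (gradient (φ n)) := fun n =>
    hasCompactSupport_gradient (hφ n).2.1
  have hgradm : ∀ n, MemLp (gradient (φ n)) 2 (volume.restrict D) := fun n =>
    ((hgradc n).memLp_of_hasCompactSupport (hgradcs n)).restrict D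
  have hgrad : ∀ᶠ n in atTop, ∫ y, ‖gradient (φ n) y‖ ^ 2 ≤ 9 := by
    filter_upwards [hφG.eventually_lt_const (by norm_num : (0 : ENNReal) < 1)] with n hn
    -- `‖∇φ_n‖ ≤ 1 + ‖G‖ ≤ 1 + √2 ≤ 3`
    have h2 : eLpNorm (gradient (φ n)) 2 (volume.restrict D) ≤ ENNReal.ofReal 3 := by
      calc eLpNorm (gradient (φ n)) 2 (volume.restrict D)
          = eLpNorm ((fun y => gradient (φ n) y - G y) + G) 2 (volume.restrict D) := by
            congr 1; ext1 y; simp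
        _ ≤ eLpNorm (fun y => gradient (φ n) y - G y) 2 (volume.restrict D) +
            eLpNorm G 2 (volume.restrict D) :=
            eLpNorm_add_le ((hgradc n).aestronglyMeasurable.sub hGm.1) hGm.1 (by norm_num)
        _ ≤ 1 + ENNReal.ofReal 2 := add_le_add hn.le hGn
        _ = ENNReal.ofReal 3 := by
            rw [← ENNReal.ofReal_one, ← ENNReal.ofReal_add] <;> norm_num
    rw [eLpNorm_two_eq (hgradm n), ENNReal.ofReal_le_ofReal_iff (by norm_num),
      Real.sqrt_le_iff] at h2
    rw [← setIntegral_eq_integral_of_forall_compl_eq_zero (s := D)]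
    · linarith [h2.2]
    · intro y hy
      rw [gradient_eq_zero_of_notMem_tsupport fun h => hy ((hφ n).2.2 h)]
      simp
  have hmeas := tendstoInMeasure_of_tendsto_eLpNorm (p := 2) (by norm_num)
    (fun n => (hφ n).1.continuous.aestronglyMeasurable) hgm.1 hφg
  obtain ⟨ns, hns, hae⟩ := hmeas.exists_seq_tendsto_ae
  set W : ℝ := (2 * R + 1) ^ 2 + 1 with hW
  have hW0 : 0 < W := by positivity
  set δ : ℕ → ℝ := fun n => 1 / ((n : ℝ) + 1) with hδ
  have hδ0 : ∀ n, 0 < δ n := fun n => Nat.one_div_pos_of_nat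
  have hδ1 : ∀ n, δ n ≤ 1 := fun n => by
    rw [hδ]; simp only; rw [div_le_one (by positivity)]; linarith [(Nat.cast_nonneg n : (0:ℝ) ≤ n)]
  have hδt : Tendsto δ atTop (𝓝 0) := tendsto_one_div_add_atTop_nhds_zero_nat
  set H : ℕ → Rd d → ℝ := fun n y => φ (ns n) y ^ 2 * (‖y - x‖ ^ 2 + δ n) ^ (-(p / 2)) with hH
  have hHc : ∀ n, Continuous (H n) := fun n => by
    refine ((hφ _).1.continuous.pow 2).mul ?_
    have := hδ0 n
    exact (by fun_prop : Continuous fun y : Rd d => ‖y - x‖ ^ 2 + δ n).rpow_const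
      fun y => Or.inl (by positivity)
  have hlim : ∀ᵐ y ∂(volume.restrict D),
      Tendsto (fun n => ENNReal.ofReal (H n y)) atTop
        (𝓝 (ENNReal.ofReal (g y ^ 2 / ‖y - x‖ ^ p))) := by
    have : NullSingletonClass (volume : Measure (Rd d)) := by
      have : Nonempty (Fin d) := ⟨⟨0, by
        rcases Nat.eq_zero_or_pos d with h | h
        · subst h; norm_num at hpd; linarith
        · exact h⟩⟩
      infer_instance
    filter_upwards [hae, (ae_restrict_of_ae (s := D)
      (measure_eq_zero_iff_ae_notMem.1 (measure_singleton x : volume ({x} : Set (Rd d)) = 0)))]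
      with y hy hyx
    refine (ENNReal.continuous_ofReal.tendsto _).comp ?_
    have hyx0 : 0 < ‖y - x‖ := norm_pos_iff.2 (sub_ne_zero.2 hyx)
    have h2 : Tendsto (fun n => ‖y - x‖ ^ 2 + δ n) atTop (𝓝 (‖y - x‖ ^ 2)) := by
      simpa using hδt.const_add (‖y - x‖ ^ 2)
    have h3 := (hy.pow 2).mul (h2.rpow_const (p := -(p / 2)) (Or.inl (by positivity)))
    convert h3 using 2
    rw [div_eq_mul_inv, ← Real.rpow_neg hyx0.le, ← Real.rpow_natCast ‖y - x‖ 2,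
      ← Real.rpow_mul hyx0.le]
    congr 2; push_cast; ring
  calc ∫⁻ y in D, ENNReal.ofReal (g y ^ 2 / ‖y - x‖ ^ p)
      = ∫⁻ y in D, liminf (fun n => ENNReal.ofReal (H n y)) atTop := by
        refine lintegral_congr_ae ?_
        filter_upwards [hlim] with y hy using hy.liminf_eq.symm
    _ ≤ liminf (fun n => ∫⁻ y in D, ENNReal.ofReal (H n y)) atTop :=
        lintegral_liminf_le fun n => (hHc n).measurable.ennreal_ofReal
    _ ≤ _ := by
        refine liminf_le_of_frequently_le' (Eventually.frequently ?_)
        filter_upwards [hns.tendsto_atTop.eventually hgrad] with n hn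
        have hcs : HasCompactSupport (H n) :=
          ((hφ (ns n)).2.1.comp_left (g := fun t => t ^ 2) (by simp)).mul_right
        have h2 := integral_sq_mul_regularized_le_grad hp0 hp2 hpd (hφ (ns n)).1 (hφ (ns n)).2.1
          (hδ0 n) x (W := W) (fun y hy => by
            have hyD := hD ((hφ (ns n)).2.2 (subset_tsupport _ hy))
            rw [mem_closedBall_zero_iff] at hyD
            have : ‖y - x‖ ≤ 2 * R + 1 := (norm_sub_le _ _).trans (by linarith)
            have := hδ1 n
            rw [hW]; gcongr) hW0
        calc ∫⁻ y in D, ENNReal.ofReal (H n y) ≤ ∫⁻ y, ENNReal.ofReal (H n y) :=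
              setLIntegral_le_lintegral _ _
          _ = ENNReal.ofReal (∫ y, H n y) := by
              rw [ofReal_integral_eq_lintegral_ofReal
                ((hHc n).integrable_of_hasCompactSupport hcs)]
              have := hδ0 n
              exact ae_of_all _ fun y => by simp only [hH, Pi.zero_apply]; positivity
          _ ≤ _ := by
              refine ENNReal.ofReal_le_ofReal (h2.trans ?_)
              gcongr

/-- Near `D` the Hardy inequality applies; at distance at least `1` from `D` the kernel is at most
`1`. -/
theorem exists_lintegral_riesz_le {p : ℝ} (hp0 : 0 ≤ p) (hp2 : p < 2) (hpd : p < d)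
    (hDm : MeasurableSet D) (hDb : Bornology.IsBounded D) :
    ∃ C : ℝ, ∀ g ∈ sobolevSphere D, ∀ x : Rd d,
      ∫⁻ y in D, ENNReal.ofReal (g y ^ 2 / ‖y - x‖ ^ p) ≤ ENNReal.ofReal C := by
  obtain ⟨R, hR, hD⟩ := hDb.subset_closedBall_lt 0 0
  refine ⟨max 1 (4 * ((2 * R + 1) ^ 2 + 1) ^ (1 - p / 2) / (d - p) ^ 2 * 9), fun g hg x => ?_⟩
  by_cases hx : ‖x‖ ≤ R + 1
  · exact (lintegral_riesz_le_of_norm_le hp0 hp2 hpd hR.le hD hg hx).trans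
      (ENNReal.ofReal_le_ofReal (le_max_right _ _))
  · have hint := integrableOn_sq_of_mem_sobolevSphere hg
    calc ∫⁻ y in D, ENNReal.ofReal (g y ^ 2 / ‖y - x‖ ^ p)
        ≤ ∫⁻ y in D, ENNReal.ofReal (g y ^ 2) := by
          refine setLIntegral_mono' hDm fun y hy => ENNReal.ofReal_le_ofReal ?_
          have hy' := hD hy
          rw [mem_closedBall_zero_iff] at hy'
          have h1 : 1 ≤ ‖y - x‖ := by
            have := norm_sub_norm_le x y
            rw [norm_sub_rev] at this
            linarith
          exact div_le_self (sq_nonneg _) (Real.one_le_rpow h1 hp0)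
      _ = ENNReal.ofReal (∫ y in D, g y ^ 2) :=
          (ofReal_integral_eq_lintegral_ofReal hint (ae_of_all _ fun y => sq_nonneg _)).symm
      _ ≤ _ := ENNReal.ofReal_le_ofReal
          ((integral_sq_le_one_of_mem_sobolevSphere hg).trans (le_max_left _ _))

theorem rhoStar_lt_top {p : ℝ} (hp0 : 0 ≤ p) (hp2 : p < 2) (hpd : p < d)
    (hDm : MeasurableSet D) (hDb : Bornology.IsBounded D) : rhoStar p D < ⊤ := by
  obtain ⟨C, hC⟩ := exists_lintegral_riesz_le hp0 hp2 hpd hDm hDb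
  refine lt_of_le_of_lt ?_ (ENNReal.ofReal_lt_top (r := C))
  exact iSup₂_le fun g hg => iSup_le fun x => hC g hg x

theorem lintegral_riesz_le_rhoStar (p : ℝ) {g : Rd d → ℝ} (hg : g ∈ sobolevSphere D) (x : Rd d) :
    ∫⁻ y in D, ENNReal.ofReal (g y ^ 2 / ‖y - x‖ ^ p) ≤ rhoStar p D := by
  have h1 := le_iSup (fun x => ∫⁻ y in D, ENNReal.ofReal (g y ^ 2 / ‖y - x‖ ^ p)) x
  refine h1.trans ?_
  unfold rhoStar
  exact le_iSup₂ (f := fun (g : Rd d → ℝ) (_ : g ∈ sobolevSphere D) =>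
    ⨆ x : Rd d, ∫⁻ y in D, ENNReal.ofReal (g y ^ 2 / ‖y - x‖ ^ p)) g hg

theorem exists_smul_mem_sobolevSphere {φ : Rd d → ℝ} (hφ : ContDiff ℝ ∞ φ)
    (hc : HasCompactSupport φ) (hD : tsupport φ ⊆ D) (hpos : 0 < ∫ y in D, φ y ^ 2) :
    ∃ s : ℝ, 0 < s ∧ (fun y => s * φ y) ∈ sobolevSphere D := by
  obtain ⟨A, hA⟩ : ∃ A, A = (∫ y in D, φ y ^ 2) + (1 / 2) * ∫ y in D, ‖gradient φ y‖ ^ 2 :=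
    ⟨_, rfl⟩
  have hA0 : 0 < A := by
    have h2 : 0 ≤ ∫ y in D, ‖gradient φ y‖ ^ 2 := integral_nonneg fun y => by positivity
    linarith
  obtain ⟨s, hs0, hs2⟩ : ∃ s : ℝ, 0 < s ∧ s ^ 2 * A = 1 := by
    refine ⟨(√A)⁻¹, by positivity, ?_⟩
    rw [inv_pow, Real.sq_sqrt hA0.le]; field_simp
  have hgrad : gradient (fun y => s * φ y) = fun y => s • gradient φ y := by
    ext1 y
    rw [gradient, gradient, fderiv_const_mul ((hφ.differentiable (by simp)) y), map_smul]
  have hgs : ContDiff ℝ ∞ fun y => s * φ y := contDiff_const.mul hφ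
  have hgc : HasCompactSupport fun y => s * φ y := hc.mul_left
  refine ⟨s, hs0, gradient (fun y => s * φ y), ⟨?_, ?_, fun _ y => s * φ y, fun _ =>
    ⟨hgs, hgc, ?_⟩, ?_, ?_⟩, ?_⟩
  · exact (hgs.continuous.memLp_of_hasCompactSupport hgc).restrict D
  · exact ((continuous_gradient hgs).memLp_of_hasCompactSupport
      (hasCompactSupport_gradient hgc)).restrict D
  · exact (closure_mono fun y hy => by
      simp only [Function.mem_support] at hy ⊢; exact right_ne_zero_of_mul hy).trans hD
  · simp
  · simp
  · rw [hgrad]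
    simp only [mul_pow, norm_smul, integral_const_mul, Real.norm_of_nonneg hs0.le]
    refine Eq.trans ?_ hs2
    rw [hA]; ring

theorem rhoStar_pos (hd : 0 < d) (p : ℝ) (hDo : IsOpen D) (hDn : D.Nonempty) :
    0 < rhoStar p D := by
  obtain ⟨c, hc⟩ := hDn
  obtain ⟨r, hr, hrD⟩ := Metric.nhds_basis_closedBall.mem_iff.1 (hDo.mem_nhds hc)
  obtain ⟨φ, hφs, hφc, hφD, hφ1⟩ : ∃ φ : Rd d → ℝ, ContDiff ℝ ∞ φ ∧ HasCompactSupport φ ∧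
      tsupport φ ⊆ D ∧ ∀ y ∈ Metric.ball c (r / 2), φ y = 1 := by
    let b : ContDiffBump c := ⟨r / 2, r, by linarith, by linarith⟩
    refine ⟨fun y => b y, b.contDiff, b.hasCompactSupport, ?_, fun y hy =>
      b.one_of_mem_closedBall (Metric.ball_subset_closedBall hy)⟩
    exact b.tsupport_eq.trans_subset hrD
  have hball : 0 < volume (Metric.ball c (r / 2)) := Metric.measure_ball_pos _ _ (by linarith)
  have hballD : Metric.ball c (r / 2) ⊆ D :=
    (Metric.ball_subset_closedBall.trans (Metric.closedBall_subset_closedBall (by linarith))).trans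
      hrD
  have hpos : 0 < ∫ y in D, φ y ^ 2 := by
    have hc2 : HasCompactSupport fun y => φ y ^ 2 :=
      hφc.comp_left (g := fun t => t ^ 2) (by simp)
    have hi : Integrable fun y => φ y ^ 2 :=
      (hφs.continuous.pow 2).integrable_of_hasCompactSupport hc2
    have hnn : 0 ≤ᵐ[volume.restrict D] fun y => φ y ^ 2 := ae_of_all _ fun y => sq_nonneg _
    rw [setIntegral_pos_iff_support_of_nonneg_ae hnn hi.integrableOn]
    refine hball.trans_le (measure_mono fun y hy => ⟨?_, hballD hy⟩)
    rw [Function.mem_support, hφ1 y hy]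
    norm_num
  obtain ⟨s, hs0, hmem⟩ := exists_smul_mem_sobolevSphere hφs hφc hφD hpos
  refine lt_of_lt_of_le ?_ (lintegral_riesz_le_rhoStar p hmem c)
  have : NullSingletonClass (volume : Measure (Rd d)) := by
    have : Nonempty (Fin d) := ⟨⟨0, hd⟩⟩
    infer_instance
  have hφm := hφs.continuous.measurable
  have hm : Measurable fun y => ENNReal.ofReal ((s * φ y) ^ 2 / ‖y - c‖ ^ p) := by fun_prop
  rw [setLIntegral_pos_iff hm]
  have h1 : volume (Metric.ball c (r / 2) \ {c}) = volume (Metric.ball c (r / 2)) :=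
    measure_sdiff_null (measure_singleton c)
  rw [← h1] at hball
  refine hball.trans_le (measure_mono fun y hy => ⟨?_, hballD hy.1⟩)
  rw [Function.mem_support, ne_eq, ENNReal.ofReal_eq_zero, not_le, hφ1 y hy.1]
  have : 0 < ‖y - c‖ := norm_pos_iff.2 (sub_ne_zero.2 hy.2)
  positivity

end RhoStar

/-! ### Second-order expansion of the Riesz kernel at infinity -/

section Expansion

variable {d : ℕ}

/-- Taylor estimate for `(1 + u)^{-s}`, a consequence of Bernoulli's inequality for the exponents
`s` and `1 - s`. -/
theorem abs_one_add_rpow_neg_sub_le {s u : ℝ} (hs0 : 0 ≤ s) (hs1 : s ≤ 1) (hu : 1 / 4 ≤ 1 + u) :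
    |(1 + u) ^ (-s) - 1 + s * u| ≤ 4 * u ^ 2 := by
  have h1u : 0 < 1 + u := by linarith
  have hb1 := rpow_one_add_le_one_add_mul_self (s := u) (by linarith) hs0 hs1
  have hb2 := rpow_one_add_le_one_add_mul_self (s := u) (by linarith)
    (p := 1 - s) (by linarith) (by linarith)
  have hpos : 0 < (1 + u) ^ s := Real.rpow_pos_of_pos h1u _
  have hlow : 1 - s * u ≤ (1 + u) ^ (-s) := by
    rw [Real.rpow_neg h1u.le, inv_eq_one_div, le_div_iff₀ hpos]
    by_cases h : 0 ≤ 1 - s * u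
    · calc (1 - s * u) * (1 + u) ^ s ≤ (1 - s * u) * (1 + s * u) := by gcongr
        _ ≤ 1 := by nlinarith [sq_nonneg (s * u)]
    · nlinarith
  have hup : (1 + u) ^ (-s) ≤ 1 - s * u + 4 * u ^ 2 := by
    have h1 : (1 + u) ^ (-s) = (1 + u) ^ (1 - s) / (1 + u) := by
      rw [div_eq_mul_inv, ← Real.rpow_neg_one, ← Real.rpow_add h1u]; ring_nf
    rw [h1, div_le_iff₀ h1u]
    have h2 : 0 ≤ u ^ 2 * (4 * (1 + u) - s) := mul_nonneg (sq_nonneg _) (by linarith)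
    nlinarith
  rw [abs_le]
  constructor
  · nlinarith [sq_nonneg u]
  · linarith

/-- The expansion `|y - x|^{-p} = |x|^{-p} + p ⟨x, y⟩ |x|^{-p-2} + O(|x|^{-p-2})` for bounded `y`,
from the Taylor estimate at `u = |y - x|² / |x|² - 1`. -/
theorem abs_riesz_sub_expansion_le {p R : ℝ} (hp0 : 0 ≤ p) (hp2 : p ≤ 2) (hR : 0 ≤ R)
    {x y : Rd d} (hy : ‖y‖ ≤ R) (hx : 2 * R ≤ ‖x‖) (hx0 : 0 < ‖x‖) :
    |riesz p (y - x) - ‖x‖ ^ (-p) - p * inner ℝ x y * ‖x‖ ^ (-p - 2)| ≤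
      26 * R ^ 2 * ‖x‖ ^ (-p - 2) := by
  set r := ‖x‖ with hr
  set u := (‖y‖ ^ 2 - 2 * inner ℝ x y) / r ^ 2 with hu
  have hr2 : 0 < r ^ 2 := by positivity
  have hyx : ‖y - x‖ ^ 2 = r ^ 2 * (1 + u) := by
    rw [@norm_sub_sq_real, real_inner_comm, hu]; field_simp; ring
  have hyxl : r / 2 ≤ ‖y - x‖ := by
    have := norm_sub_norm_le x y
    rw [norm_sub_rev] at this
    linarith
  have h1u : 1 / 4 ≤ 1 + u := by
    have h1 : (r / 2) ^ 2 ≤ ‖y - x‖ ^ 2 := by gcongr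
    rw [hyx] at h1
    nlinarith
  have hin : |inner ℝ x y| ≤ r * R := (abs_real_inner_le_norm x y).trans (by gcongr)
  have hy2 : ‖y‖ ^ 2 ≤ R ^ 2 := by gcongr
  have hu2 : u ^ 2 ≤ 25 / 4 * R ^ 2 / r ^ 2 := by
    have h1 : |‖y‖ ^ 2 - 2 * inner ℝ x y| ≤ 5 / 2 * R * r := by
      rw [abs_le] at hin ⊢
      have : 0 ≤ ‖y‖ ^ 2 := by positivity
      constructor <;> nlinarith
    have h2 : (‖y‖ ^ 2 - 2 * inner ℝ x y) ^ 2 ≤ (5 / 2 * R * r) ^ 2 := by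
      rw [← sq_abs]; gcongr
    rw [hu, div_pow, div_le_div_iff₀ (by positivity) hr2]
    nlinarith [mul_le_mul_of_nonneg_right h2 hr2.le]
  have hT := abs_one_add_rpow_neg_sub_le (s := p / 2) (by linarith) (by linarith) h1u
  have hriesz : riesz p (y - x) = r ^ (-p) * (1 + u) ^ (-(p / 2)) := by
    have hy0 : 0 ≤ ‖y - x‖ := norm_nonneg _
    rw [riesz, one_div, ← Real.rpow_neg hy0]
    have e1 : ‖y - x‖ ^ (-p) = (‖y - x‖ ^ 2) ^ (-(p / 2)) := by
      rw [← Real.rpow_natCast, ← Real.rpow_mul hy0]; congr 1; push_cast; ring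
    have e2 : r ^ (-p) = (r ^ 2) ^ (-(p / 2)) := by
      rw [← Real.rpow_natCast, ← Real.rpow_mul hx0.le]; congr 1; push_cast; ring
    rw [e1, e2, hyx, Real.mul_rpow hr2.le (by linarith)]
  have hrp : r ^ (-p) = r ^ (-p - 2) * r ^ 2 := by
    rw [← Real.rpow_natCast r 2, ← Real.rpow_add hx0]; congr 1; push_cast; ring
  have hrpos : 0 < r ^ (-p - 2) := Real.rpow_pos_of_pos hx0 _
  have hsplit : riesz p (y - x) - r ^ (-p) - p * inner ℝ x y * r ^ (-p - 2) =
      r ^ (-p - 2) * (r ^ 2 * ((1 + u) ^ (-(p / 2)) - 1 + p / 2 * u) - p / 2 * ‖y‖ ^ 2) := by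
    rw [hriesz, hrp, hu]; field_simp; ring
  rw [hsplit, abs_mul, abs_of_pos hrpos, mul_comm]
  gcongr
  have h3 : |r ^ 2 * ((1 + u) ^ (-(p / 2)) - 1 + p / 2 * u)| ≤ 25 * R ^ 2 := by
    rw [abs_mul, abs_of_pos hr2]
    calc r ^ 2 * |(1 + u) ^ (-(p / 2)) - 1 + p / 2 * u| ≤ r ^ 2 * (4 * u ^ 2) := by gcongr
      _ ≤ r ^ 2 * (4 * (25 / 4 * R ^ 2 / r ^ 2)) := by gcongr
      _ = 25 * R ^ 2 := by field_simp
  have h4 : |p / 2 * ‖y‖ ^ 2| ≤ R ^ 2 := by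
    rw [abs_of_nonneg (by positivity)]
    nlinarith [sq_nonneg R, sq_nonneg ‖y‖]
  calc _ ≤ |r ^ 2 * ((1 + u) ^ (-(p / 2)) - 1 + p / 2 * u)| + |p / 2 * ‖y‖ ^ 2| := abs_sub _ _
    _ ≤ _ := by linarith

/-- The kernel `‖x‖^{-p}`, cut off inside the unit ball. -/
def tailZero (p : ℝ) : Rd d → ℝ := {x | 1 ≤ ‖x‖}.indicator fun x => ‖x‖ ^ (-p)

/-- The kernel `x_i ‖x‖^{-p-2}`, cut off inside the unit ball. -/
def tailLin (p : ℝ) (i : Fin d) : Rd d → ℝ :=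
  {x | 1 ≤ ‖x‖}.indicator fun x => x i * ‖x‖ ^ (-p - 2)

/-- The kernel `‖x‖^{-p-2}`, cut off inside the unit ball. -/
def tailQuad (p : ℝ) : Rd d → ℝ := {x | 1 ≤ ‖x‖}.indicator fun x => ‖x‖ ^ (-p - 2)

theorem measurableSet_one_le_norm : MeasurableSet {x : Rd d | 1 ≤ ‖x‖} :=
  measurableSet_le measurable_const measurable_norm

theorem isTailKernel_indicator {p : ℝ} (hp0 : 0 ≤ p) {f : Rd d → ℝ} (hf : Measurable f)
    (h : ∀ x, 1 ≤ ‖x‖ → |f x| ≤ ‖x‖ ^ (-p)) :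
    IsTailKernel p ({x | 1 ≤ ‖x‖}.indicator f) where
  measurable := hf.indicator measurableSet_one_le_norm
  le_one x := by
    by_cases hx : 1 ≤ ‖x‖
    · rw [indicator_of_mem (by exact hx)]
      exact (h x hx).trans (Real.rpow_le_one_of_one_le_of_nonpos hx (by linarith))
    · rw [indicator_of_notMem (by exact hx)]; simp
  le_rpow x hx := by
    rw [indicator_of_mem (by exact hx)]
    exact h x hx

theorem isTailKernel_tailZero {p : ℝ} (hp0 : 0 ≤ p) : IsTailKernel p (tailZero (d := d) p) :=
  isTailKernel_indicator hp0 (by fun_prop) fun x _ => by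
    rw [abs_of_nonneg (by positivity)]

theorem isTailKernel_tailLin {p : ℝ} (hp0 : 0 ≤ p) (i : Fin d) :
    IsTailKernel p (tailLin p i) :=
  isTailKernel_indicator hp0 (by fun_prop) fun x hx => by
    rw [abs_mul, abs_of_nonneg (by positivity : 0 ≤ ‖x‖ ^ (-p - 2))]
    have h1 : |x i| ≤ ‖x‖ := by
      have := PiLp.norm_apply_le x i
      simpa using this
    calc |x i| * ‖x‖ ^ (-p - 2) ≤ ‖x‖ ^ (1 : ℝ) * ‖x‖ ^ (-p - 2) := by
          rw [Real.rpow_one]; gcongr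
      _ = ‖x‖ ^ (-p - 1) := by rw [← Real.rpow_add (by linarith)]; ring_nf
      _ ≤ _ := Real.rpow_le_rpow_of_exponent_le hx (by linarith)

theorem isTailKernel_tailQuad {p : ℝ} (hp0 : 0 ≤ p) : IsTailKernel p (tailQuad (d := d) p) :=
  isTailKernel_indicator hp0 (by fun_prop) fun x hx => by
    rw [abs_of_nonneg (by positivity)]
    exact Real.rpow_le_rpow_of_exponent_le hx (by linarith)

theorem tailQuad_nonneg (p : ℝ) (x : Rd d) : 0 ≤ tailQuad p x :=
  indicator_nonneg (fun x _ => by positivity) x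

/-- The increments of the truncated compensated integral of a function that agrees with a linear
combination of `tailZero` and `tailLin` up to a multiple of `tailQuad` are controlled by those of
the finitely many tail kernels. -/
theorem abs_truncInt_sub_le {p : ℝ} (hp : (d : ℝ) / 2 < p) (hp0 : 0 ≤ p) (hd : (d : ℝ) ≤ 4)
    {ε : ℝ} (hε : 0 ≤ ε)
    {μ : Measure (Rd d)} (hμ : ∀ n : ℕ, μ (Metric.closedBall 0 (n : ℝ)) < ⊤) {f : Rd d → ℝ}
    (hf : Measurable f) {c : ℝ} (hfc : ∀ x, |f x| ≤ c) {m₀ C : ℝ} (m : Fin d → ℝ) {j n : ℕ}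
    (hC : 0 ≤ C) (hj : 1 ≤ j) (hjn : j ≤ n)
    (hfe : ∀ x, (j : ℝ) ≤ ‖x‖ →
      |f x - (m₀ * tailZero p x + ∑ i, p * m i * tailLin p i x)| ≤ C * tailQuad p x) :
    |truncInt μ (ENNReal.ofReal ε • volume) f n - truncInt μ (ENNReal.ofReal ε • volume) f j| ≤
      |m₀| * |truncInt μ (ENNReal.ofReal ε • volume) (tailZero p) n -
        truncInt μ (ENNReal.ofReal ε • volume) (tailZero p) j| +
      ∑ i, p * |m i| * |truncInt μ (ENNReal.ofReal ε • volume) (tailLin p i) n -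
        truncInt μ (ENNReal.ofReal ε • volume) (tailLin p i) j| +
      C * (|truncInt μ (ENNReal.ofReal ε • volume) (tailQuad p) n -
        truncInt μ (ENNReal.ofReal ε • volume) (tailQuad p) j| +
        2 * (ε * ((j : ℝ) ^ (-(2 - (d : ℝ) / 2)) * tailConst d p))) := by
  set ν : Measure (Rd d) := ENNReal.ofReal ε • volume with hν
  have hνfin : ∀ n : ℕ, ν (Metric.closedBall 0 (n : ℝ)) < ⊤ := fun n =>
    (ofReal_smul_volume_ne_top ε measure_closedBall_lt_top.ne).lt_top
  set B : Set (Rd d) := Metric.closedBall 0 (n : ℝ) \ Metric.closedBall 0 (j : ℝ) with hB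
  have hBm : MeasurableSet B :=
    Metric.isClosed_closedBall.measurableSet.diff Metric.isClosed_closedBall.measurableSet
  have hBj : ∀ x ∈ B, (j : ℝ) ≤ ‖x‖ := by
    rintro x ⟨-, hx⟩
    rw [mem_closedBall_zero_iff, not_le] at hx
    exact hx.le
  have hj' : (1 : ℝ) ≤ j := by exact_mod_cast hj
  have hbd : ∀ {k : Rd d → ℝ} {c' : ℝ}, Measurable k → (∀ x, |k x| ≤ c') →
      ∀ m' : Measure (Rd d), (∀ n : ℕ, m' (Metric.closedBall 0 (n : ℝ)) < ⊤) →
      IntegrableOn k (Metric.closedBall 0 (n : ℝ)) m' := by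
    intro k c' hk hkc m' hm'
    have : IsFiniteMeasure (m'.restrict (Metric.closedBall 0 (n : ℝ))) := ⟨by simpa using hm' n⟩
    exact Integrable.of_bound hk.aestronglyMeasurable c' (ae_of_all _ hkc)
  have hz := isTailKernel_tailZero (d := d) hp0
  have hl := isTailKernel_tailLin (d := d) hp0
  have hq := isTailKernel_tailQuad (d := d) hp0
  rw [truncInt_sub hjn (hbd hf hfc μ hμ) (hbd hf hfc ν hνfin),
    truncInt_sub hjn (hbd hz.measurable hz.le_one μ hμ) (hbd hz.measurable hz.le_one ν hνfin),
    truncInt_sub hjn (hbd hq.measurable hq.le_one μ hμ) (hbd hq.measurable hq.le_one ν hνfin)]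
  simp only [fun i => truncInt_sub hjn (hbd (hl i).measurable (hl i).le_one μ hμ)
    (hbd (hl i).measurable (hl i).le_one ν hνfin)]
  set r : Rd d → ℝ := fun x => f x - (m₀ * tailZero p x + ∑ i, p * m i * tailLin p i x) with hr
  have hsub : B ⊆ Metric.closedBall 0 (n : ℝ) := sdiff_subset
  have key : ∀ m' : Measure (Rd d), (∀ n : ℕ, m' (Metric.closedBall 0 (n : ℝ)) < ⊤) →
      (∫ x in B, f x ∂m' = m₀ * (∫ x in B, tailZero p x ∂m') +
        (∑ i, p * m i * ∫ x in B, tailLin p i x ∂m') + ∫ x in B, r x ∂m') ∧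
      |∫ x in B, r x ∂m'| ≤ C * ∫ x in B, tailQuad p x ∂m' := by
    intro m' hm'
    have i1 := (hbd hf hfc m' hm').mono_set hsub
    have i2 := ((hbd hz.measurable hz.le_one m' hm').mono_set hsub).const_mul m₀
    have i3 : ∀ i ∈ Finset.univ, IntegrableOn (fun x => p * m i * tailLin p i x) B m' := fun i _ =>
      ((hbd (hl i).measurable (hl i).le_one m' hm').mono_set hsub).const_mul (p * m i)
    have i3' := integrable_finsetSum _ i3
    have i4 := (hbd hq.measurable hq.le_one m' hm').mono_set hsub
    constructor
    · have : ∫ x in B, r x ∂m' = (∫ x in B, f x ∂m') -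
          (m₀ * (∫ x in B, tailZero p x ∂m') +
            ∑ i, p * m i * ∫ x in B, tailLin p i x ∂m') := by
        have e1 : ∫ x in B, r x ∂m' = (∫ x in B, f x ∂m') -
            ∫ x in B, (m₀ * tailZero p x + ∑ i, p * m i * tailLin p i x) ∂m' :=
          integral_sub i1 (i2.add i3')
        rw [e1, integral_add i2 i3', integral_const_mul, integral_finsetSum _ i3]
        simp only [integral_const_mul]
      rw [this]; ring
    · rw [← integral_const_mul, ← Real.norm_eq_abs]
      refine norm_integral_le_of_norm_le (i4.const_mul C) ?_
      filter_upwards [ae_restrict_mem hBm] with x hx using hfe x (hBj x hx)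
  obtain ⟨k1, k2⟩ := key μ hμ
  obtain ⟨k3, k4⟩ := key ν hνfin
  have hνq : ∫ x in B, tailQuad p x ∂ν ≤ ε * ((j : ℝ) ^ (-(2 - (d : ℝ) / 2)) * tailConst d p) := by
    rw [hν, integral_smul_ofReal hε]
    refine mul_le_mul_of_nonneg_left ?_ hε
    have := setIntegral_le_of_rpow (κ := 2 - (d : ℝ) / 2) hp (by linarith) hj hBm hBj
      hq.measurable fun x hx => by
        rw [abs_of_nonneg (tailQuad_nonneg p x), tailQuad,
          indicator_of_mem (by exact hj'.trans (hBj x hx))]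
        refine le_of_eq ?_
        congr 1; ring
    simpa only [abs_of_nonneg (tailQuad_nonneg p _)] using this
  have hq0 : 0 ≤ ∫ x in B, tailQuad p x ∂ν := integral_nonneg (tailQuad_nonneg p)
  have e1 : (∫ x in B, f x ∂μ) - ∫ x in B, f x ∂ν =
      m₀ * ((∫ x in B, tailZero p x ∂μ) - ∫ x in B, tailZero p x ∂ν) +
      ∑ i, p * m i * ((∫ x in B, tailLin p i x ∂μ) - ∫ x in B, tailLin p i x ∂ν) +
      ((∫ x in B, r x ∂μ) - ∫ x in B, r x ∂ν) := by
    rw [k1, k3]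
    simp only [mul_sub, Finset.sum_sub_distrib]
    ring
  rw [e1]
  refine (abs_add_three _ _ _).trans (add_le_add_three (abs_mul _ _).le ?_ ?_)
  · refine (Finset.abs_sum_le_sum_abs _ _).trans (Finset.sum_le_sum fun i _ => ?_)
    rw [abs_mul, abs_mul, abs_of_nonneg hp0]
  · calc |(∫ x in B, r x ∂μ) - ∫ x in B, r x ∂ν| ≤ |∫ x in B, r x ∂μ| + |∫ x in B, r x ∂ν| :=
          abs_sub _ _
      _ ≤ C * (∫ x in B, tailQuad p x ∂μ) + C * ∫ x in B, tailQuad p x ∂ν := add_le_add k2 k4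
      _ = C * (((∫ x in B, tailQuad p x ∂μ) - ∫ x in B, tailQuad p x ∂ν) +
          2 * ∫ x in B, tailQuad p x ∂ν) := by ring
      _ ≤ _ := by
          gcongr
          exact le_abs_self _

end Expansion

/-! ### Smoothed kernels -/

section Smear

variable {d : ℕ} {D : Set (Rd d)} {p : ℝ}

/-- Nonnegative measurable kernels dominated by the Riesz kernel. -/
structure IsSubRiesz (p : ℝ) (K : Rd d → ℝ) : Prop where
  measurable : Measurable K
  nonneg : ∀ z, 0 ≤ K z
  le_riesz : ∀ z, K z ≤ riesz p z

theorem riesz_nonneg (p : ℝ) (z : Rd d) : 0 ≤ riesz p z := by unfold riesz; positivity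

theorem measurable_riesz (p : ℝ) : Measurable (riesz (d := d) p) := by
  unfold riesz; fun_prop

theorem isSubRiesz_riesz (p : ℝ) : IsSubRiesz (d := d) p (riesz p) :=
  ⟨measurable_riesz p, riesz_nonneg p, fun _ => le_rfl⟩

theorem cutoff_scale_nonneg {a ε : ℝ} (ha : 0 < a) (hε : ε ∈ Ioo (0 : ℝ) 1) (p : ℝ) :
    0 < a⁻¹ * Real.log ε⁻¹ ^ (-(1 / p)) := by
  have h1 : 0 < Real.log ε⁻¹ := Real.log_pos ((one_lt_inv₀ hε.1).2 hε.2)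
  positivity

theorem measurable_cutoff_norm {α : ℝ → ℝ} (hα : IsCutoff α) {c : ℝ} (hc : 0 ≤ c) :
    Measurable fun z : Rd d => α (c * ‖z‖) := by
  have h1 : Continuous fun z : Rd d => α (c * ‖z‖) :=
    hα.smooth.continuousOn.comp_continuous (by fun_prop) fun z => by
      simp only [mem_Ici]; positivity
  exact h1.measurable

theorem isSubRiesz_kerK {α : ℝ → ℝ} (hα : IsCutoff α) {a ε : ℝ} (ha : 0 < a)
    (hε : ε ∈ Ioo (0 : ℝ) 1) : IsSubRiesz (d := d) p (kerK p α a ε) := by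
  have hc := cutoff_scale_nonneg ha hε p
  have h1 : ∀ z : Rd d, α (a⁻¹ * Real.log ε⁻¹ ^ (-(1 / p)) * ‖z‖) ∈ Icc (0 : ℝ) 1 := fun z =>
    hα.mem_Icc _ (by simp only [mem_Ici]; positivity)
  exact ⟨(measurable_riesz p).mul (measurable_cutoff_norm hα hc.le),
    fun z => mul_nonneg (riesz_nonneg p z) (h1 z).1,
    fun z => mul_le_of_le_one_right (riesz_nonneg p z) (h1 z).2⟩

theorem isSubRiesz_kerL {α : ℝ → ℝ} (hα : IsCutoff α) {a ε : ℝ} (ha : 0 < a)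
    (hε : ε ∈ Ioo (0 : ℝ) 1) : IsSubRiesz (d := d) p (kerL p α a ε) := by
  have hc := cutoff_scale_nonneg ha hε p
  have h1 : ∀ z : Rd d, α (a⁻¹ * Real.log ε⁻¹ ^ (-(1 / p)) * ‖z‖) ∈ Icc (0 : ℝ) 1 := fun z =>
    hα.mem_Icc _ (by simp only [mem_Ici]; positivity)
  exact ⟨(measurable_riesz p).mul ((measurable_cutoff_norm hα hc.le).const_sub 1),
    fun z => mul_nonneg (riesz_nonneg p z) (by linarith [(h1 z).2]),
    fun z => mul_le_of_le_one_right (riesz_nonneg p z) (by linarith [(h1 z).1])⟩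

/-- The radius of the cutoff: `kerK` is the Riesz kernel inside the ball of this radius, and
vanishes outside the ball with three times this radius. -/
def cutoffRadius (p a ε : ℝ) : ℝ := a * Real.log ε⁻¹ ^ (1 / p)

theorem cutoffRadius_pos {a ε : ℝ} (ha : 0 < a) (hε : ε ∈ Ioo (0 : ℝ) 1) (p : ℝ) :
    0 < cutoffRadius p a ε := by
  have h1 : 0 < Real.log ε⁻¹ := Real.log_pos ((one_lt_inv₀ hε.1).2 hε.2)
  unfold cutoffRadius; positivity

theorem cutoff_scale_mul {a ε : ℝ} (ha : 0 < a) (hε : ε ∈ Ioo (0 : ℝ) 1) (p r : ℝ) :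
    a⁻¹ * Real.log ε⁻¹ ^ (-(1 / p)) * r = r / cutoffRadius p a ε := by
  have h1 : 0 < Real.log ε⁻¹ := Real.log_pos ((one_lt_inv₀ hε.1).2 hε.2)
  rw [cutoffRadius, Real.rpow_neg h1.le]
  field_simp

theorem kerK_eq_riesz {α : ℝ → ℝ} (hα : IsCutoff α) {a ε : ℝ} (ha : 0 < a)
    (hε : ε ∈ Ioo (0 : ℝ) 1) {z : Rd d} (hz : ‖z‖ ≤ cutoffRadius p a ε) :
    kerK p α a ε z = riesz p z := by
  have hr := cutoffRadius_pos ha hε p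
  rw [kerK, cutoff_scale_mul ha hε, hα.eq_one _ ⟨by positivity, (div_le_one hr).2 hz⟩, mul_one]

theorem kerK_eq_zero {α : ℝ → ℝ} (hα : IsCutoff α) {a ε : ℝ} (ha : 0 < a)
    (hε : ε ∈ Ioo (0 : ℝ) 1) {z : Rd d} (hz : 3 * cutoffRadius p a ε ≤ ‖z‖) :
    kerK p α a ε z = 0 := by
  have hr := cutoffRadius_pos ha hε p
  rw [kerK, cutoff_scale_mul ha hε, hα.eq_zero _ ((le_div_iff₀ hr).2 hz), mul_zero]

theorem kerK_add_kerL (p : ℝ) (α : ℝ → ℝ) (a ε : ℝ) (z : Rd d) :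
    kerK p α a ε z + kerL p α a ε z = riesz p z := by
  unfold kerK kerL; ring

theorem kerL_le {α : ℝ → ℝ} (hα : IsCutoff α) {a ε : ℝ} (ha : 0 < a)
    (hε : ε ∈ Ioo (0 : ℝ) 1) (hp : 0 < p) (z : Rd d) :
    kerL p α a ε z ≤ a ^ (-p) / Real.log ε⁻¹ := by
  have hr := cutoffRadius_pos ha hε p
  have hlog : 0 < Real.log ε⁻¹ := Real.log_pos ((one_lt_inv₀ hε.1).2 hε.2)
  by_cases hz : ‖z‖ ≤ cutoffRadius p a ε
  · have h1 := kerK_add_kerL p α a ε z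
    rw [kerK_eq_riesz hα ha hε hz] at h1
    have : kerL p α a ε z = 0 := by linarith
    rw [this]; positivity
  · push Not at hz
    refine ((isSubRiesz_kerL hα ha hε).le_riesz z).trans ?_
    have h2 : cutoffRadius p a ε ^ p ≤ ‖z‖ ^ p := Real.rpow_le_rpow hr.le hz.le hp.le
    have h3 : cutoffRadius p a ε ^ p = a ^ p * Real.log ε⁻¹ := by
      rw [cutoffRadius, Real.mul_rpow ha.le (by positivity), ← Real.rpow_mul hlog.le,
        one_div_mul_cancel hp.ne', Real.rpow_one]
    rw [riesz, Real.rpow_neg ha.le, ← one_div, div_div, ← h3]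
    gcongr

theorem IsSubRiesz.lintegral_le {K : Rd d → ℝ} (hK : IsSubRiesz p K) {g : Rd d → ℝ}
    (hg : g ∈ sobolevSphere D) (x : Rd d) :
    ∫⁻ y in D, ENNReal.ofReal (K (y - x) * g y ^ 2) ≤ rhoStar p D := by
  refine le_trans (lintegral_mono fun y => ENNReal.ofReal_le_ofReal ?_)
    (lintegral_riesz_le_rhoStar p hg x)
  calc K (y - x) * g y ^ 2 ≤ riesz p (y - x) * g y ^ 2 := by
        gcongr; exact hK.le_riesz _
    _ = g y ^ 2 / ‖y - x‖ ^ p := by rw [riesz]; ring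

theorem IsSubRiesz.aestronglyMeasurable {K : Rd d → ℝ} (hK : IsSubRiesz p K) {g : Rd d → ℝ}
    (hg : g ∈ sobolevSphere D) (x : Rd d) :
    AEStronglyMeasurable (fun y => K (y - x) * g y ^ 2) (volume.restrict D) := by
  obtain ⟨G, hG, -⟩ := hg
  exact (hK.measurable.comp (measurable_id.sub_const x)).aestronglyMeasurable.mul
    (hG.memLp.1.pow 2)

theorem IsSubRiesz.integrableOn {K : Rd d → ℝ} (hK : IsSubRiesz p K) (hρ : rhoStar p D < ⊤)
    {g : Rd d → ℝ} (hg : g ∈ sobolevSphere D) (x : Rd d) :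
    IntegrableOn (fun y => K (y - x) * g y ^ 2) D := by
  refine ⟨hK.aestronglyMeasurable hg x, ?_⟩
  refine lt_of_le_of_lt (le_of_eq ?_) ((hK.lintegral_le hg x).trans_lt hρ)
  refine lintegral_congr fun _ => ?_
  exact Real.enorm_of_nonneg (mul_nonneg (hK.nonneg _) (sq_nonneg _))

theorem IsSubRiesz.smear_nonneg {K : Rd d → ℝ} (hK : IsSubRiesz p K) (D : Set (Rd d))
    (g : Rd d → ℝ) (x : Rd d) : 0 ≤ smear D K g x :=
  integral_nonneg fun _ => mul_nonneg (hK.nonneg _) (sq_nonneg _)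

theorem IsSubRiesz.smear_le {K : Rd d → ℝ} (hK : IsSubRiesz p K) (hρ : rhoStar p D < ⊤)
    {g : Rd d → ℝ} (hg : g ∈ sobolevSphere D) (x : Rd d) :
    smear D K g x ≤ (rhoStar p D).toReal := by
  rw [smear, integral_eq_lintegral_of_nonneg_ae
    (ae_of_all _ fun _ => mul_nonneg (hK.nonneg _) (sq_nonneg _)) (hK.aestronglyMeasurable hg x)]
  exact ENNReal.toReal_mono hρ.ne (hK.lintegral_le hg x)

theorem IsSubRiesz.abs_smear_le {K : Rd d → ℝ} (hK : IsSubRiesz p K) (hρ : rhoStar p D < ⊤)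
    {g : Rd d → ℝ} (hg : g ∈ sobolevSphere D) (x : Rd d) :
    |smear D K g x| ≤ (rhoStar p D).toReal := by
  rw [abs_of_nonneg (hK.smear_nonneg D g x)]
  exact hK.smear_le hρ hg x

theorem IsSubRiesz.smear_le_of_le {K : Rd d → ℝ} (hK : IsSubRiesz p K) (hρ : rhoStar p D < ⊤)
    {b : ℝ} (hb : 0 ≤ b) (hKb : ∀ z, K z ≤ b) {g : Rd d → ℝ} (hg : g ∈ sobolevSphere D)
    (x : Rd d) : smear D K g x ≤ b := by
  calc smear D K g x ≤ ∫ y in D, b * g y ^ 2 :=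
        integral_mono (hK.integrableOn hρ hg x)
          ((integrableOn_sq_of_mem_sobolevSphere hg).const_mul b)
          fun y => mul_le_mul_of_nonneg_right (hKb _) (sq_nonneg _)
    _ = b * ∫ y in D, g y ^ 2 := integral_const_mul _ _
    _ ≤ b := mul_le_of_le_one_right hb (integral_sq_le_one_of_mem_sobolevSphere hg)

theorem IsSubRiesz.measurable_smear {K : Rd d → ℝ} (hK : IsSubRiesz p K)
    {g : Rd d → ℝ} (hg : g ∈ sobolevSphere D) : Measurable (smear D K g) := by
  obtain ⟨G, hG, -⟩ := hg
  have h1 : smear D K g = fun x => ∫ y in D, K (y - x) * hG.memLp.1.mk g y ^ 2 := by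
    ext x
    refine integral_congr_ae ?_
    filter_upwards [hG.memLp.1.ae_eq_mk] with y hy
    rw [hy]
  rw [h1]
  have h2 : Measurable fun z : Rd d × Rd d => K (z.2 - z.1) * hG.memLp.1.mk g z.2 ^ 2 :=
    (hK.measurable.comp (measurable_snd.sub measurable_fst)).mul
      ((hG.memLp.1.stronglyMeasurable_mk.measurable.comp measurable_snd).pow_const 2)
  exact (h2.stronglyMeasurable.integral_prod_right').measurable

theorem smear_add_smear {K L : Rd d → ℝ} (hK : IsSubRiesz p K) (hL : IsSubRiesz p L)
    (hKL : ∀ z, K z + L z = riesz p z) (hρ : rhoStar p D < ⊤)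
    {g : Rd d → ℝ} (hg : g ∈ sobolevSphere D) (x : Rd d) :
    smear D K g x + smear D L g x = smear D (riesz p) g x := by
  unfold smear
  rw [← integral_add (hK.integrableOn hρ hg x) (hL.integrableOn hρ hg x)]
  refine integral_congr_ae (ae_of_all _ fun y => ?_)
  simp only [← hKL, add_mul]

theorem smear_congr {K K' : Rd d → ℝ} (hD : MeasurableSet D) (g : Rd d → ℝ) {x : Rd d}
    (h : ∀ y ∈ D, K (y - x) = K' (y - x)) : smear D K g x = smear D K' g x :=
  setIntegral_congr_fun hD fun y hy => by simp only [h y hy]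

/-- The smoothed Riesz kernel is a combination of `tailZero` and `tailLin`, with coefficients the
first moments of `g²`, up to a multiple of `tailQuad`. -/
theorem abs_smear_riesz_sub_expansion_le (hp0 : 0 ≤ p) (hp2 : p ≤ 2) {R : ℝ} (hR : 0 ≤ R)
    (hDm : MeasurableSet D) (hD : D ⊆ Metric.closedBall 0 R) (hρ : rhoStar p D < ⊤)
    {g : Rd d → ℝ} (hg : g ∈ sobolevSphere D) {x : Rd d} (hx1 : 1 ≤ ‖x‖) (hx : 2 * R ≤ ‖x‖) :
    |smear D (riesz p) g x - ((∫ y in D, g y ^ 2) * tailZero p x +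
      ∑ i, p * (∫ y in D, y i * g y ^ 2) * tailLin p i x)| ≤ 26 * R ^ 2 * tailQuad p x := by
  have hx0 : 0 < ‖x‖ := by linarith
  have hint := integrableOn_sq_of_mem_sobolevSphere hg
  have hDn : ∀ y ∈ D, ‖y‖ ≤ R := fun y hy => by simpa using hD hy
  have hint1 : ∀ i, IntegrableOn (fun y : Rd d => y i * g y ^ 2) D := by
    intro i
    refine Integrable.mono' (hint.const_mul R)
      ((by fun_prop : Measurable fun y : Rd d => y i).aestronglyMeasurable.mul hint.1) ?_
    filter_upwards [ae_restrict_mem hDm] with y hy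
    rw [norm_mul, Real.norm_of_nonneg (sq_nonneg (g y))]
    gcongr
    exact (PiLp.norm_apply_le y i).trans (hDn y hy)
  have hin : ∀ y : Rd d, inner ℝ x y * g y ^ 2 = ∑ i, x i * (y i * g y ^ 2) := by
    intro y
    rw [PiLp.inner_apply, Finset.sum_mul]
    refine Finset.sum_congr rfl fun i _ => ?_
    simp; ring
  have hint2 : IntegrableOn (fun y => inner ℝ x y * g y ^ 2) D := by
    simp only [hin]
    exact integrable_finsetSum _ fun i _ => (hint1 i).const_mul _
  have hinner : ∫ y in D, inner ℝ x y * g y ^ 2 = ∑ i, x i * ∫ y in D, y i * g y ^ 2 := by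
    simp only [hin]
    rw [integral_finsetSum _ fun i _ => (hint1 i).const_mul _]
    simp only [integral_const_mul]
  have e1 : (∫ y in D, g y ^ 2) * tailZero p x +
      ∑ i, p * (∫ y in D, y i * g y ^ 2) * tailLin p i x =
      ∫ y in D, (‖x‖ ^ (-p) * g y ^ 2 + p * ‖x‖ ^ (-p - 2) * (inner ℝ x y * g y ^ 2)) := by
    rw [integral_add (hint.const_mul _) (hint2.const_mul _), integral_const_mul,
      integral_const_mul, hinner, Finset.mul_sum, tailZero, indicator_of_mem (by exact hx1),
      mul_comm]
    congr 1
    refine Finset.sum_congr rfl fun i _ => ?_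
    rw [tailLin, indicator_of_mem (by exact hx1)]
    ring
  have hi : IntegrableOn (fun y => ‖x‖ ^ (-p) * g y ^ 2 +
      p * ‖x‖ ^ (-p - 2) * (inner ℝ x y * g y ^ 2)) D :=
    (hint.const_mul _).add (hint2.const_mul _)
  rw [e1, smear, ← integral_sub ((isSubRiesz_riesz p).integrableOn hρ hg x) hi, tailQuad,
    indicator_of_mem (by exact hx1)]
  have h2 : ∀ᵐ y ∂(volume.restrict D), ‖riesz p (y - x) * g y ^ 2 -
      (‖x‖ ^ (-p) * g y ^ 2 + p * ‖x‖ ^ (-p - 2) * (inner ℝ x y * g y ^ 2))‖ ≤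
      26 * R ^ 2 * ‖x‖ ^ (-p - 2) * g y ^ 2 := by
    filter_upwards [ae_restrict_mem hDm] with y hy
    have h3 := abs_riesz_sub_expansion_le hp0 hp2 hR (hDn y hy) hx hx0
    have h4 : riesz p (y - x) * g y ^ 2 -
      (‖x‖ ^ (-p) * g y ^ 2 + p * ‖x‖ ^ (-p - 2) * (inner ℝ x y * g y ^ 2)) =
      (riesz p (y - x) - ‖x‖ ^ (-p) - p * inner ℝ x y * ‖x‖ ^ (-p - 2)) * g y ^ 2 := by ring
    rw [h4, norm_mul, Real.norm_of_nonneg (sq_nonneg (g y)), Real.norm_eq_abs]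
    gcongr
  refine (norm_integral_le_of_norm_le (hint.const_mul _) h2).trans ?_
  rw [integral_const_mul]
  exact mul_le_of_le_one_right (by positivity) (integral_sq_le_one_of_mem_sobolevSphere hg)

theorem abs_integral_coord_le {R : ℝ} (hR : 0 ≤ R)
    (hDm : MeasurableSet D) (hD : D ⊆ Metric.closedBall 0 R)
    {g : Rd d → ℝ} (hg : g ∈ sobolevSphere D) (i : Fin d) : |∫ y in D, y i * g y ^ 2| ≤ R := by
  have hint := integrableOn_sq_of_mem_sobolevSphere hg
  have h2 : ∀ᵐ y ∂(volume.restrict D), ‖y i * g y ^ 2‖ ≤ R * g y ^ 2 := by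
    filter_upwards [ae_restrict_mem hDm] with y hy
    rw [norm_mul, Real.norm_of_nonneg (sq_nonneg (g y))]
    gcongr
    exact (PiLp.norm_apply_le y i).trans (by simpa using hD hy)
  refine (norm_integral_le_of_norm_le (hint.const_mul R) h2).trans ?_
  rw [integral_const_mul]
  exact mul_le_of_le_one_right hR (integral_sq_le_one_of_mem_sobolevSphere hg)

end Smear

/-! ### Simultaneous convergence of the Poisson integrals -/

section Regular

variable {d : ℕ} {D : Set (Rd d)} {p : ℝ}

/-- A realization of the field that is finite on balls and for which the compensated integrals of
the finitely many tail kernels converge. The Poisson integrals are then well defined for all `g`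
at once. -/
structure TailRegular (p ε : ℝ) (μ : Measure (Rd d)) : Prop where
  closedBall_lt_top : ∀ n : ℕ, μ (Metric.closedBall 0 (n : ℝ)) < ⊤
  exists_lim_zero : ∃ c, Tendsto (truncInt μ (ENNReal.ofReal ε • volume) (tailZero p)) atTop (𝓝 c)
  exists_lim_lin : ∀ i, ∃ c,
    Tendsto (truncInt μ (ENNReal.ofReal ε • volume) (tailLin p i)) atTop (𝓝 c)
  exists_lim_quad : ∃ c, Tendsto (truncInt μ (ENNReal.ofReal ε • volume) (tailQuad p)) atTop (𝓝 c)

theorem IsPoissonField.ae_tailRegular {Ω : Type*} [MeasurableSpace Ω] {P : Measure Ω}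
    {μ : Ω → Measure (Rd d)} {ε : ℝ} (hp0 : 0 ≤ p) (hp : (d : ℝ) / 2 < p) (hε : 0 ≤ ε)
    (h : IsPoissonField P μ (ENNReal.ofReal ε • volume)) :
    ∀ᵐ w ∂P, TailRegular p ε (μ w) := by
  filter_upwards [h.ae_closedBall_lt_top,
    (isTailKernel_tailZero (d := d) hp0).ae_tendsto_truncInt hp h hε,
    ae_all_iff.2 fun i => (isTailKernel_tailLin (d := d) hp0 i).ae_tendsto_truncInt hp h hε,
    (isTailKernel_tailQuad (d := d) hp0).ae_tendsto_truncInt hp h hε] with w h1 h2 h3 h4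
  exact ⟨h1, h2, h3, h4⟩

theorem tendsto_dist_prod_of_tendsto {S : ℕ → ℝ} {c : ℝ} (h : Tendsto S atTop (𝓝 c)) :
    Tendsto (fun n : ℕ × ℕ => |S n.1 - S n.2|) atTop (𝓝 0) :=
  cauchySeq_iff_tendsto_dist_atTop_0.1 h.cauchySeq

theorem closedBall_smul_lt_top (ε : ℝ) (n : ℕ) :
    (ENNReal.ofReal ε • volume : Measure (Rd d)) (Metric.closedBall 0 (n : ℝ)) < ⊤ :=
  (ofReal_smul_volume_ne_top ε measure_closedBall_lt_top.ne).lt_top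

theorem integrableOn_of_abs_le {m : Measure (Rd d)} {B : Set (Rd d)} (hB : m B < ⊤)
    {f : Rd d → ℝ} (hf : Measurable f) {c : ℝ} (hc : ∀ x, |f x| ≤ c) : IntegrableOn f B m := by
  have : IsFiniteMeasure (m.restrict B) := ⟨by simpa using hB⟩
  exact Integrable.of_bound hf.aestronglyMeasurable c (ae_of_all _ hc)

/-- A bounded function with the expansion of a smoothed Riesz kernel has a convergent compensated
integral, for every regular realization of the field. -/
theorem TailRegular.tendsto_truncInt {ε : ℝ} {μ : Measure (Rd d)} (h : TailRegular p ε μ)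
    (hp0 : 0 ≤ p) (hp : (d : ℝ) / 2 < p) (hd : (d : ℝ) < 4) (hε : 0 ≤ ε) {f : Rd d → ℝ}
    (hf : Measurable f) {c : ℝ} (hfc : ∀ x, |f x| ≤ c) {m₀ C : ℝ} (m : Fin d → ℝ) {j₀ : ℕ}
    (hC : 0 ≤ C) (hj₀ : 1 ≤ j₀)
    (hfe : ∀ x, (j₀ : ℝ) ≤ ‖x‖ →
      |f x - (m₀ * tailZero p x + ∑ i, p * m i * tailLin p i x)| ≤
        C * tailQuad p x) :
    ∃ c, Tendsto (truncInt μ (ENNReal.ofReal ε • volume) f) atTop (𝓝 c) := by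
  obtain ⟨c0, hc0⟩ := h.exists_lim_zero
  choose cl hcl using h.exists_lim_lin
  obtain ⟨cq, hcq⟩ := h.exists_lim_quad
  set S := truncInt μ (ENNReal.ofReal ε • volume) with hS
  set κ : ℝ := 2 - (d : ℝ) / 2 with hκ
  have hκ0 : 0 < κ := by rw [hκ]; linarith
  set b : ℕ × ℕ → ℝ := fun n =>
    |m₀| * |S (tailZero p) n.1 - S (tailZero p) n.2| +
      ∑ i, p * |m i| * |S (tailLin p i) n.1 - S (tailLin p i) n.2| +
      C * (|S (tailQuad p) n.1 - S (tailQuad p) n.2| +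
        2 * (ε * (((n.1 : ℝ) ^ (-κ) + (n.2 : ℝ) ^ (-κ)) * tailConst d p))) with hb
  have hpow : Tendsto (fun n : ℕ => (n : ℝ) ^ (-κ)) atTop (𝓝 0) :=
    (tendsto_rpow_neg_atTop hκ0).comp tendsto_natCast_atTop_atTop
  have hlim : Tendsto b atTop (𝓝 0) := by
    have h1 := (tendsto_dist_prod_of_tendsto hc0).const_mul |m₀|
    have h2 := tendsto_finsetSum (Finset.univ : Finset (Fin d)) fun i _ =>
      (tendsto_dist_prod_of_tendsto (hcl i)).const_mul (p * |m i|)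
    have h3 := tendsto_dist_prod_of_tendsto hcq
    have h4 : Tendsto (fun n : ℕ × ℕ => (n.1 : ℝ) ^ (-κ) + (n.2 : ℝ) ^ (-κ)) atTop (𝓝 (0 + 0)) := by
      rw [← prod_atTop_atTop_eq]
      exact (hpow.comp tendsto_fst).add (hpow.comp tendsto_snd)
    have h5 := (h3.add (((h4.mul_const (tailConst d p)).const_mul ε).const_mul 2)).const_mul C
    have h6 := (h1.add h2).add h5
    simpa using h6
  refine cauchySeq_tendsto_of_complete (cauchySeq_iff_tendsto_dist_atTop_0.2 ?_)
  have hone : ∀ n j : ℕ, j₀ ≤ j → j ≤ n → |S f n - S f j| ≤ b (n, j) := by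
    intro n j hj hjn
    refine (abs_truncInt_sub_le hp hp0 hd.le hε h.closedBall_lt_top hf hfc m hC (hj₀.trans hj) hjn
      fun x hx => hfe x (le_trans (by exact_mod_cast hj) hx)).trans ?_
    simp only [hb]
    have := tailConst_nonneg d p
    gcongr
    have : (0 : ℝ) ≤ (n : ℝ) ^ (-κ) := by positivity
    linarith
  have hsymm : ∀ n j, b (n, j) = b (j, n) := by
    intro n j
    simp only [hb, abs_sub_comm (S _ n), add_comm ((n : ℝ) ^ (-κ))]
  refine squeeze_zero' (Eventually.of_forall fun n => dist_nonneg) ?_ hlim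
  rw [← prod_atTop_atTop_eq]
  filter_upwards [(eventually_ge_atTop j₀).prod_mk (eventually_ge_atTop j₀)] with n hn
  rw [Real.dist_eq]
  rcases le_total n.2 n.1 with hle | hle
  · exact hone _ _ hn.2 hle
  · rw [abs_sub_comm, show b n = b (n.2, n.1) from hsymm n.1 n.2]
    exact hone _ _ hn.1 hle

theorem smear_kerK_eq_zero {α : ℝ → ℝ} (hα : IsCutoff α) {a ε : ℝ} (ha : 0 < a)
    (hε : ε ∈ Ioo (0 : ℝ) 1) {R : ℝ} (hDm : MeasurableSet D) (hD : D ⊆ Metric.closedBall 0 R)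
    (g : Rd d → ℝ) {x : Rd d} (hx : R + 3 * cutoffRadius p a ε ≤ ‖x‖) :
    smear D (kerK p α a ε) g x = 0 := by
  rw [smear_congr (K' := 0) hDm g fun y hy => ?_]
  · simp [smear]
  · refine kerK_eq_zero hα ha hε ?_
    have h1 : ‖y‖ ≤ R := by simpa using hD hy
    have := norm_sub_norm_le x y
    rw [norm_sub_rev] at this
    linarith

theorem truncInt_eq_of_eq_zero {μ ν : Measure (Rd d)} {f : Rd d → ℝ} {j n : ℕ} (hjn : j ≤ n)
    (hμ : IntegrableOn f (Metric.closedBall 0 (n : ℝ)) μ)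
    (hν : IntegrableOn f (Metric.closedBall 0 (n : ℝ)) ν)
    (hf : ∀ x, (j : ℝ) ≤ ‖x‖ → f x = 0) : truncInt μ ν f n = truncInt μ ν f j := by
  have h1 : ∀ x ∈ Metric.closedBall (0 : Rd d) (n : ℝ) \ Metric.closedBall 0 (j : ℝ),
      f x = 0 := by
    rintro x ⟨-, hx⟩
    rw [mem_closedBall_zero_iff, not_le] at hx
    exact hf x hx.le
  have h2 := truncInt_sub hjn hμ hν
  rw [setIntegral_eq_zero_of_forall_eq_zero h1, setIntegral_eq_zero_of_forall_eq_zero h1] at h2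
  linarith

theorem CompIntegrable.tendsto {μ ν : Measure (Rd d)} {f : Rd d → ℝ}
    (h : CompIntegrable μ ν f) : Tendsto (truncInt μ ν f) atTop (𝓝 (compInt μ ν f)) :=
  tendsto_nhds_limUnder h.2

end Regular

section PoissonIntegrals

variable {d : ℕ} {D : Set (Rd d)} {p : ℝ} {α : ℝ → ℝ} {a ε R : ℝ} {m : Measure (Rd d)}
  {g : Rd d → ℝ}

theorem IsSubRiesz.integrableOn_smear {K : Rd d → ℝ} (hK : IsSubRiesz p K)
    (hρ : rhoStar p D < ⊤) (hg : g ∈ sobolevSphere D) {μ : Measure (Rd d)} {B : Set (Rd d)}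
    (hB : μ B < ⊤) : IntegrableOn (smear D K g) B μ :=
  integrableOn_of_abs_le hB (hK.measurable_smear hg) (hK.abs_smear_le hρ hg)

/-- The compensated integrals of the smoothed kernels that agree with the smoothed Riesz kernel far
away converge along a regular realization. -/
theorem TailRegular.poissonIntegrable_of_tendsto {K : Rd d → ℝ} (hK : IsSubRiesz p K)
    (hρ : rhoStar p D < ⊤) (hg : g ∈ sobolevSphere D)
    (h : TailRegular p ε (contract ε m))
    (hlim : ∃ c, Tendsto (truncInt (contract ε m) (ENNReal.ofReal ε • volume) (smear D K g))
      atTop (𝓝 c)) : PoissonIntegrable D K ε m g :=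
  ⟨fun x => hK.integrableOn hρ hg x, fun n =>
    ⟨hK.integrableOn_smear hρ hg (h.closedBall_lt_top n),
      hK.integrableOn_smear hρ hg (closedBall_smul_lt_top ε n)⟩, hlim⟩

theorem TailRegular.poissonIntegrable_riesz (hp0 : 0 ≤ p) (hp2 : p ≤ 2) (hp : (d : ℝ) / 2 < p)
    (hd : (d : ℝ) < 4) (hR : 0 ≤ R) (hDm : MeasurableSet D) (hD : D ⊆ Metric.closedBall 0 R)
    (hρ : rhoStar p D < ⊤) (hg : g ∈ sobolevSphere D) (hε : 0 ≤ ε)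
    (h : TailRegular p ε (contract ε m)) : PoissonIntegrable D (riesz p) ε m g := by
  have hK := isSubRiesz_riesz (d := d) p
  obtain ⟨j, hj⟩ := exists_nat_ge (max 1 (2 * R))
  have hj1 : (1 : ℝ) ≤ j := (le_max_left _ _).trans hj
  have hj2 : 2 * R ≤ j := (le_max_right _ _).trans hj
  refine h.poissonIntegrable_of_tendsto hK hρ hg ?_
  exact h.tendsto_truncInt hp0 hp hd hε (hK.measurable_smear hg) (hK.abs_smear_le hρ hg)
    (fun i => ∫ y in D, y i * g y ^ 2) (by positivity) (by exact_mod_cast hj1)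
    fun x hx => abs_smear_riesz_sub_expansion_le hp0 hp2 hR hDm hD hρ hg
      (hj1.trans hx) (hj2.trans hx)

theorem TailRegular.truncInt_kerK_eq (hα : IsCutoff α) (ha : 0 < a) (hε : ε ∈ Ioo (0 : ℝ) 1)
    (hDm : MeasurableSet D) (hD : D ⊆ Metric.closedBall 0 R)
    (hρ : rhoStar p D < ⊤) (hg : g ∈ sobolevSphere D)
    (h : TailRegular p ε (contract ε m)) {j n : ℕ} (hj : R + 3 * cutoffRadius p a ε ≤ j)
    (hjn : j ≤ n) :
    truncInt (contract ε m) (ENNReal.ofReal ε • volume) (smear D (kerK p α a ε) g) n =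
      truncInt (contract ε m) (ENNReal.ofReal ε • volume) (smear D (kerK p α a ε) g) j :=
  truncInt_eq_of_eq_zero hjn
    ((isSubRiesz_kerK hα ha hε).integrableOn_smear hρ hg (h.closedBall_lt_top n))
    ((isSubRiesz_kerK hα ha hε).integrableOn_smear hρ hg (closedBall_smul_lt_top ε n))
    fun _ hx => smear_kerK_eq_zero hα ha hε hDm hD g (hj.trans hx)

theorem TailRegular.tendsto_truncInt_kerK (hα : IsCutoff α) (ha : 0 < a) (hε : ε ∈ Ioo (0 : ℝ) 1)
    (hDm : MeasurableSet D) (hD : D ⊆ Metric.closedBall 0 R)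
    (hρ : rhoStar p D < ⊤) (hg : g ∈ sobolevSphere D)
    (h : TailRegular p ε (contract ε m)) {j : ℕ} (hj : R + 3 * cutoffRadius p a ε ≤ j) :
    Tendsto (truncInt (contract ε m) (ENNReal.ofReal ε • volume) (smear D (kerK p α a ε) g)) atTop
      (𝓝 (truncInt (contract ε m) (ENNReal.ofReal ε • volume) (smear D (kerK p α a ε) g) j)) := by
  refine tendsto_const_nhds.congr' ?_
  filter_upwards [eventually_ge_atTop j] with n hn
  exact (h.truncInt_kerK_eq hα ha hε hDm hD hρ hg hj hn).symm

theorem TailRegular.poissonIntegrable_kerK (hα : IsCutoff α) (ha : 0 < a)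
    (hε : ε ∈ Ioo (0 : ℝ) 1) (hDm : MeasurableSet D) (hD : D ⊆ Metric.closedBall 0 R)
    (hρ : rhoStar p D < ⊤) (hg : g ∈ sobolevSphere D)
    (h : TailRegular p ε (contract ε m)) : PoissonIntegrable D (kerK p α a ε) ε m g := by
  obtain ⟨j, hj⟩ := exists_nat_ge (R + 3 * cutoffRadius p a ε)
  exact h.poissonIntegrable_of_tendsto (isSubRiesz_kerK hα ha hε) hρ hg
    ⟨_, h.tendsto_truncInt_kerK hα ha hε hDm hD hρ hg hj⟩

theorem TailRegular.truncInt_kerK_add_kerL (hα : IsCutoff α) (ha : 0 < a)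
    (hε : ε ∈ Ioo (0 : ℝ) 1) (hρ : rhoStar p D < ⊤) (hg : g ∈ sobolevSphere D)
    (h : TailRegular p ε (contract ε m)) (n : ℕ) :
    truncInt (contract ε m) (ENNReal.ofReal ε • volume) (smear D (kerK p α a ε) g) n +
      truncInt (contract ε m) (ENNReal.ofReal ε • volume) (smear D (kerL p α a ε) g) n =
      truncInt (contract ε m) (ENNReal.ofReal ε • volume) (smear D (riesz p) g) n := by
  have hK := isSubRiesz_kerK (d := d) (p := p) hα ha hε
  have hL := isSubRiesz_kerL (d := d) (p := p) hα ha hε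
  have h1 : smear D (riesz p) g = fun x =>
      smear D (kerK p α a ε) g x + smear D (kerL p α a ε) g x := by
    ext x
    exact (smear_add_smear hK hL (kerK_add_kerL p α a ε) hρ hg x).symm
  unfold truncInt
  rw [h1, integral_add (hK.integrableOn_smear hρ hg (h.closedBall_lt_top n))
    (hL.integrableOn_smear hρ hg (h.closedBall_lt_top n)),
    integral_add (hK.integrableOn_smear hρ hg (closedBall_smul_lt_top ε n))
    (hL.integrableOn_smear hρ hg (closedBall_smul_lt_top ε n))]
  ring

theorem TailRegular.poissonIntegrable_kerL (hα : IsCutoff α) (ha : 0 < a)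
    (hε : ε ∈ Ioo (0 : ℝ) 1) (hp0 : 0 ≤ p) (hp2 : p ≤ 2) (hp : (d : ℝ) / 2 < p)
    (hd : (d : ℝ) < 4) (hR : 0 ≤ R) (hDm : MeasurableSet D) (hD : D ⊆ Metric.closedBall 0 R)
    (hρ : rhoStar p D < ⊤) (hg : g ∈ sobolevSphere D)
    (h : TailRegular p ε (contract ε m)) : PoissonIntegrable D (kerL p α a ε) ε m g := by
  obtain ⟨c1, hc1⟩ := (h.poissonIntegrable_riesz hp0 hp2 hp hd hR hDm hD hρ hg hε.1.le).2.2
  obtain ⟨c2, hc2⟩ := (h.poissonIntegrable_kerK hα ha hε hDm hD hρ hg).2.2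
  refine h.poissonIntegrable_of_tendsto (isSubRiesz_kerL hα ha hε) hρ hg ⟨c1 - c2, ?_⟩
  refine (hc1.sub hc2).congr fun n => ?_
  rw [← h.truncInt_kerK_add_kerL hα ha hε hρ hg n]
  ring

theorem TailRegular.zeta_eq (hα : IsCutoff α) (ha : 0 < a)
    (hε : ε ∈ Ioo (0 : ℝ) 1) (hp0 : 0 ≤ p) (hp2 : p ≤ 2) (hp : (d : ℝ) / 2 < p)
    (hd : (d : ℝ) < 4) (hR : 0 ≤ R) (hDm : MeasurableSet D) (hD : D ⊆ Metric.closedBall 0 R)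
    (hρ : rhoStar p D < ⊤) (hg : g ∈ sobolevSphere D)
    (h : TailRegular p ε (contract ε m)) :
    zeta p D ε m g = Gone p α D a ε m g + Fone p α D a ε m g := by
  have h1 := (h.poissonIntegrable_riesz hp0 hp2 hp hd hR hDm hD hρ hg hε.1.le).2.tendsto
  have h2 := (h.poissonIntegrable_kerK hα ha hε hDm hD hρ hg).2.tendsto
  have h3 := (h.poissonIntegrable_kerL hα ha hε hp0 hp2 hp hd hR hDm hD hρ hg).2.tendsto
  exact tendsto_nhds_unique h1
    ((h2.add h3).congr fun n => h.truncInt_kerK_add_kerL hα ha hε hρ hg n)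

theorem TailRegular.Gone_eq (hα : IsCutoff α) (ha : 0 < a) (hε : ε ∈ Ioo (0 : ℝ) 1)
    (hDm : MeasurableSet D) (hD : D ⊆ Metric.closedBall 0 R)
    (hρ : rhoStar p D < ⊤) (hg : g ∈ sobolevSphere D)
    (h : TailRegular p ε (contract ε m)) {j : ℕ} (hj : R + 3 * cutoffRadius p a ε ≤ j) :
    Gone p α D a ε m g =
      truncInt (contract ε m) (ENNReal.ofReal ε • volume) (smear D (kerK p α a ε) g) j :=
  tendsto_nhds_unique (h.poissonIntegrable_kerK hα ha hε hDm hD hρ hg).2.tendsto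
    (h.tendsto_truncInt_kerK hα ha hε hDm hD hρ hg hj)

/-- Each point of the field contributes at most `ρ*_D` to `Gone`. -/
theorem TailRegular.Gone_le (hα : IsCutoff α) (ha : 0 < a) (hε : ε ∈ Ioo (0 : ℝ) 1)
    (hDm : MeasurableSet D) (hD : D ⊆ Metric.closedBall 0 R)
    (hρ : rhoStar p D < ⊤) (hg : g ∈ sobolevSphere D)
    (h : TailRegular p ε (contract ε m)) {j : ℕ} (hj : R + 3 * cutoffRadius p a ε ≤ j) :
    Gone p α D a ε m g ≤
      (rhoStar p D).toReal * (contract ε m).real (Metric.closedBall 0 (j : ℝ)) := by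
  have hK := isSubRiesz_kerK (d := d) (p := p) hα ha hε
  rw [h.Gone_eq hα ha hε hDm hD hρ hg hj, truncInt]
  have h1 : 0 ≤ ∫ x in Metric.closedBall 0 (j : ℝ), smear D (kerK p α a ε) g x
      ∂(ENNReal.ofReal ε • volume) := integral_nonneg fun x => hK.smear_nonneg D g x
  have h2 : ∫ x in Metric.closedBall 0 (j : ℝ), smear D (kerK p α a ε) g x ∂(contract ε m) ≤
      ∫ x in Metric.closedBall 0 (j : ℝ), (rhoStar p D).toReal ∂(contract ε m) :=
    integral_mono (hK.integrableOn_smear hρ hg (h.closedBall_lt_top j))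
      (integrableOn_of_abs_le (h.closedBall_lt_top j) measurable_const fun _ => le_rfl)
      fun x => hK.smear_le hρ hg x
  rw [setIntegral_const, smul_eq_mul, mul_comm] at h2
  linarith

/-- The points in `B` contribute at least `b` each, and the compensator is bounded by `ρ*_D`. -/
theorem TailRegular.le_Gone (hα : IsCutoff α) (ha : 0 < a) (hε : ε ∈ Ioo (0 : ℝ) 1)
    (hDm : MeasurableSet D) (hD : D ⊆ Metric.closedBall 0 R)
    (hρ : rhoStar p D < ⊤) (hg : g ∈ sobolevSphere D)
    (h : TailRegular p ε (contract ε m)) {j : ℕ} (hj : R + 3 * cutoffRadius p a ε ≤ j)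
    {B : Set (Rd d)} (hB : MeasurableSet B) (hBj : B ⊆ Metric.closedBall 0 (j : ℝ)) {b : ℝ}
    (hb : ∀ x ∈ B, b ≤ smear D (kerK p α a ε) g x) :
    b * (contract ε m).real B - ε * ((rhoStar p D).toReal *
      volume.real (Metric.closedBall (0 : Rd d) (j : ℝ))) ≤ Gone p α D a ε m g := by
  have hK := isSubRiesz_kerK (d := d) (p := p) hα ha hε
  have hBfin : (contract ε m) B < ⊤ := (measure_mono hBj).trans_lt (h.closedBall_lt_top j)
  rw [h.Gone_eq hα ha hε hDm hD hρ hg hj, truncInt, integral_smul_ofReal hε.1.le]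
  have h1 : ∫ x in Metric.closedBall 0 (j : ℝ), smear D (kerK p α a ε) g x ≤
      ∫ x in Metric.closedBall (0 : Rd d) (j : ℝ), (rhoStar p D).toReal :=
    integral_mono (hK.integrableOn_smear hρ hg measure_closedBall_lt_top)
      (integrableOn_of_abs_le measure_closedBall_lt_top measurable_const fun _ => le_rfl)
      fun x => hK.smear_le hρ hg x
  rw [setIntegral_const, smul_eq_mul, mul_comm] at h1
  have h2 : ∫ x in B, b ∂(contract ε m) ≤
      ∫ x in B, smear D (kerK p α a ε) g x ∂(contract ε m) :=
    setIntegral_mono_on (integrableOn_of_abs_le hBfin measurable_const fun _ => le_rfl)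
      (hK.integrableOn_smear hρ hg hBfin) hB hb
  have h3 : ∫ x in B, smear D (kerK p α a ε) g x ∂(contract ε m) ≤
      ∫ x in Metric.closedBall 0 (j : ℝ), smear D (kerK p α a ε) g x ∂(contract ε m) :=
    setIntegral_mono_set (hK.integrableOn_smear hρ hg (h.closedBall_lt_top j))
      (ae_of_all _ fun x => hK.smear_nonneg D g x) (LE.le.eventuallyLE hBj)
  rw [setIntegral_const, smul_eq_mul, mul_comm] at h2
  have h4 := mul_le_mul_of_nonneg_left h1 hε.1.le
  linarith

/-- A bound for `Fone` that is uniform in `g`: inside a large ball the kernel is small, and outside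
the expansion of the Riesz kernel applies. -/
theorem TailRegular.abs_Fone_le (hα : IsCutoff α) (ha : 0 < a)
    (hε : ε ∈ Ioo (0 : ℝ) 1) (hp0 : 0 < p) (hp2 : p ≤ 2) (hp : (d : ℝ) / 2 < p)
    (hd : (d : ℝ) < 4) (hR : 0 ≤ R) (hDm : MeasurableSet D) (hD : D ⊆ Metric.closedBall 0 R)
    (hρ : rhoStar p D < ⊤) (hg : g ∈ sobolevSphere D)
    (h : TailRegular p ε (contract ε m)) {j : ℕ} (hj1 : 1 ≤ j) (hj2 : 2 * R ≤ j)
    (hj : R + 3 * cutoffRadius p a ε ≤ j) {c0 cq : ℝ} {cl : Fin d → ℝ}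
    (hc0 : Tendsto (truncInt (contract ε m) (ENNReal.ofReal ε • volume) (tailZero p)) atTop (𝓝 c0))
    (hcl : ∀ i, Tendsto (truncInt (contract ε m) (ENNReal.ofReal ε • volume) (tailLin p i)) atTop
      (𝓝 (cl i)))
    (hcq : Tendsto (truncInt (contract ε m) (ENNReal.ofReal ε • volume) (tailQuad p)) atTop
      (𝓝 cq)) :
    |Fone p α D a ε m g| ≤
      a ^ (-p) / Real.log ε⁻¹ * ((contract ε m).real (Metric.closedBall 0 (j : ℝ)) +
        ε * volume.real (Metric.closedBall (0 : Rd d) (j : ℝ))) +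
      (|c0 - truncInt (contract ε m) (ENNReal.ofReal ε • volume) (tailZero p) j| +
      ∑ i, p * R * |cl i - truncInt (contract ε m) (ENNReal.ofReal ε • volume) (tailLin p i) j| +
      26 * R ^ 2 * (|cq - truncInt (contract ε m) (ENNReal.ofReal ε • volume) (tailQuad p) j| +
        2 * (ε * tailConst d p))) := by
  have hL := isSubRiesz_kerL (d := d) (p := p) hα ha hε
  have hlog : 0 < Real.log ε⁻¹ := Real.log_pos ((one_lt_inv₀ hε.1).2 hε.2)
  set S := truncInt (contract ε m) (ENNReal.ofReal ε • volume) with hS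
  have hlim : Tendsto (S (smear D (kerL p α a ε) g)) atTop (𝓝 (Fone p α D a ε m g)) :=
    (h.poissonIntegrable_kerL hα ha hε hp0.le hp2 hp hd hR hDm hD hρ hg).2.tendsto
  have hm0 : |∫ y in D, g y ^ 2| ≤ 1 := by
    rw [abs_of_nonneg (integral_nonneg fun y => sq_nonneg _)]
    exact integral_sq_le_one_of_mem_sobolevSphere hg
  have hfe : ∀ x : Rd d, (j : ℝ) ≤ ‖x‖ →
      |smear D (kerL p α a ε) g x - ((∫ y in D, g y ^ 2) * tailZero p x +
        ∑ i, p * (∫ y in D, y i * g y ^ 2) * tailLin p i x)| ≤ 26 * R ^ 2 * tailQuad p x := by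
    intro x hx
    have h1 : smear D (kerL p α a ε) g x = smear D (riesz p) g x := by
      have h2 := smear_add_smear (isSubRiesz_kerK hα ha hε) hL (kerK_add_kerL p α a ε) hρ hg x
      rw [smear_kerK_eq_zero hα ha hε hDm hD g (hj.trans hx), zero_add] at h2
      exact h2
    rw [h1]
    exact abs_smear_riesz_sub_expansion_le hp0.le hp2 hR hDm hD hρ hg
      (le_trans (by exact_mod_cast hj1) hx) (hj2.trans hx)
  have hinc : ∀ n, j ≤ n → |S (smear D (kerL p α a ε) g) n - S (smear D (kerL p α a ε) g) j| ≤
      |S (tailZero p) n - S (tailZero p) j| +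
      ∑ i, p * R * |S (tailLin p i) n - S (tailLin p i) j| +
      26 * R ^ 2 * (|S (tailQuad p) n - S (tailQuad p) j| + 2 * (ε * tailConst d p)) := by
    intro n hn
    refine (abs_truncInt_sub_le hp hp0.le hd.le hε.1.le h.closedBall_lt_top
      (hL.measurable_smear hg) (hL.abs_smear_le hρ hg) (fun i => ∫ y in D, y i * g y ^ 2)
      (by positivity) hj1 hn hfe).trans ?_
    have hj1' : (1 : ℝ) ≤ j := by exact_mod_cast hj1
    have h1 : (j : ℝ) ^ (-(2 - (d : ℝ) / 2)) ≤ 1 :=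
      Real.rpow_le_one_of_one_le_of_nonpos hj1' (by linarith)
    have h2 := tailConst_nonneg d p
    have h3 := hε.1.le
    refine add_le_add_three (mul_le_of_le_one_left (abs_nonneg _) hm0)
      (Finset.sum_le_sum fun i _ => ?_) ?_
    · have := abs_integral_coord_le hR hDm hD hg i
      gcongr
    · gcongr
      exact mul_le_of_le_one_left h2 h1
  have hfar := le_of_tendsto_of_tendsto
    ((hlim.sub_const (S (smear D (kerL p α a ε) g) j)).abs)
    ((((hc0.sub_const (S (tailZero p) j)).abs).add
      (tendsto_finsetSum (Finset.univ : Finset (Fin d)) fun i _ =>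
        ((hcl i).sub_const (S (tailLin p i) j)).abs.const_mul (p * R))).add
      ((((hcq.sub_const (S (tailQuad p) j)).abs).add_const
        (2 * (ε * tailConst d p))).const_mul (26 * R ^ 2)))
    (by filter_upwards [eventually_ge_atTop j] with n hn using hinc n hn)
  have hsmall : ∀ x, smear D (kerL p α a ε) g x ≤ a ^ (-p) / Real.log ε⁻¹ := fun x =>
    hL.smear_le_of_le hρ (by positivity) (kerL_le hα ha hε hp0) hg x
  have hball : ∀ ν : Measure (Rd d), ν (Metric.closedBall 0 (j : ℝ)) < ⊤ →
      |∫ x in Metric.closedBall 0 (j : ℝ), smear D (kerL p α a ε) g x ∂ν| ≤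
        a ^ (-p) / Real.log ε⁻¹ * ν.real (Metric.closedBall 0 (j : ℝ)) := by
    intro ν hν
    exact norm_setIntegral_le_of_norm_le_const hν
      fun x _ => by
        rw [Real.norm_of_nonneg (hL.smear_nonneg D g x)]; exact hsmall x
  have hnear : |S (smear D (kerL p α a ε) g) j| ≤
      a ^ (-p) / Real.log ε⁻¹ * ((contract ε m).real (Metric.closedBall 0 (j : ℝ)) +
        ε * volume.real (Metric.closedBall (0 : Rd d) (j : ℝ))) := by
    rw [hS, truncInt, integral_smul_ofReal hε.1.le]
    refine (abs_sub _ _).trans ?_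
    rw [abs_mul, abs_of_pos hε.1]
    have h1 := hball _ (h.closedBall_lt_top j)
    have h2 := mul_le_mul_of_nonneg_left (hball volume measure_closedBall_lt_top) hε.1.le
    linarith
  have habs := abs_add_le (S (smear D (kerL p α a ε) g) j)
    (Fone p α D a ε m g - S (smear D (kerL p α a ε) g) j)
  rw [add_sub_cancel] at habs
  linarith

end PoissonIntegrals

/-! ### Asymptotics as `ε → 0` -/

section Asymptotics

/-- The scale `ε^{-(2-p)/d}` of the deviations. -/
def devScale (d : ℕ) (p ε : ℝ) : ℝ := ε ^ (-((2 - p) / (d : ℝ)))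

/-- The speed `l(ε) = ε^{-(2-p)/d} log(1/ε)` of the large deviations. -/
def speed (d : ℕ) (p ε : ℝ) : ℝ := devScale d p ε * Real.log ε⁻¹

theorem eventually_mem_Ioo_zero_one : ∀ᶠ ε in 𝓝[>] (0 : ℝ), ε ∈ Ioo (0 : ℝ) 1 :=
  Ioo_mem_nhdsGT one_pos

theorem tendsto_log_inv : Tendsto (fun ε : ℝ => Real.log ε⁻¹) (𝓝[>] 0) atTop :=
  Real.tendsto_log_atTop.comp tendsto_inv_nhdsGT_zero

theorem rpow_neg_eq_exp_log_inv {ε : ℝ} (hε : 0 < ε) (s : ℝ) :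
    ε ^ (-s) = Real.exp (s * Real.log ε⁻¹) := by
  rw [Real.rpow_def_of_pos hε, Real.log_inv]; ring_nf

theorem eventually_mul_log_rpow_le (C r : ℝ) {s : ℝ} (hs : 0 < s) :
    ∀ᶠ ε in 𝓝[>] (0 : ℝ), C * Real.log ε⁻¹ ^ r ≤ ε ^ (-s) := by
  have h1 := (isLittleO_rpow_exp_pos_mul_atTop r hs).const_mul_left C
  have h2 := tendsto_log_inv.eventually (h1.bound one_pos)
  filter_upwards [h2, eventually_mem_Ioo_zero_one] with ε h3 hε
  rw [rpow_neg_eq_exp_log_inv hε.1]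
  have h4 := (Real.le_norm_self _).trans h3
  rwa [one_mul, Real.norm_of_nonneg (Real.exp_pos _).le] at h4

theorem eventually_le_rpow_neg (C : ℝ) {s : ℝ} (hs : 0 < s) :
    ∀ᶠ ε in 𝓝[>] (0 : ℝ), C ≤ ε ^ (-s) := by
  simpa using eventually_mul_log_rpow_le C 0 hs

variable {d : ℕ} {p : ℝ}

theorem devScale_pos {ε : ℝ} (hε : 0 < ε) : 0 < devScale d p ε := Real.rpow_pos_of_pos hε _

theorem eventually_le_devScale (hd : 0 < d) (hp : p < 2) (C : ℝ) :
    ∀ᶠ ε in 𝓝[>] (0 : ℝ), C ≤ devScale d p ε :=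
  eventually_le_rpow_neg C (div_pos (by linarith) (by exact_mod_cast hd))

theorem eventually_le_speed (hd : 0 < d) (hp : p < 2) (C : ℝ) :
    ∀ᶠ ε in 𝓝[>] (0 : ℝ), C ≤ speed d p ε := by
  filter_upwards [eventually_le_devScale hd hp 1, tendsto_log_inv.eventually_ge_atTop (max C 0)]
    with ε h1 h2
  have h3 := le_max_left C 0
  have h4 := le_max_right C 0
  unfold speed
  nlinarith

theorem speed_pos {ε : ℝ} (hε : ε ∈ Ioo (0 : ℝ) 1) : 0 < speed d p ε :=
  mul_pos (devScale_pos hε.1) (Real.log_pos ((one_lt_inv₀ hε.1).2 hε.2))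

theorem scaledLog_eq {Ω : Type*} [MeasurableSpace Ω] (P : Measure Ω) (ε : ℝ) (A : Set Ω) :
    scaledLog P d p ε A = (((speed d p ε)⁻¹ : ℝ) : EReal) * ENNReal.log (P A) := by
  rw [scaledLog, speed, devScale, one_div, one_div]

theorem scaledLog_le {Ω : Type*} [MeasurableSpace Ω] {P : Measure Ω} {ε : ℝ}
    (hε : ε ∈ Ioo (0 : ℝ) 1) {A : Set Ω} {B : ℝ}
    (h : P A ≤ ENNReal.ofReal (Real.exp (B * speed d p ε))) : scaledLog P d p ε A ≤ B := by
  have hs := speed_pos (d := d) (p := p) hε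
  rw [scaledLog_eq]
  calc (((speed d p ε)⁻¹ : ℝ) : EReal) * ENNReal.log (P A)
      ≤ (((speed d p ε)⁻¹ : ℝ) : EReal) * ((B * speed d p ε : ℝ) : EReal) := by
        refine mul_le_mul_of_nonneg_left ?_ (by exact_mod_cast (inv_pos.2 hs).le)
        refine (ENNReal.log_le_log h).trans (le_of_eq ?_)
        rw [ENNReal.log_ofReal_of_pos (Real.exp_pos _), Real.log_exp]
    _ = (B : EReal) := by
        rw [← EReal.coe_mul]; congr 1; field_simp

theorem le_scaledLog {Ω : Type*} [MeasurableSpace Ω] {P : Measure Ω} {ε : ℝ}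
    (hε : ε ∈ Ioo (0 : ℝ) 1) {A : Set Ω} {B : ℝ}
    (h : ENNReal.ofReal (Real.exp (B * speed d p ε)) ≤ P A) : B ≤ scaledLog P d p ε A := by
  have hs := speed_pos (d := d) (p := p) hε
  rw [scaledLog_eq]
  calc (B : EReal) = (((speed d p ε)⁻¹ : ℝ) : EReal) * ((B * speed d p ε : ℝ) : EReal) := by
        rw [← EReal.coe_mul]; congr 1; field_simp
    _ ≤ (((speed d p ε)⁻¹ : ℝ) : EReal) * ENNReal.log (P A) := by
        refine mul_le_mul_of_nonneg_left ?_ (by exact_mod_cast (inv_pos.2 hs).le)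
        refine le_trans (le_of_eq ?_) (ENNReal.log_le_log h)
        rw [ENNReal.log_ofReal_of_pos (Real.exp_pos _), Real.log_exp]

theorem tendsto_scaledLog_bot {Ω : Type*} [MeasurableSpace Ω] {P : Measure Ω} {A : ℝ → Set Ω}
    (h : ∀ B : ℝ, ∀ᶠ ε in 𝓝[>] (0 : ℝ), P (A ε) ≤ ENNReal.ofReal (Real.exp (-B * speed d p ε))) :
    Tendsto (fun ε => scaledLog P d p ε (A ε)) (𝓝[>] 0) (𝓝 ⊥) := by
  rw [EReal.tendsto_nhds_bot_iff_real]
  intro x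
  filter_upwards [h (-(x - 1)), eventually_mem_Ioo_zero_one] with ε h1 hε
  rw [neg_neg] at h1
  refine (scaledLog_le hε h1).trans_lt ?_
  exact_mod_cast sub_one_lt x

theorem tendsto_scaledLog {Ω : Type*} [MeasurableSpace Ω] {P : Measure Ω} {A : ℝ → Set Ω} {I : ℝ}
    (hup : ∀ B < I, ∀ᶠ ε in 𝓝[>] (0 : ℝ),
      P (A ε) ≤ ENNReal.ofReal (Real.exp (-B * speed d p ε)))
    (hlow : ∀ B > I, ∀ᶠ ε in 𝓝[>] (0 : ℝ),
      ENNReal.ofReal (Real.exp (-B * speed d p ε)) ≤ P (A ε)) :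
    Tendsto (fun ε => scaledLog P d p ε (A ε)) (𝓝[>] 0) (𝓝 ((-I : ℝ) : EReal)) := by
  rw [tendsto_order]
  constructor
  · intro y hy
    obtain ⟨z, hz1, hz2⟩ := EReal.lt_iff_exists_real_btwn.1 hy
    have hz3 : z < -I := by exact_mod_cast hz2
    filter_upwards [hlow (-z) (by linarith), eventually_mem_Ioo_zero_one] with ε h1 hε
    rw [neg_neg] at h1
    exact hz1.trans_le (le_scaledLog hε h1)
  · intro y hy
    obtain ⟨z, hz1, hz2⟩ := EReal.lt_iff_exists_real_btwn.1 hy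
    have hz3 : -I < z := by exact_mod_cast hz1
    filter_upwards [hup (-z) (by linarith), eventually_mem_Ioo_zero_one] with ε h1 hε
    rw [neg_neg] at h1
    exact (scaledLog_le hε h1).trans_lt hz2

/-- A constant factor is negligible on the exponential scale. -/
theorem eventually_mul_exp_neg_speed_le (hd : 0 < d) (hp : p < 2) (C : ℝ) {B B' : ℝ}
    (hB : B < B') : ∀ᶠ ε in 𝓝[>] (0 : ℝ),
      C * Real.exp (-B' * speed d p ε) ≤ Real.exp (-B * speed d p ε) := by
  filter_upwards [eventually_le_speed hd hp (|C| / (B' - B))] with ε h1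
  rw [div_le_iff₀ (by linarith)] at h1
  have h2 : Real.exp (-B * speed d p ε) =
      Real.exp ((B' - B) * speed d p ε) * Real.exp (-B' * speed d p ε) := by
    rw [← Real.exp_add]; ring_nf
  rw [h2]
  gcongr
  have := Real.add_one_le_exp ((B' - B) * speed d p ε)
  have := le_abs_self C
  linarith

/-- A finite sum of exponentially small terms is exponentially small at every smaller rate. -/
theorem eventually_sum_le_exp_neg_speed (hd : 0 < d) (hp : p < 2) {ι : Type*} [Fintype ι]
    {q : ι → ℝ → ENNReal} {B B' : ℝ} (hB : B < B')
    (h : ∀ i, ∀ᶠ ε in 𝓝[>] (0 : ℝ), q i ε ≤ ENNReal.ofReal (Real.exp (-B' * speed d p ε))) :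
    ∀ᶠ ε in 𝓝[>] (0 : ℝ), ∑ i, q i ε ≤ ENNReal.ofReal (Real.exp (-B * speed d p ε)) := by
  filter_upwards [eventually_all.2 h,
    eventually_mul_exp_neg_speed_le hd hp (Fintype.card ι : ℝ) hB] with ε h1 h2
  calc ∑ i, q i ε ≤ ∑ _i : ι, ENNReal.ofReal (Real.exp (-B' * speed d p ε)) :=
        Finset.sum_le_sum fun i _ => h1 i
    _ = ENNReal.ofReal (Fintype.card ι * Real.exp (-B' * speed d p ε)) := by
        rw [Finset.sum_const, Finset.card_univ, nsmul_eq_mul,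
          ENNReal.ofReal_mul (by positivity), ENNReal.ofReal_natCast]
    _ ≤ _ := ENNReal.ofReal_le_ofReal h2

theorem volume_real_closedBall (j : ℕ) :
    volume.real (Metric.closedBall (0 : Rd d) (j : ℝ)) =
      (j : ℝ) ^ d * volume.real (Metric.ball (0 : Rd d) 1) := by
  rw [Measure.addHaar_real_closedBall _ _ (by positivity), finrank_euclideanSpace_fin]

/-- The counting radius: a ball containing the supports of all smoothed truncated kernels. -/
def countRadius (p a R ε : ℝ) : ℕ := ⌈R + 3 * cutoffRadius p a ε⌉₊

theorem le_countRadius (p a R ε : ℝ) : R + 3 * cutoffRadius p a ε ≤ countRadius p a R ε :=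
  Nat.le_ceil _

/-- Balls of the counting radius have a volume that grows slower than any power of `1/ε`. -/
theorem eventually_volume_countRadius_le {a R : ℝ} (ha : 0 < a) (hR : 0 ≤ R)
    (hp : 0 < p) (C : ℝ) {s : ℝ} (hs : 0 < s) :
    ∀ᶠ ε in 𝓝[>] (0 : ℝ),
      C * volume.real (Metric.closedBall (0 : Rd d) (countRadius p a R ε : ℝ)) ≤ ε ^ (-s) := by
  set v := volume.real (Metric.ball (0 : Rd d) 1) with hv
  have hv0 : 0 ≤ v := measureReal_nonneg
  filter_upwards [eventually_mul_log_rpow_le (|C| * ((R + 3 * a + 1) ^ d * v)) (1 / p * d) hs,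
    eventually_mem_Ioo_zero_one, tendsto_log_inv.eventually_ge_atTop 1] with ε h1 hε h2
  refine le_trans ?_ h1
  rw [volume_real_closedBall, ← hv]
  have h3 : 1 ≤ Real.log ε⁻¹ ^ (1 / p) := Real.one_le_rpow h2 (by positivity)
  have h4 : 0 < cutoffRadius p a ε := cutoffRadius_pos ha hε p
  have h5 : (countRadius p a R ε : ℝ) ≤ (R + 3 * a + 1) * Real.log ε⁻¹ ^ (1 / p) := by
    refine (Nat.ceil_lt_add_one (by positivity)).le.trans ?_
    rw [cutoffRadius]
    nlinarith
  calc C * ((countRadius p a R ε : ℝ) ^ d * v)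
      ≤ |C| * (((R + 3 * a + 1) * Real.log ε⁻¹ ^ (1 / p)) ^ d * v) := by
        gcongr; exact le_abs_self C
    _ = _ := by
        rw [mul_pow, ← Real.rpow_natCast (Real.log ε⁻¹ ^ (1 / p)) d, ← Real.rpow_mul (by linarith)]
        ring

end Asymptotics

/-! ### The far part of the field is negligible -/

section FarPart

variable {d : ℕ} {p : ℝ}

/-- The radius `ε^{-(1 + (2-p)/d)/d}`, at which the mean number of points of the contracted field
in the ball is of the order of `devScale`. -/
def outerRadius (d : ℕ) (p ε : ℝ) : ℕ := ⌈ε ^ (-((1 + (2 - p) / d) / d))⌉₊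

theorem outerExponent_pos (hd : 0 < d) (hp2 : p < 2) : 0 < (1 + (2 - p) / d) / (d : ℝ) := by
  have h1 : (0 : ℝ) < d := by exact_mod_cast hd
  have h2 : 0 < (2 - p) / d := div_pos (by linarith) h1
  positivity

theorem rpow_le_outerRadius (d : ℕ) (p ε : ℝ) :
    ε ^ (-((1 + (2 - p) / d) / d)) ≤ outerRadius d p ε := Nat.le_ceil _

theorem one_le_outerRadius {ε : ℝ} (hε : 0 < ε) : 1 ≤ outerRadius d p ε :=
  Nat.one_le_ceil_iff.2 (Real.rpow_pos_of_pos hε _)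

theorem eventually_le_outerRadius (hd : 0 < d) (hp2 : p < 2) (C : ℝ) :
    ∀ᶠ ε in 𝓝[>] (0 : ℝ), C ≤ outerRadius d p ε := by
  filter_upwards [eventually_le_rpow_neg C (outerExponent_pos hd hp2)] with ε h
  exact h.trans (rpow_le_outerRadius d p ε)

theorem eventually_cutoffRadius_le_outerRadius (hd : 0 < d) (hp2 : p < 2) (hp0 : 0 < p) {a R : ℝ}
    (hR : 0 ≤ R) : ∀ᶠ ε in 𝓝[>] (0 : ℝ), R + 3 * cutoffRadius p a ε ≤ outerRadius d p ε := by
  filter_upwards [eventually_mul_log_rpow_le (R + 3 * a) (1 / p) (outerExponent_pos hd hp2),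
    tendsto_log_inv.eventually_ge_atTop 1] with ε h1 h2
  have h3 : 1 ≤ Real.log ε⁻¹ ^ (1 / p) := Real.one_le_rpow h2 (by positivity)
  refine le_trans ?_ (h1.trans (rpow_le_outerRadius d p ε))
  rw [cutoffRadius]
  nlinarith

theorem mul_volume_outerRadius_le (hd : 0 < d) (hp2 : p < 2) {ε : ℝ} (hε : ε ∈ Ioo (0 : ℝ) 1) :
    ε * volume.real (Metric.closedBall (0 : Rd d) (outerRadius d p ε : ℝ)) ≤
      2 ^ d * volume.real (Metric.ball (0 : Rd d) 1) * devScale d p ε := by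
  have hd' : (d : ℝ) ≠ 0 := by positivity
  have hs := outerExponent_pos hd hp2
  set s : ℝ := (1 + (2 - p) / d) / (d : ℝ) with hsdef
  have h1 : 1 ≤ ε ^ (-s) := Real.one_le_rpow_of_pos_of_le_one_of_nonpos hε.1 hε.2.le (by linarith)
  have h2 : (outerRadius d p ε : ℝ) ≤ 2 * ε ^ (-s) := by
    have := (Nat.ceil_lt_add_one (show 0 ≤ ε ^ (-s) by linarith)).le
    rw [outerRadius, ← hsdef]
    linarith
  have h3 : ε * (ε ^ (-s)) ^ d = devScale d p ε := by
    rw [← Real.rpow_natCast, ← Real.rpow_mul hε.1.le, devScale]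
    nth_rewrite 1 [← Real.rpow_one ε]
    rw [← Real.rpow_add hε.1]
    congr 1
    rw [hsdef]; field_simp; ring
  rw [volume_real_closedBall]
  calc ε * ((outerRadius d p ε : ℝ) ^ d * volume.real (Metric.ball (0 : Rd d) 1))
      ≤ ε * ((2 * ε ^ (-s)) ^ d * volume.real (Metric.ball (0 : Rd d) 1)) := by
        have := hε.1.le
        gcongr
    _ = 2 ^ d * volume.real (Metric.ball (0 : Rd d) 1) * (ε * (ε ^ (-s)) ^ d) := by
        rw [mul_pow]; ring
    _ = _ := by rw [h3]

variable {Ω : Type*} [MeasurableSpace Ω] {P : Measure Ω}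
  {N : Ω → Measure (Rd d)}

/-- Outside the ball of radius `outerRadius`, the compensated integral of a tail kernel exceeds
`γ devScale` with a superexponentially small probability. -/
theorem IsTailKernel.eventually_measure_le [IsProbabilityMeasure P] (hd : 0 < d) (hp0 : 0 < p)
    (hp2 : p < 2) (hp : (d : ℝ) / 2 < p) {f : Rd d → ℝ} (hf : IsTailKernel p f)
    (hN : IsPoissonField P N volume) {γ : ℝ} (hγ : 0 < γ) (B : ℝ) : ∀ᶠ ε in 𝓝[>] (0 : ℝ),
      P {w | ∃ c, Tendsto (truncInt (contract ε (N w)) (ENNReal.ofReal ε • volume) f)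
          atTop (𝓝 c) ∧ γ * devScale d p ε <
          |c - truncInt (contract ε (N w)) (ENNReal.ofReal ε • volume) f (outerRadius d p ε)|} ≤
        ENNReal.ofReal (Real.exp (-B * speed d p ε)) := by
  have hT := tailConst_nonneg d p
  have hs := outerExponent_pos hd hp2
  -- the exponential rate `θ log (1/ε)` turns the deviation `γ devScale` into `(|B| + 1) speed`
  set θ : ℝ := (|B| + 1) / γ with hθ
  have hθ0 : 0 < θ := by positivity
  filter_upwards [eventually_mem_Ioo_zero_one,
    eventually_mul_log_rpow_le θ 1 (mul_pos hs hp0),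
    eventually_mul_log_rpow_le (θ ^ 2 * tailConst d p) 2 one_pos,
    eventually_mul_exp_neg_speed_le hd hp2 (2 * Real.exp 1)
      (show B < |B| + 1 by linarith [le_abs_self B])] with ε hε h1 h2 h3
  have hlog : 0 < Real.log ε⁻¹ := Real.log_pos ((one_lt_inv₀ hε.1).2 hε.2)
  have hj := one_le_outerRadius (d := d) (p := p) hε.1
  have hj1 : (1 : ℝ) ≤ outerRadius d p ε := by exact_mod_cast hj
  have h4 : θ * Real.log ε⁻¹ ≤ (outerRadius d p ε : ℝ) ^ p := by
    rw [Real.rpow_one] at h1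
    refine h1.trans ?_
    rw [← neg_mul, Real.rpow_mul hε.1.le]
    exact Real.rpow_le_rpow (Real.rpow_nonneg hε.1.le _) (rpow_le_outerRadius d p ε) hp0.le
  refine (hf.measure_lt_abs_lim_sub_le hp (isPoissonField_contract hd hN hε.1) hε.1.le hj
    (by positivity) h4 _).trans (ENNReal.ofReal_le_ofReal ?_)
  have h5 : (θ * Real.log ε⁻¹) ^ 2 *
      (ε * ((outerRadius d p ε : ℝ) ^ (-(p - d / 2)) * tailConst d p)) ≤ 1 := by
    have h6 : (outerRadius d p ε : ℝ) ^ (-(p - (d : ℝ) / 2)) ≤ 1 :=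
      Real.rpow_le_one_of_one_le_of_nonpos hj1 (by linarith)
    rw [Real.rpow_two, Real.rpow_neg_one] at h2
    have h7 := hε.1
    calc (θ * Real.log ε⁻¹) ^ 2 *
          (ε * ((outerRadius d p ε : ℝ) ^ (-(p - d / 2)) * tailConst d p))
        ≤ (θ * Real.log ε⁻¹) ^ 2 * (ε * (1 * tailConst d p)) := by gcongr
      _ = ε * (θ ^ 2 * tailConst d p * Real.log ε⁻¹ ^ 2) := by ring
      _ ≤ ε * ε⁻¹ := by gcongr
      _ = 1 := mul_inv_cancel₀ hε.1.ne'
  have h8 : θ * Real.log ε⁻¹ * (γ * devScale d p ε) = (|B| + 1) * speed d p ε := by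
    rw [hθ, speed]; field_simp
  rw [h8]
  refine le_trans ?_ h3
  rw [mul_assoc, ← Real.exp_add]
  exact mul_le_mul_of_nonneg_left (Real.exp_le_exp.2 (by linarith)) (by norm_num)

/-- The number of points in the ball of radius `outerRadius` is of smaller order than `speed`, up
to superexponentially small probabilities. -/
theorem eventually_measure_le_count (hd : 0 < d) (hp2 : p < 2) (hN : IsPoissonField P N volume)
    {γ : ℝ} (hγ : 0 < γ) (B : ℝ) : ∀ᶠ ε in 𝓝[>] (0 : ℝ),
      P {w | γ * speed d p ε ≤
          (contract ε (N w)).real (Metric.closedBall 0 (outerRadius d p ε : ℝ))} ≤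
        ENNReal.ofReal (Real.exp (-B * speed d p ε)) := by
  set θ : ℝ := (|B| + 1) / γ with hθ
  have hθ0 : 0 < θ := by positivity
  set v : ℝ := 2 ^ d * volume.real (Metric.ball (0 : Rd d) 1) with hv
  filter_upwards [eventually_mem_Ioo_zero_one,
    tendsto_log_inv.eventually_ge_atTop (v * Real.exp θ)] with ε hε h1
  have hu := devScale_pos (d := d) (p := p) hε.1
  refine ((isPoissonField_contract hd hN hε.1).measure_le_real_le
    Metric.isClosed_closedBall.measurableSet
    (ofReal_smul_volume_ne_top ε measure_closedBall_lt_top.ne) θ _ hθ0).trans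
    (ENNReal.ofReal_le_ofReal (Real.exp_le_exp.2 ?_))
  rw [measureReal_ennreal_smul_apply, ENNReal.toReal_ofReal hε.1.le]
  have h2 := mul_volume_outerRadius_le hd hp2 hε
  have h3 : ε * volume.real (Metric.closedBall (0 : Rd d) (outerRadius d p ε : ℝ)) *
      (Real.exp θ - 1) ≤ speed d p ε := by
    have h4 : 0 ≤ ε * volume.real (Metric.closedBall (0 : Rd d) (outerRadius d p ε : ℝ)) :=
      mul_nonneg hε.1.le measureReal_nonneg
    calc _ ≤ ε * volume.real (Metric.closedBall (0 : Rd d) (outerRadius d p ε : ℝ)) *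
          Real.exp θ := by gcongr; linarith
      _ ≤ v * devScale d p ε * Real.exp θ := by gcongr
      _ = devScale d p ε * (v * Real.exp θ) := by ring
      _ ≤ _ := by rw [speed]; gcongr
  have h5 : θ * (γ * speed d p ε) = (|B| + 1) * speed d p ε := by
    rw [hθ]; field_simp
  have h6 := mul_le_mul_of_nonneg_right (le_abs_self B) (speed_pos (d := d) (p := p) hε).le
  linarith

theorem iSup_sphere_lt {D : Set (Rd d)} {Φ : (Rd d → ℝ) → ℝ} {b c : ℝ} (hbc : b < c)
    (h : ∀ g ∈ sobolevSphere D, Φ g ≤ b) : supSphere D Φ < c :=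
  lt_of_le_of_lt (iSup₂_le fun g hg => EReal.coe_le_coe_iff.2 (h g hg))
    (EReal.coe_lt_coe_iff.2 hbc)

variable {D : Set (Rd d)} {α : ℝ → ℝ} {a R : ℝ}

/-- The integrals of the far kernel are superexponentially negligible, uniformly on the sphere:
their bound involves only the number of points in a ball and finitely many tail kernels. -/
theorem eventually_measure_le_supSphere_Fone [IsProbabilityMeasure P] (hd : 0 < d) (hp0 : 0 < p)
    (hp2 : p < 2) (hp : (d : ℝ) / 2 < p) (hα : IsCutoff α) (ha : 0 < a) (hR : 0 ≤ R)
    (hDm : MeasurableSet D) (hD : D ⊆ Metric.closedBall 0 R) (hρ : rhoStar p D < ⊤)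
    (hN : IsPoissonField P N volume) {γ : ℝ} (hγ : 0 < γ) (B : ℝ) : ∀ᶠ ε in 𝓝[>] (0 : ℝ),
      P {w | ((γ * devScale d p ε : ℝ) : EReal) ≤
          supSphere D (fun g => |Fone p α D a ε (N w) g|)} ≤
        ENNReal.ofReal (Real.exp (-B * speed d p ε)) := by
  have hd4 : (d : ℝ) < 4 := by linarith
  have hT := tailConst_nonneg d p
  have hB1 : B < B + 1 := by linarith
  have hB2 : B + 1 < B + 2 := by linarith
  set v : ℝ := 2 ^ d * volume.real (Metric.ball (0 : Rd d) 1) with hv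
  have hv0 : 0 ≤ v := by positivity
  -- the bound for `Fone` has six terms, each of which gets the share `γ / 10`
  have hγ1 : 0 < a ^ p * (γ / 10) := by positivity
  have hγ2 : 0 < γ / 10 / (d * (p * R) + 1) := by positivity
  have hγ3 : 0 < γ / 10 / (26 * R ^ 2 + 1) := by positivity
  filter_upwards [eventually_mem_Ioo_zero_one, eventually_le_outerRadius hd hp2 (2 * R),
    eventually_cutoffRadius_le_outerRadius hd hp2 hp0 (a := a) hR,
    eventually_measure_le_count hd hp2 hN hγ1 (B + 1),
    (isTailKernel_tailZero hp0.le).eventually_measure_le hd hp0 hp2 hp hN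
      (show 0 < γ / 10 by positivity) (B + 1),
    eventually_sum_le_exp_neg_speed hd hp2 hB2 fun i =>
      (isTailKernel_tailLin hp0.le i).eventually_measure_le hd hp0 hp2 hp hN hγ2 (B + 2),
    (isTailKernel_tailQuad hp0.le).eventually_measure_le hd hp0 hp2 hp hN hγ3 (B + 1),
    eventually_mul_exp_neg_speed_le hd hp2 4 hB1,
    tendsto_log_inv.eventually_ge_atTop (a ^ (-p) * v * (10 / γ)),
    eventually_le_devScale hd hp2 (26 * R ^ 2 * (2 * tailConst d p) * (10 / γ))]
    with ε hε hj2 hj3 hC hZ hL hQ h4 ht hu'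
  have hlog : 0 < Real.log ε⁻¹ := Real.log_pos ((one_lt_inv₀ hε.1).2 hε.2)
  have hu := devScale_pos (d := d) (p := p) hε.1
  set u := devScale d p ε with hudef
  set S := fun w => truncInt (contract ε (N w)) (ENNReal.ofReal ε • volume) with hS
  set j := outerRadius d p ε with hjdef
  set bad : (Rd d → ℝ) → ℝ → Set Ω := fun f r =>
    {w | ∃ c, Tendsto (S w f) atTop (𝓝 c) ∧ r * u < |c - S w f j|} with hbad
  set few : Set Ω := {w | a ^ p * (γ / 10) * speed d p ε ≤
    (contract ε (N w)).real (Metric.closedBall 0 (j : ℝ))} with hfew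
  have hsub : ∀ᵐ w ∂P, w ∈ {w | ((γ * u : ℝ) : EReal) ≤
      supSphere D (fun g => |Fone p α D a ε (N w) g|)} →
      w ∈ few ∪ bad (tailZero p) (γ / 10) ∪
        (⋃ i, bad (tailLin p i) (γ / 10 / (d * (p * R) + 1))) ∪
        bad (tailQuad p) (γ / 10 / (26 * R ^ 2 + 1)) := by
    filter_upwards [(isPoissonField_contract hd hN hε.1).ae_tailRegular hp0.le hp hε.1.le]
      with w hw
    refine fun hw1 => by_contra fun hw2 => ?_
    simp only [mem_union, not_or, mem_iUnion, not_exists, hbad, hfew, mem_ofPred_eq, not_le,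
      not_and, not_lt] at hw2 hw1
    obtain ⟨⟨⟨hc, hz⟩, hl⟩, hq⟩ := hw2
    obtain ⟨c0, hc0⟩ := hw.exists_lim_zero
    choose cl hcl using hw.exists_lim_lin
    obtain ⟨cq, hcq⟩ := hw.exists_lim_quad
    refine absurd hw1 (not_le.2 (iSup_sphere_lt (b := 6 * (γ / 10 * u)) (by nlinarith) ?_))
    intro g hg
    have hmain := hw.abs_Fone_le hα ha hε hp0 hp2.le hp hd4 hR hDm hD hρ hg
      (one_le_outerRadius hε.1) hj2 hj3 hc0 hcl hcq
    have e1 : a ^ (-p) / Real.log ε⁻¹ *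
        (contract ε (N w)).real (Metric.closedBall 0 (j : ℝ)) ≤ γ / 10 * u := by
      calc _ ≤ a ^ (-p) / Real.log ε⁻¹ * (a ^ p * (γ / 10) * speed d p ε) := by gcongr
        _ = (a ^ (-p) * a ^ p) * (γ / 10 * u) * (Real.log ε⁻¹ / Real.log ε⁻¹) := by
            rw [speed]; ring
        _ = γ / 10 * u := by rw [← Real.rpow_add ha, div_self hlog.ne']; simp
    have e2 : a ^ (-p) / Real.log ε⁻¹ *
        (ε * volume.real (Metric.closedBall (0 : Rd d) (j : ℝ))) ≤ γ / 10 * u := by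
      calc _ ≤ a ^ (-p) / Real.log ε⁻¹ * (v * u) := 
            mul_le_mul_of_nonneg_left (mul_volume_outerRadius_le hd hp2 hε) (by positivity)
        _ = (a ^ (-p) * v * (10 / γ)) / Real.log ε⁻¹ * (γ / 10 * u) := by field_simp
        _ ≤ 1 * (γ / 10 * u) := by gcongr; exact (div_le_one hlog).2 ht
        _ = _ := one_mul _
    have e3 := hz c0 hc0
    have e4 : ∑ i, p * R * |cl i - S w (tailLin p i) j| ≤ γ / 10 * u := by
      calc _ ≤ ∑ _i : Fin d, p * R * (γ / 10 / (d * (p * R) + 1) * u) := by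
            refine Finset.sum_le_sum fun i _ => ?_
            have := hl i (cl i) (hcl i)
            gcongr
        _ = d * (p * R) / (d * (p * R) + 1) * (γ / 10 * u) := by
            rw [Finset.sum_const, Finset.card_univ, Fintype.card_fin, nsmul_eq_mul]; ring
        _ ≤ 1 * (γ / 10 * u) := by
            gcongr
            exact (div_le_one (by positivity)).2 (by linarith)
        _ = _ := one_mul _
    have e5 : 26 * R ^ 2 * |cq - S w (tailQuad p) j| ≤ γ / 10 * u := by
      have := hq cq hcq
      calc _ ≤ 26 * R ^ 2 * (γ / 10 / (26 * R ^ 2 + 1) * u) := by gcongr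
        _ = 26 * R ^ 2 / (26 * R ^ 2 + 1) * (γ / 10 * u) := by ring
        _ ≤ 1 * (γ / 10 * u) := by
            gcongr
            exact (div_le_one (by positivity)).2 (by linarith)
        _ = _ := one_mul _
    have e6 : 26 * R ^ 2 * (2 * (ε * tailConst d p)) ≤ γ / 10 * u := by
      have hε1 := hε.2.le
      calc _ ≤ 26 * R ^ 2 * (2 * (1 * tailConst d p)) := by gcongr
        _ = γ / 10 * (26 * R ^ 2 * (2 * tailConst d p) * (10 / γ)) := by field_simp
        _ ≤ γ / 10 * u := by gcongr
    simp only [mul_add] at hmain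
    linarith
  calc P {w | ((γ * u : ℝ) : EReal) ≤ supSphere D (fun g => |Fone p α D a ε (N w) g|)}
      ≤ P (few ∪ bad (tailZero p) (γ / 10) ∪
        (⋃ i, bad (tailLin p i) (γ / 10 / (d * (p * R) + 1))) ∪
        bad (tailQuad p) (γ / 10 / (26 * R ^ 2 + 1))) := measure_mono_ae hsub
    _ ≤ P few + P (bad (tailZero p) (γ / 10)) +
        (∑ i, P (bad (tailLin p i) (γ / 10 / (d * (p * R) + 1)))) +
        P (bad (tailQuad p) (γ / 10 / (26 * R ^ 2 + 1))) := by
        refine (measure_union_le _ _).trans (add_le_add ((measure_union_le _ _).trans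
          (add_le_add (measure_union_le _ _) ?_)) le_rfl)
        exact measure_iUnion_fintype_le _ _
    _ ≤ ENNReal.ofReal (Real.exp (-(B + 1) * speed d p ε)) +
        ENNReal.ofReal (Real.exp (-(B + 1) * speed d p ε)) +
        ENNReal.ofReal (Real.exp (-(B + 1) * speed d p ε)) +
        ENNReal.ofReal (Real.exp (-(B + 1) * speed d p ε)) :=
        add_le_add (add_le_add (add_le_add hC hZ) hL) hQ
    _ = ENNReal.ofReal (4 * Real.exp (-(B + 1) * speed d p ε)) := by
        rw [ENNReal.ofReal_mul (by norm_num)]; norm_num; ring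
    _ ≤ _ := ENNReal.ofReal_le_ofReal h4

end FarPart

/-! ### The near part of the field -/

section NearPart

variable {d : ℕ} {p : ℝ} {Ω : Type*} [MeasurableSpace Ω] {P : Measure Ω} {N : Ω → Measure (Rd d)}
  {D : Set (Rd d)} {α : ℝ → ℝ} {a R : ℝ}

/-- The upper bound: each point of the field contributes at most `ρ*_D`, so that `γ devScale / ρ*_D`
points are needed in the ball of radius `countRadius`. -/
theorem eventually_measure_le_supSphere_Gone [IsProbabilityMeasure P] (hd : 0 < d) (hp0 : 0 < p)
    (hp2 : p < 2) (hp : (d : ℝ) / 2 < p) (hα : IsCutoff α) (ha : 0 < a) (hR : 0 ≤ R)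
    (hDm : MeasurableSet D) (hD : D ⊆ Metric.closedBall 0 R) (hρ0 : 0 < (rhoStar p D).toReal)
    (hρ : rhoStar p D < ⊤) (hN : IsPoissonField P N volume) {γ : ℝ} (hγ : 0 < γ) {B : ℝ}
    (hB : B < (1 + (2 - p) / d) * (γ / (rhoStar p D).toReal)) : ∀ᶠ ε in 𝓝[>] (0 : ℝ),
      P {w | ((γ * devScale d p ε : ℝ) : EReal) ≤
          supSphere D (fun g => Gone p α D a ε (N w) g)} ≤
        ENNReal.ofReal (Real.exp (-B * speed d p ε)) := by
  have hd' : (0 : ℝ) < d := by exact_mod_cast hd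
  have hκ : 0 < (2 - p) / d := div_pos (by linarith) hd'
  set ρ := (rhoStar p D).toReal with hρdef
  set κ := (2 - p) / (d : ℝ) with hκdef
  have hk : 0 < γ / ρ := by positivity
  -- the Chernoff exponent is `θ log (1/ε)` with `θ` slightly below `1 + κ`
  obtain ⟨θ, hθB, hθ1⟩ : ∃ θ, max (B / (γ / ρ)) 0 < θ ∧ θ < 1 + κ :=
    exists_between (max_lt ((div_lt_iff₀ hk).2 hB) (by linarith))
  have hθ0 : 0 < θ := (le_max_right _ _).trans_lt hθB
  have hBθ : B < θ * (γ / ρ) := (div_lt_iff₀ hk).1 ((le_max_left _ _).trans_lt hθB)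
  filter_upwards [eventually_mem_Ioo_zero_one,
    eventually_volume_countRadius_le (d := d) ha hR hp0 1 (show 0 < 1 + κ - θ by linarith),
    tendsto_log_inv.eventually_ge_atTop (1 / (θ * (γ / ρ) - B))] with ε hε hvol ht
  have hlog : 0 < Real.log ε⁻¹ := Real.log_pos ((one_lt_inv₀ hε.1).2 hε.2)
  have hu := devScale_pos (d := d) (p := p) hε.1
  have hsub : ∀ᵐ w ∂P, w ∈ {w | ((γ * devScale d p ε : ℝ) : EReal) ≤
      supSphere D (fun g => Gone p α D a ε (N w) g)} →
      w ∈ {w | γ / ρ * devScale d p ε ≤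
        (contract ε (N w)).real (Metric.closedBall 0 (countRadius p a R ε : ℝ))} := by
    filter_upwards [(isPoissonField_contract hd hN hε.1).ae_tailRegular hp0.le hp hε.1.le]
      with w hw hw1
    have h1 : supSphere D (fun g => Gone p α D a ε (N w) g) ≤
        ((ρ * (contract ε (N w)).real
          (Metric.closedBall 0 (countRadius p a R ε : ℝ)) : ℝ) : EReal) :=
      iSup₂_le fun g hg => EReal.coe_le_coe_iff.2
        (hw.Gone_le hα ha hε hDm hD hρ hg (le_countRadius p a R ε))
    have h2 := EReal.coe_le_coe_iff.1 (le_trans hw1 h1)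
    rw [div_mul_eq_mul_div, div_le_iff₀ hρ0, mul_comm _ ρ]
    exact h2
  refine (measure_mono_ae hsub).trans (((isPoissonField_contract hd hN hε.1).measure_le_real_le
    Metric.isClosed_closedBall.measurableSet
    (ofReal_smul_volume_ne_top ε measure_closedBall_lt_top.ne) (θ * Real.log ε⁻¹) _
    (by positivity)).trans (ENNReal.ofReal_le_ofReal (Real.exp_le_exp.2 ?_)))
  rw [measureReal_ennreal_smul_apply, ENNReal.toReal_ofReal hε.1.le,
    ← rpow_neg_eq_exp_log_inv hε.1]
  set V := volume.real (Metric.closedBall (0 : Rd d) (countRadius p a R ε : ℝ)) with hV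
  have hV0 : 0 ≤ V := measureReal_nonneg
  have h1 : ε * V * (ε ^ (-θ) - 1) ≤ devScale d p ε := by
    have hε0 := hε.1.le
    calc ε * V * (ε ^ (-θ) - 1) ≤ ε * (1 * V) * ε ^ (-θ) := by
          rw [one_mul]; gcongr; linarith
      _ ≤ ε * ε ^ (-(1 + κ - θ)) * ε ^ (-θ) := by gcongr
      _ = ε ^ (1 : ℝ) * ε ^ (-(1 + κ - θ)) * ε ^ (-θ) := by rw [Real.rpow_one]
      _ = devScale d p ε := by
          rw [← Real.rpow_add hε.1, ← Real.rpow_add hε.1, devScale, ← hκdef]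
          ring_nf
  have h2 : devScale d p ε ≤ (θ * (γ / ρ) - B) * speed d p ε := by
    rw [div_le_iff₀ (by linarith)] at ht
    rw [speed]
    nlinarith
  have h3 : θ * Real.log ε⁻¹ * (γ / ρ * devScale d p ε) = θ * (γ / ρ) * speed d p ε := by
    rw [speed]; ring
  linarith

/-- The smoothed Riesz kernel is lower semicontinuous, by Fatou's lemma. -/
theorem eventually_le_smear_riesz (hd : 0 < d) (hρ : rhoStar p D < ⊤) {g : Rd d → ℝ}
    (hg : g ∈ sobolevSphere D) {b : ℝ} {x₀ : Rd d}
    (hb : ENNReal.ofReal b < ∫⁻ y in D, ENNReal.ofReal (g y ^ 2 / ‖y - x₀‖ ^ p)) :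
    ∀ᶠ x in 𝓝 x₀, b ≤ smear D (riesz p) g x := by
  have : Nonempty (Fin d) := ⟨⟨0, hd⟩⟩
  have hK := isSubRiesz_riesz (d := d) p
  set f : Rd d → Rd d → ENNReal := fun x y => ENNReal.ofReal (riesz p (y - x) * g y ^ 2) with hf
  have hlim : ∀ y, y ≠ x₀ → Tendsto (fun x => f x y) (𝓝 x₀) (𝓝 (f x₀ y)) := by
    intro y hy
    have h1 : ‖y - x₀‖ ≠ 0 := norm_ne_zero_iff.2 (sub_ne_zero.2 hy)
    have h2 : ContinuousAt (fun x : Rd d => riesz p (y - x)) x₀ := by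
      unfold riesz
      have h3 : ContinuousAt (fun x : Rd d => ‖y - x‖) x₀ := by fun_prop
      refine continuousAt_const.div (h3.rpow_const (Or.inl h1)) ?_
      exact (Real.rpow_pos_of_pos (norm_pos_iff.2 (sub_ne_zero.2 hy)) _).ne'
    exact (ENNReal.continuous_ofReal.tendsto _).comp (h2.mul continuousAt_const)
  have hlow : ∫⁻ y in D, f x₀ y ≤ liminf (fun x => ∫⁻ y in D, f x y) (𝓝 x₀) := by
    refine le_trans (lintegral_mono_ae ?_)
      (lintegral_liminf_le' fun x => (hK.aestronglyMeasurable hg x).aemeasurable.ennreal_ofReal)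
    have h1 : ∀ᵐ y ∂(volume.restrict D), y ≠ x₀ :=
      ae_restrict_of_ae (Measure.ae_ne volume x₀)
    filter_upwards [h1] with y hy
    exact (hlim y hy).liminf_eq.ge
  have hlt : ENNReal.ofReal b < liminf (fun x => ∫⁻ y in D, f x y) (𝓝 x₀) := by
    refine hb.trans_le (le_trans (le_of_eq (lintegral_congr fun y => ?_)) hlow)
    simp only [hf, riesz]
    congr 1
    ring
  filter_upwards [eventually_lt_of_lt_liminf hlt] with x hx
  rw [smear, integral_eq_lintegral_of_nonneg_ae
    (ae_of_all _ fun _ => mul_nonneg (hK.nonneg _) (sq_nonneg _)) (hK.aestronglyMeasurable hg x)]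
  exact (ENNReal.ofReal_le_iff_le_toReal ((hK.lintegral_le hg x).trans_lt hρ).ne).1 hx.le

/-- A lower bound for Poisson probabilities, from `k! ≤ k ^ k`. -/
theorem exp_neg_sub_mul_log_le_poisson {r : ℝ} (hr : 0 < r) {k : ℕ} (hk : 1 ≤ k) :
    Real.exp (-r - k * Real.log (k / r)) ≤ Real.exp (-r) * r ^ k / k.factorial := by
  have hk0 : (0 : ℝ) < k := by exact_mod_cast hk
  have h1 : (k.factorial : ℝ) ≤ (k : ℝ) ^ k := by exact_mod_cast Nat.factorial_le_pow k
  have h2 : Real.exp (k * Real.log (k / r)) = (k / r) ^ k := by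
    rw [Real.exp_nat_mul, Real.exp_log (by positivity)]
  rw [Real.exp_sub, h2, div_pow, mul_div_assoc, div_eq_mul_inv, inv_div]
  gcongr

/-- The probability that a Poisson field with intensity `ε dx` has about `c devScale` points in a
fixed set of positive volume: each point costs a factor `ε / devScale`. -/
theorem eventually_exp_neg_speed_le_poisson (hd : 0 < d) (hp2 : p < 2) {v c C B : ℝ} (hv : 0 < v)
    (hc : 0 < c) (hB : (1 + (2 - p) / d) * c < B) : ∀ᶠ ε in 𝓝[>] (0 : ℝ), ∀ k : ℕ, 1 ≤ k →
      (k : ℝ) ≤ c * devScale d p ε + C →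
      Real.exp (-B * speed d p ε) ≤ Real.exp (-(ε * v)) * (ε * v) ^ k / k.factorial := by
  have hd' : (0 : ℝ) < d := by exact_mod_cast hd
  have hκ : 0 < (2 - p) / d := div_pos (by linarith) hd'
  set κ := (2 - p) / (d : ℝ) with hκdef
  -- the additive constant `C` and the lower order terms are absorbed by `c' > c`
  obtain ⟨c', hc', hc'B⟩ : ∃ c', c < c' ∧ c' < B / (1 + κ) :=
    exists_between ((lt_div_iff₀ (by linarith)).2 (by linarith))
  rw [lt_div_iff₀ (by linarith)] at hc'B
  have hc'0 : 0 < c' := hc.trans hc'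
  set A := |Real.log c'| + |Real.log v| with hA
  filter_upwards [eventually_mem_Ioo_zero_one, eventually_le_devScale hd hp2 (C / (c' - c)),
    eventually_le_devScale hd hp2 1,
    tendsto_log_inv.eventually_ge_atTop ((c' * A + v) / (B - c' * (1 + κ)))]
    with ε hε h1 h2 h3 k hk1 hk2
  have hlog : 0 < Real.log ε⁻¹ := Real.log_pos ((one_lt_inv₀ hε.1).2 hε.2)
  have hu := devScale_pos (d := d) (p := p) hε.1
  have hk0 : (0 : ℝ) < k := by exact_mod_cast hk1
  have hlogu : Real.log (devScale d p ε) = κ * Real.log ε⁻¹ := by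
    rw [devScale, rpow_neg_eq_exp_log_inv hε.1, Real.log_exp]
  refine le_trans (Real.exp_le_exp.2 ?_) (exp_neg_sub_mul_log_le_poisson (mul_pos hε.1 hv) hk1)
  rw [div_le_iff₀ (by linarith)] at h1 h3
  have hk3 : (k : ℝ) ≤ c' * devScale d p ε := by linarith
  have h4 : Real.log (k / (ε * v)) ≤ (1 + κ) * Real.log ε⁻¹ + A := by
    calc Real.log (k / (ε * v)) ≤ Real.log (c' * devScale d p ε / (ε * v)) :=
          Real.log_le_log (div_pos hk0 (mul_pos hε.1 hv))
            (div_le_div_of_nonneg_right hk3 (mul_pos hε.1 hv).le)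
      _ = Real.log c' + κ * Real.log ε⁻¹ + Real.log ε⁻¹ - Real.log v := by
          rw [Real.log_div (by positivity) (mul_pos hε.1 hv).ne', Real.log_mul hc'0.ne' hu.ne',
            Real.log_mul hε.1.ne' hv.ne', hlogu, Real.log_inv]
          ring
      _ ≤ _ := by
          have := le_abs_self (Real.log c')
          have := neg_abs_le (Real.log v)
          rw [hA]; linarith
  have hA0 : 0 ≤ A := by positivity
  have h5 : k * Real.log (k / (ε * v)) ≤
      c' * devScale d p ε * ((1 + κ) * Real.log ε⁻¹ + A) := by
    calc _ ≤ k * ((1 + κ) * Real.log ε⁻¹ + A) := by gcongr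
      _ ≤ _ := by gcongr
  have h6 : ε * v ≤ v * devScale d p ε := by
    have := hε.2
    nlinarith
  have h7 := mul_le_mul_of_nonneg_right h3 hu.le
  rw [speed]
  nlinarith

/-- The lower bound: place `γ devScale / b` points, with `b` slightly below `ρ*_D`, where the
smoothed Riesz kernel of a nearly optimal `g` is at least `b`. -/
theorem eventually_le_measure_le_supSphere_Gone [IsProbabilityMeasure P] (hd : 0 < d)
    (hp0 : 0 < p) (hp2 : p < 2) (hp : (d : ℝ) / 2 < p) (hα : IsCutoff α) (ha : 0 < a) (hR : 0 ≤ R)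
    (hDm : MeasurableSet D) (hD : D ⊆ Metric.closedBall 0 R) (hρ0 : 0 < (rhoStar p D).toReal)
    (hρ : rhoStar p D < ⊤) (hN : IsPoissonField P N volume) {γ : ℝ} (hγ : 0 < γ) {B : ℝ}
    (hB : (1 + (2 - p) / d) * (γ / (rhoStar p D).toReal) < B) : ∀ᶠ ε in 𝓝[>] (0 : ℝ),
      ENNReal.ofReal (Real.exp (-B * speed d p ε)) ≤
        P {w | ((γ * devScale d p ε : ℝ) : EReal) ≤
          supSphere D (fun g => Gone p α D a ε (N w) g)} := by
  have hd' : (0 : ℝ) < d := by exact_mod_cast hd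
  have hκ : 0 < (2 - p) / d := div_pos (by linarith) hd'
  set ρ := (rhoStar p D).toReal with hρdef
  set κ := (2 - p) / (d : ℝ) with hκdef
  have hB0 : 0 < B := lt_trans (by positivity) hB
  obtain ⟨b, hb1, hb2⟩ : ∃ b, (1 + κ) * γ / B < b ∧ b < ρ := by
    refine exists_between ((div_lt_iff₀ hB0).2 ?_)
    rw [← mul_div_assoc, div_lt_iff₀ hρ0] at hB
    linarith
  have hb0 : 0 < b := lt_trans (by positivity) hb1
  have hbB : (1 + κ) * (γ / b) < B := by
    rw [div_lt_iff₀ hB0] at hb1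
    rw [← mul_div_assoc, div_lt_iff₀ hb0]
    linarith
  have hbρ : ENNReal.ofReal b < rhoStar p D := (ENNReal.ofReal_lt_iff_lt_toReal hb0.le hρ.ne).2 hb2
  obtain ⟨g, hg, x₀, hx₀⟩ : ∃ g ∈ sobolevSphere D, ∃ x₀,
      ENNReal.ofReal b < ∫⁻ y in D, ENNReal.ofReal (g y ^ 2 / ‖y - x₀‖ ^ p) := by
    simpa only [rhoStar, lt_iSup_iff, exists_prop] using hbρ
  obtain ⟨r, hr, hball⟩ :=
    Metric.nhds_basis_closedBall.eventually_iff.1 (eventually_le_smear_riesz hd hρ hg hx₀)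
  set V := Metric.closedBall x₀ r with hV
  have hVtop : volume V < ⊤ := measure_closedBall_lt_top
  have hv : 0 < volume.real V :=
    ENNReal.toReal_pos (Metric.measure_closedBall_pos volume x₀ hr).ne' hVtop.ne
  filter_upwards [eventually_mem_Ioo_zero_one,
    eventually_volume_countRadius_le (d := d) ha hR hp0 ρ one_pos,
    ((tendsto_rpow_atTop (show 0 < 1 / p by positivity)).comp
      tendsto_log_inv).eventually_ge_atTop ((R + ‖x₀‖ + r) / a),
    eventually_exp_neg_speed_le_poisson hd hp2 (C := 1 / b + 1) hv (show 0 < γ / b by positivity)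
      hbB] with ε hε hvol hcut hpois
  have hcut' : R + ‖x₀‖ + r ≤ cutoffRadius p a ε := by
    rw [cutoffRadius, mul_comm]; exact (div_le_iff₀ ha).1 hcut
  have hu := devScale_pos (d := d) (p := p) hε.1
  have hVn : ∀ x ∈ V, ‖x‖ ≤ ‖x₀‖ + r := fun x hx => by
    have h1 := norm_le_norm_add_norm_sub' x x₀
    have h2 : ‖x - x₀‖ ≤ r := mem_closedBall_iff_norm.1 hx
    linarith
  -- the summand `1` outweighs the compensator
  set k := ⌈(γ * devScale d p ε + 1) / b⌉₊ with hk
  have hk1 : 1 ≤ k := Nat.one_le_ceil_iff.2 (by positivity)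
  have hk2 : (k : ℝ) ≤ γ / b * devScale d p ε + (1 / b + 1) := by
    refine (Nat.ceil_lt_add_one (by positivity)).le.trans (le_of_eq ?_)
    ring
  have hk3 : γ * devScale d p ε + 1 ≤ b * k := by
    have := Nat.le_ceil ((γ * devScale d p ε + 1) / b)
    rw [div_le_iff₀ hb0] at this
    rw [mul_comm b]; exact this
  have hNε := isPoissonField_contract hd hN hε.1
  calc ENNReal.ofReal (Real.exp (-B * speed d p ε))
      ≤ P {w | contract ε (N w) V = k} := by
        rw [hNε.measure_eq Metric.isClosed_closedBall.measurableSet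
          (ofReal_smul_volume_ne_top ε hVtop.ne), measureReal_ennreal_smul_apply,
          ENNReal.toReal_ofReal hε.1.le]
        exact ENNReal.ofReal_le_ofReal (hpois k hk1 hk2)
    _ ≤ _ := measure_mono_ae ?_
  filter_upwards [hNε.ae_tailRegular hp0.le hp hε.1.le] with w hw hwk
  have hwk' : (contract ε (N w)).real V = k := by
    rw [measureReal_def, show contract ε (N w) V = k from hwk, ENNReal.toReal_natCast]
  have hVj : V ⊆ Metric.closedBall 0 (countRadius p a R ε : ℝ) := fun x hx => by
    rw [mem_closedBall_zero_iff]
    have h1 := hVn x hx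
    have h2 := le_countRadius p a R ε
    have h3 := cutoffRadius_pos ha hε p
    linarith
  have hlow := hw.le_Gone hα ha hε hDm hD hρ hg (le_countRadius p a R ε)
    Metric.isClosed_closedBall.measurableSet hVj (b := b) fun x hx => by
      rw [smear_congr hDm g fun y hy => ?_]
      · exact hball hx
      · refine kerK_eq_riesz hα ha hε ((norm_sub_le _ _).trans ?_)
        have h1 := hVn x hx
        have h2 := mem_closedBall_zero_iff.1 (hD hy)
        linarith
  have hsmall : ε * (ρ * volume.real
      (Metric.closedBall (0 : Rd d) (countRadius p a R ε : ℝ))) ≤ 1 := by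
    rw [Real.rpow_neg_one] at hvol
    exact (mul_le_mul_of_nonneg_left hvol hε.1.le).trans (mul_inv_cancel₀ hε.1.ne').le
  rw [hwk'] at hlow
  exact le_iSup₂_of_le g hg (EReal.coe_le_coe_iff.2 (by linarith))

end NearPart

/-! ### The sum of the two parts -/

section Sum

variable {d : ℕ} {p : ℝ} {D : Set (Rd d)}

theorem le_of_supSphere_lt {Φ : (Rd d → ℝ) → ℝ} {b : ℝ} (h : supSphere D Φ < b) {g : Rd d → ℝ}
    (hg : g ∈ sobolevSphere D) : Φ g < b :=
  EReal.coe_lt_coe_iff.1 ((le_iSup₂ (f := fun g (_ : g ∈ sobolevSphere D) => (Φ g : EReal))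
    g hg).trans_lt h)

theorem le_supSphere_or_of_le_add {Φ Ψ F : (Rd d → ℝ) → ℝ}
    (h : ∀ g ∈ sobolevSphere D, Φ g ≤ Ψ g + |F g|) {b c : ℝ} (hbc : b < c)
    (hc : (c : EReal) ≤ supSphere D Φ) :
    (b : EReal) ≤ supSphere D Ψ ∨ (((c - b) / 2 : ℝ) : EReal) ≤ supSphere D fun g => |F g| := by
  by_contra! hcon
  refine absurd hc (not_le.2 (iSup_sphere_lt (b := b + (c - b) / 2) (by linarith) fun g hg => ?_))
  have h1 := le_of_supSphere_lt hcon.1 hg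
  have h2 := le_of_supSphere_lt hcon.2 hg
  linarith [h g hg]

variable {Ω : Type*} [MeasurableSpace Ω] {P : Measure Ω}

/-- A perturbation with superexponentially small deviations does not increase deviation
probabilities on the exponential scale. -/
theorem eventually_measure_le_supSphere_add {Φ Ψ F : ℝ → Ω → (Rd d → ℝ) → ℝ}
    (h : ∀ ε ∈ Ioo (0 : ℝ) 1, ∀ᵐ w ∂P, ∀ g ∈ sobolevSphere D, Φ ε w g ≤ Ψ ε w g + |F ε w g|)
    {γ γ' : ℝ} (hγ : γ < γ') {B : ℝ} (hF : ∀ᶠ ε in 𝓝[>] (0 : ℝ),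
      P {w | (((γ' - γ) / 2 * devScale d p ε : ℝ) : EReal) ≤ supSphere D fun g => |F ε w g|} ≤
        ENNReal.ofReal (Real.exp (-B * speed d p ε))) :
    ∀ᶠ ε in 𝓝[>] (0 : ℝ),
      P {w | ((γ' * devScale d p ε : ℝ) : EReal) ≤ supSphere D (Φ ε w)} ≤
        P {w | ((γ * devScale d p ε : ℝ) : EReal) ≤ supSphere D (Ψ ε w)} +
          ENNReal.ofReal (Real.exp (-B * speed d p ε)) := by
  filter_upwards [hF, eventually_mem_Ioo_zero_one] with ε h1 hε
  have hu := devScale_pos (d := d) (p := p) hε.1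
  refine le_trans (measure_mono_ae ?_) ((measure_union_le _ _).trans (add_le_add le_rfl h1))
  filter_upwards [h ε hε] with w hw hw1
  refine (le_supSphere_or_of_le_add hw (by gcongr) hw1).imp id fun h2 => ?_
  rw [← sub_mul, mul_div_right_comm] at h2
  exact h2

/-- Families whose difference has superexponentially small deviations have the same linear rate
function: the level `γ` is perturbed by an arbitrarily small proportion. -/
theorem tendsto_scaledLog_supSphere_add (hd : 0 < d) (hp2 : p < 2)
    {Φ Ψ F : ℝ → Ω → (Rd d → ℝ) → ℝ}
    (h : ∀ ε ∈ Ioo (0 : ℝ) 1, ∀ᵐ w ∂P, ∀ g ∈ sobolevSphere D, Φ ε w g = Ψ ε w g + F ε w g)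
    (hF : ∀ r > 0, ∀ B : ℝ, ∀ᶠ ε in 𝓝[>] (0 : ℝ),
      P {w | ((r * devScale d p ε : ℝ) : EReal) ≤ supSphere D fun g => |F ε w g|} ≤
        ENNReal.ofReal (Real.exp (-B * speed d p ε)))
    {c : ℝ} (hc : 0 < c)
    (hup : ∀ r > 0, ∀ B < c * r, ∀ᶠ ε in 𝓝[>] (0 : ℝ),
      P {w | ((r * devScale d p ε : ℝ) : EReal) ≤ supSphere D (Ψ ε w)} ≤
        ENNReal.ofReal (Real.exp (-B * speed d p ε)))
    (hlow : ∀ r > 0, ∀ B > c * r, ∀ᶠ ε in 𝓝[>] (0 : ℝ),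
      ENNReal.ofReal (Real.exp (-B * speed d p ε)) ≤
        P {w | ((r * devScale d p ε : ℝ) : EReal) ≤ supSphere D (Ψ ε w)})
    {γ : ℝ} (hγ : 0 < γ) :
    Tendsto (fun ε => scaledLog P d p ε
      {w | ((γ * devScale d p ε : ℝ) : EReal) ≤ supSphere D (Φ ε w)})
      (𝓝[>] 0) (𝓝 ((-(c * γ) : ℝ) : EReal)) := by
  have h1 : ∀ ε ∈ Ioo (0 : ℝ) 1, ∀ᵐ w ∂P, ∀ g ∈ sobolevSphere D,
      Φ ε w g ≤ Ψ ε w g + |F ε w g| := fun ε hε => by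
    filter_upwards [h ε hε] with w hw g hg
    linarith [hw g hg, le_abs_self (F ε w g)]
  have h2 : ∀ ε ∈ Ioo (0 : ℝ) 1, ∀ᵐ w ∂P, ∀ g ∈ sobolevSphere D,
      Ψ ε w g ≤ Φ ε w g + |F ε w g| := fun ε hε => by
    filter_upwards [h ε hε] with w hw g hg
    linarith [hw g hg, neg_abs_le (F ε w g)]
  refine tendsto_scaledLog (fun B hB => ?_) fun B hB => ?_
  · obtain ⟨r, hr, hrγ⟩ : ∃ r, max (B / c) 0 < r ∧ r < γ :=
      exists_between (max_lt ((div_lt_iff₀' hc).2 hB) hγ)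
    obtain ⟨B', hB', hB'r⟩ := exists_between ((div_lt_iff₀' hc).1 ((le_max_left _ _).trans_lt hr))
    filter_upwards [eventually_measure_le_supSphere_add h1 hrγ (hF _ (by linarith) B'),
      hup r ((le_max_right _ _).trans_lt hr) B' hB'r,
      eventually_mul_exp_neg_speed_le hd hp2 2 hB'] with ε e1 e2 e3
    refine e1.trans ((add_le_add e2 le_rfl).trans ?_)
    rw [← two_mul, ← ENNReal.ofReal_ofNat 2, ← ENNReal.ofReal_mul (by norm_num)]
    exact ENNReal.ofReal_le_ofReal e3
  · obtain ⟨r, hγr, hr⟩ : ∃ r, γ < r ∧ r < B / c := exists_between ((lt_div_iff₀' hc).2 hB)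
    obtain ⟨B', hrB', hB'⟩ := exists_between ((lt_div_iff₀' hc).1 hr)
    filter_upwards [eventually_measure_le_supSphere_add h2 hγr (hF _ (by linarith) B),
      hlow r (by linarith) B' hrB',
      eventually_mul_exp_neg_speed_le hd hp2 2 hB'] with ε e1 e2 e3
    have e4 := ENNReal.ofReal_le_ofReal e3
    rw [ENNReal.ofReal_mul (by norm_num), ENNReal.ofReal_ofNat, two_mul] at e4
    exact ENNReal.le_of_add_le_add_right ENNReal.ofReal_ne_top (e4.trans (e2.trans e1))

end Sum

end

theorem theorem3p2 {Ω : Type*} [MeasurableSpace Ω] (P : Measure Ω) [IsProbabilityMeasure P]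
    (d : ℕ) (p : ℝ) (hp : (d : ℝ) / 2 < p) (hp' : p < min 2 (d : ℝ))
    (D : Set (Rd d)) (hDo : IsOpen D) (hDb : Bornology.IsBounded D) (hDn : D.Nonempty)
    (α : ℝ → ℝ) (hα : IsCutoff α)
    (N : Ω → Measure (Rd d)) (hN : IsPoissonField P N volume)
    (a γ : ℝ) (ha : 0 < a) (hγ : 0 < γ) :
    -- the Poisson integrals are almost surely well defined, for all `g` simultaneously
    (∀ ε ∈ Ioo (0 : ℝ) 1, ∀ᵐ w ∂P, ∀ g ∈ sobolevSphere D,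
      PoissonIntegrable D (kerK p α a ε) ε (N w) g ∧
      PoissonIntegrable D (kerL p α a ε) ε (N w) g ∧
      PoissonIntegrable D (riesz p) ε (N w) g) ∧
    0 < rhoStar p D ∧ rhoStar p D < ⊤ ∧
    Tendsto (fun ε : ℝ => scaledLog P d p ε
        {w | ((γ * ε ^ (-((2 - p) / (d : ℝ))) : ℝ) : EReal) ≤
          supSphere D (fun g => |Fone p α D a ε (N w) g|)})
      (𝓝[>] 0) (𝓝 ⊥) ∧
    Tendsto (fun ε : ℝ => scaledLog P d p ε
        {w | ((γ * ε ^ (-((2 - p) / (d : ℝ))) : ℝ) : EReal) ≤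
          supSphere D (fun g => Gone p α D a ε (N w) g)})
      (𝓝[>] 0) (𝓝 ((-((2 + d - p) / (d * (rhoStar p D).toReal) * γ) : ℝ) : EReal)) ∧
    Tendsto (fun ε : ℝ => scaledLog P d p ε
        {w | ((γ * ε ^ (-((2 - p) / (d : ℝ))) : ℝ) : EReal) ≤
          supSphere D (fun g => zeta p D ε (N w) g)})
      (𝓝[>] 0) (𝓝 ((-((2 + d - p) / (d * (rhoStar p D).toReal) * γ) : ℝ) : EReal)) := by
  have hp2 : p < 2 := hp'.trans_le (min_le_left _ _)
  have hpd : p < d := hp'.trans_le (min_le_right _ _)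
  have hd' : (0 : ℝ) < d := by linarith
  have hd : 0 < d := by exact_mod_cast hd'
  have hd4 : (d : ℝ) < 4 := by linarith
  have hp0 : 0 < p := by linarith
  have hDm := hDo.measurableSet
  obtain ⟨R, hR, hD⟩ := hDb.subset_closedBall_lt 0 0
  have hρ := rhoStar_lt_top hp0.le hp2 hpd hDm hDb
  have hρ' := rhoStar_pos hd p hDo hDn
  have hρ0 : 0 < (rhoStar p D).toReal := ENNReal.toReal_pos hρ'.ne' hρ.ne
  have hreg : ∀ ε ∈ Ioo (0 : ℝ) 1, ∀ᵐ w ∂P, TailRegular p ε (contract ε (N w)) := fun ε hε =>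
    (isPoissonField_contract hd hN hε.1).ae_tailRegular hp0.le hp hε.1.le
  have hc : 0 < (1 + (2 - p) / d) / (rhoStar p D).toReal := by
    have := div_pos (sub_pos.2 hp2) hd'
    positivity
  have hrate : (2 + d - p) / (d * (rhoStar p D).toReal) * γ =
      (1 + (2 - p) / d) / (rhoStar p D).toReal * γ := by
    field_simp; ring
  have hF : ∀ r > 0, ∀ B : ℝ, ∀ᶠ ε in 𝓝[>] (0 : ℝ),
      P {w | ((r * devScale d p ε : ℝ) : EReal) ≤
        supSphere D (fun g => |Fone p α D a ε (N w) g|)} ≤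
      ENNReal.ofReal (Real.exp (-B * speed d p ε)) := fun r hr B =>
    eventually_measure_le_supSphere_Fone hd hp0 hp2 hp hα ha hR.le hDm hD hρ hN hr B
  have hup : ∀ r > 0, ∀ B < (1 + (2 - p) / d) / (rhoStar p D).toReal * r, ∀ᶠ ε in 𝓝[>] (0 : ℝ),
      P {w | ((r * devScale d p ε : ℝ) : EReal) ≤
        supSphere D (fun g => Gone p α D a ε (N w) g)} ≤
      ENNReal.ofReal (Real.exp (-B * speed d p ε)) := fun r hr B hB =>
    eventually_measure_le_supSphere_Gone hd hp0 hp2 hp hα ha hR.le hDm hD hρ0 hρ hN hr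
      (by rwa [← mul_div_assoc, mul_div_right_comm])
  have hlow : ∀ r > 0, ∀ B > (1 + (2 - p) / d) / (rhoStar p D).toReal * r, ∀ᶠ ε in 𝓝[>] (0 : ℝ),
      ENNReal.ofReal (Real.exp (-B * speed d p ε)) ≤
      P {w | ((r * devScale d p ε : ℝ) : EReal) ≤
        supSphere D (fun g => Gone p α D a ε (N w) g)} := fun r hr B hB =>
    eventually_le_measure_le_supSphere_Gone hd hp0 hp2 hp hα ha hR.le hDm hD hρ0 hρ hN hr
      (by rwa [← mul_div_assoc, mul_div_right_comm])
  rw [hrate]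
  refine ⟨fun ε hε => ?_, hρ', hρ, tendsto_scaledLog_bot (hF γ hγ),
    tendsto_scaledLog (hup γ hγ) (hlow γ hγ),
    tendsto_scaledLog_supSphere_add hd hp2 (fun ε hε => ?_) hF hc hup hlow hγ⟩
  · filter_upwards [hreg ε hε] with w hw g hg
    exact ⟨hw.poissonIntegrable_kerK hα ha hε hDm hD hρ hg,
      hw.poissonIntegrable_kerL hα ha hε hp0.le hp2.le hp hd4 hR.le hDm hD hρ hg,
      hw.poissonIntegrable_riesz hp0.le hp2.le hp hd4 hR.le hDm hD hρ hg hε.1.le⟩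
  · filter_upwards [hreg ε hε] with w hw g hg
    exact hw.zeta_eq hα ha hε hp0.le hp2.le hp hd4 hR.le hDm hD hρ hg
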